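/- **Setting.** Let $G$ be a complex semisimple Lie group with Lie algebra $\mathfrak g$ and Maurer–Cartan form $\theta$, let $M$ be a one-dimensional complex manifold, and let $\mathfrak g=\bigoplus_{m\in\mathbb Z}\mathfrak g_m$ be a $\mathbb Z$-gradation. Put $\tilde{\mathfrak n}_+=\bigoplus_{m>0}\mathfrak g_m$, $\tilde{\mathfrak n}_-=\bigoplus_{m<0}\mathfrak g_m$, $\tilde{\mathfrak b}_+=\bigoplus_{m\ge 0}\mathfrak g_m$, $\tilde{\mathfrak b}_-=\bigoplus_{m\le 0}\mathfrak g_m$, $\tilde{\mathfrak h}=\mathfrak g_0$, and let $\tilde N_\pm,\tilde B_\pm,\tilde H$ be the corresponding connected subgroups of $G$. Let $\pi_\pm:G\to F_\pm=G/\tilde B_\mp$ be the projections. Fix nonzero $x_\pm\in\mathfrak g_{\pm1}$ and let $\mathcal O_\pm=\mathrm{Ad}(\tilde H)x_\pm$. All mappings are smooth ($C^\infty$ over $\mathbb R$). In a local holomorphic coordinate $z$ a $\mathfrak g$-valued 1-form is written $\omega=\omega_-dz+\omega_+d\bar z$; for a mapping $\psi$ into $G$ write ${}^\psi\omega=\psi^*\theta$,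 and for a 1-form $\omega$ the gauge transform by $\psi$ is $\mathrm{Ad}(\psi^{-1})\circ\omega+\psi^*\theta$. A mapping $\varphi:M\to G$ is *admissible* if, for every local coordinate $z$, $({}^\varphi\omega)_-$ takes values in $\mathfrak g_{-1}\oplus\mathfrak g_0$, $({}^\varphi\omega)_+$ takes values in $\mathfrak g_0\oplus\mathfrak g_{1}$, and, with $\varphi_\pm=\pi_\pm\circ\varphi$, for every $p$ in the domain of $z$ one has $\varphi_{-*}(\partial_{z}|_p)\in\pi_{-*}(L_{g*}\mathcal O_-)$ for all $g$ with $\pi_-(g)=\varphi_-(p)$ and $\varphi_{+*}(\partial_{\bar z}|_p)\in\pi_{+*}(L_{g*}\mathcal O_+)$ for all $g$ with $\pi_+(g)=\varphi_+(p)$. Given an open set $W$ in the domain of $z$ and $g_\pm\in G$, *Gauss data* for $\varphi$ on $W$ consist of decompositions on $W$ $$\varphi=\mu_+\nu_-\eta_-=\mu_-\nu_+\eta_+,$$ with smooth $\mu_\pm:W\to g_\pm\tilde N_\pm$, $\nu_\pm:W\to\tilde N_\pm$, $\eta_\pm:W\to\tilde H$, together with a holomorphic $\gamma_-:W\to\tilde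 H$ and an antiholomorphic $\gamma_+:W\to\tilde H$ such that $({}^{\mu_-}\omega)_-=\sqrt{-1}\,\mathrm{Ad}(\gamma_-)x_-$ and $({}^{\mu_+}\omega)_+=\sqrt{-1}\,\mathrm{Ad}(\gamma_+)x_+$. For such data put $\gamma=\gamma_+^{-1}\eta_-\eta_+^{-1}\gamma_-$. **Theorem.** Let $z$ be a local holomorphic coordinate on $M$. 1. Let $\varphi:M\to G$ be admissible. (a) For every $p$ in the domain of $z$ and all $g_\pm\in G$ with $\varphi(p)\in g_+\tilde N_+\tilde B_-\cap g_-\tilde N_-\tilde B_+$ (for instance $g_\pm=\varphi(p)$), Gauss data for $\varphi$ exist on some open neighbourhood of $p$ in the domain of $z$. (b) For any Gauss data for $\varphi$ on any open subset $W$ of the domain of $z$, $\gamma$ takes values in $\tilde H$, and there is a smooth mapping $\psi:W\to\tilde H$ whose gauge transformation takes ${}^\varphi\omega$ to ${}^{\varphi'}\omega$, where $\varphi'=\varphi\psi$ and $${}^{\varphi'}\omega=\bigl(\sqrt{-1}\,x_-+({}^\gamma\omega)_-\bigr)dz+\sqrt{-1}\,\mathrm{Ad}(\gamma^{-1})x_+\,d\bar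 z\quad\text{on } W.$$ Moreover $\gamma$ satisfies on $W$ the Toda equation $$\partial_{\bar z}\bigl(({}^\gamma\omega)_-\bigr)=[\mathrm{Ad}(\gamma^{-1})x_+,x_-],$$ which for a linear group reads $\partial_{\bar z}(\gamma^{-1}\partial_z\gamma)=[\gamma^{-1}x_+\gamma,x_-]$. 2. For any open subset $W$ of the domain of $z$ and any smooth $\gamma:W\to\tilde H$, the connection form $\omega=(\sqrt{-1}\,x_-+({}^\gamma\omega)_-)dz+\sqrt{-1}\,\mathrm{Ad}(\gamma^{-1})x_+d\bar z$ satisfies the zero curvature condition $\partial_z\omega_+-\partial_{\bar z}\omega_-+[\omega_-,\omega_+]=0$ on $W$ if and only if $\gamma$ satisfies the Toda equation on $W$. -/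

import Mathlib

open Set
open scoped Manifold ContDiff

noncomputable section

namespace Toda

section Group

variable {E : Type*} [NormedAddCommGroup E] [NormedSpace ℂ E]
  {G : Type*} [TopologicalSpace G] [ChartedSpace E G] [Group G]

/-- The Maurer-Cartan form `θ_g = (L_{g⁻¹})_*` of the complex Lie group `G`.  The value lies in the
tangent space at `g⁻¹ * g = 1`. -/
def maurerCartan (g : G) : TangentSpace 𝓘(ℂ, E) g →L[ℂ] GroupLieAlgebra 𝓘(ℂ, E) G :=
  mfderiv 𝓘(ℂ, E) 𝓘(ℂ, E) (fun h : G => g⁻¹ * h) g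

/-- The adjoint representation: `Ad g` is the derivative at `1` of `h ↦ g * h * g⁻¹`. -/
def Ad (g : G) : GroupLieAlgebra 𝓘(ℂ, E) G →L[ℂ] GroupLieAlgebra 𝓘(ℂ, E) G :=
  mfderiv 𝓘(ℂ, E) 𝓘(ℂ, E) (fun h : G => g * h * g⁻¹) 1

/-- `IsExp X g` means `g = exp X`: the integral curve through `1` of the left invariant vector
field generated by `X` reaches `g` at time `1`. -/
def IsExp (X : GroupLieAlgebra 𝓘(ℂ, E) G) (g : G) : Prop :=
  ∃ c : ℝ → G, IsMIntegralCurve (I := 𝓘(ℝ, E)) c (fun h => mulInvariantVectorField X h) ∧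
    c 0 = 1 ∧ c 1 = g

/-- The connected Lie subgroup of `G` corresponding to a Lie subalgebra `k` of the Lie algebra of
`G`: the subgroup generated by the elements `exp X`, `X ∈ k`. -/
def connectedSubgroup (k : Submodule ℂ (GroupLieAlgebra 𝓘(ℂ, E) G)) : Subgroup G :=
  Subgroup.closure {g : G | ∃ X ∈ k, IsExp X g}

/-- A `ℤ`-gradation of the Lie algebra of `G`. -/
structure IsGradation (gr : ℤ → Submodule ℂ (GroupLieAlgebra 𝓘(ℂ, E) G)) : Prop where
  isInternal : DirectSum.IsInternal gr
  bracket_mem : ∀ (m k : ℤ), ∀ x ∈ gr m, ∀ y ∈ gr k, ⁅x, y⁆ ∈ gr (m + k)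

variable (gr : ℤ → Submodule ℂ (GroupLieAlgebra 𝓘(ℂ, E) G))

/-- The subalgebra `ñ₊`, the sum of all `𝔤_m` with `m > 0`. -/
def nPlus : Submodule ℂ (GroupLieAlgebra 𝓘(ℂ, E) G) := ⨆ m : {m : ℤ // 0 < m}, gr m

/-- The subalgebra `ñ₋`, the sum of all `𝔤_m` with `m < 0`. -/
def nMinus : Submodule ℂ (GroupLieAlgebra 𝓘(ℂ, E) G) := ⨆ m : {m : ℤ // m < 0}, gr m

/-- The parabolic subalgebra `b̃₊`, the sum of all `𝔤_m` with `m ≥ 0`. -/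
def bPlus : Submodule ℂ (GroupLieAlgebra 𝓘(ℂ, E) G) := ⨆ m : {m : ℤ // 0 ≤ m}, gr m

/-- The parabolic subalgebra `b̃₋`, the sum of all `𝔤_m` with `m ≤ 0`. -/
def bMinus : Submodule ℂ (GroupLieAlgebra 𝓘(ℂ, E) G) := ⨆ m : {m : ℤ // m ≤ 0}, gr m

/-- The connected subgroup `Ñ₊`. -/
def NPlus : Subgroup G := connectedSubgroup (nPlus gr)

/-- The connected subgroup `Ñ₋`. -/
def NMinus : Subgroup G := connectedSubgroup (nMinus gr)

/-- The connected parabolic subgroup `B̃₊`; the flag manifold `F₋` is `G / B̃₊`. -/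
def BPlus : Subgroup G := connectedSubgroup (bPlus gr)

/-- The connected parabolic subgroup `B̃₋`; the flag manifold `F₊` is `G / B̃₋`. -/
def BMinus : Subgroup G := connectedSubgroup (bMinus gr)

/-- The connected subgroup `H̃` corresponding to the subalgebra `h̃ = 𝔤_0`. -/
def HTilde : Subgroup G := connectedSubgroup (gr 0)

/-- The orbit of `x` under the adjoint action of `H̃`. -/
def orbitHTilde (x : GroupLieAlgebra 𝓘(ℂ, E) G) : Set (GroupLieAlgebra 𝓘(ℂ, E) G) :=
  {y | ∃ h ∈ HTilde gr, y = Ad h x}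

/-- Let `B` be the connected subgroup corresponding to the subalgebra `b`, and let `π : G → G / B`
be the projection.  `SamePush b g X g' X'` says that `π(g) = π(g')` and that the (holomorphic)
tangent vectors `π_* (L_{g*} X)` and `π_* (L_{g'*} X')` of `G / B` are equal.  Indeed the kernel of
`π_*` at `g` is `L_{g*} b`, and for `g' = g * β` with `β ∈ B` one has
`π (g' * exp (t X')) = π (g * exp (t Ad(β) X'))`. -/
def SamePush (b : Submodule ℂ (GroupLieAlgebra 𝓘(ℂ, E) G))
    (g : G) (X : GroupLieAlgebra 𝓘(ℂ, E) G) (g' : G) (X' : GroupLieAlgebra 𝓘(ℂ, E) G) : Prop :=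
  g⁻¹ * g' ∈ connectedSubgroup b ∧ X - Ad (g⁻¹ * g') X' ∈ b

end Group

section Forms

variable {E : Type*} [NormedAddCommGroup E] [NormedSpace ℂ E]
  {G : Type*} [TopologicalSpace G] [ChartedSpace E G] [Group G]
  {M : Type*} [TopologicalSpace M] [ChartedSpace ℂ M]

variable (E G M) in
/-- `𝔤`-valued `1`-forms on the surface `M` considered as a real manifold. -/
abbrev OneForm : Type _ :=
  (p : M) → TangentSpace 𝓘(ℝ, ℂ) p →ₗ[ℝ] GroupLieAlgebra 𝓘(ℂ, E) G

/-- The pull-back `φ^* θ` of the Maurer-Cartan form by a mapping `φ : M → G`. -/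
def mcForm (φ : M → G) : OneForm E G M := fun p =>
  ((maurerCartan (E := E) (φ p)).toLinearMap.restrictScalars ℝ).comp
    (mfderiv 𝓘(ℝ, ℂ) 𝓘(ℝ, E) φ p).toLinearMap

/-- The gauge transformed connection form `Ad (ψ⁻¹) ∘ α + ψ^* θ`. -/
def gaugeTransform (ψ : M → G) (α : OneForm E G M) : OneForm E G M := fun p =>
  ((Ad (E := E) (ψ p)⁻¹).toLinearMap.restrictScalars ℝ).comp (α p) + mcForm ψ p

/-- The differential of a `𝔤`-valued function. -/
def dFun (f : M → GroupLieAlgebra 𝓘(ℂ, E) G) : OneForm E G M := fun p =>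
  let F : M → E := fun q => f q
  let L : TangentSpace 𝓘(ℝ, ℂ) p →L[ℝ] E := mfderiv 𝓘(ℝ, ℂ) 𝓘(ℝ, E) F p
  L.toLinearMap

/-- The tangent vector `∂/∂x` (for `w = 1`) or `∂/∂y` (for `w = I`) at `p` of the
coordinate `z = x + √-1 y`. -/
def coordVec (z : OpenPartialHomeomorph M ℂ) (w : ℂ) (p : M) : TangentSpace 𝓘(ℝ, ℂ) p :=
  mfderiv 𝓘(ℝ, ℂ) 𝓘(ℝ, ℂ) z.symm (z p) w

/-- The component `α_-` of `α = α_- dz + α_+ dz̄`. -/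
def dzComp (z : OpenPartialHomeomorph M ℂ) (α : OneForm E G M) (p : M) :
    GroupLieAlgebra 𝓘(ℂ, E) G :=
  (1 / 2 : ℂ) • (α p (coordVec z 1 p) - Complex.I • α p (coordVec z Complex.I p))

/-- The component `α_+` of `α = α_- dz + α_+ dz̄`. -/
def dzbarComp (z : OpenPartialHomeomorph M ℂ) (α : OneForm E G M) (p : M) :
    GroupLieAlgebra 𝓘(ℂ, E) G :=
  (1 / 2 : ℂ) • (α p (coordVec z 1 p) + Complex.I • α p (coordVec z Complex.I p))

/-- The derivative `∂_z f` of a `𝔤`-valued function. -/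
def dz (z : OpenPartialHomeomorph M ℂ) (f : M → GroupLieAlgebra 𝓘(ℂ, E) G) (p : M) :
    GroupLieAlgebra 𝓘(ℂ, E) G := dzComp z (dFun f) p

/-- The derivative `∂_z̄ f` of a `𝔤`-valued function. -/
def dzbar (z : OpenPartialHomeomorph M ℂ) (f : M → GroupLieAlgebra 𝓘(ℂ, E) G) (p : M) :
    GroupLieAlgebra 𝓘(ℂ, E) G := dzbarComp z (dFun f) p

/-- The `1`-form `A dz + B dz̄` at the point `p`, evaluated at the tangent vector `v`. -/
def formOf (z : OpenPartialHomeomorph M ℂ) (A B : M → GroupLieAlgebra 𝓘(ℂ, E) G) (p : M)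
    (v : TangentSpace 𝓘(ℝ, ℂ) p) : GroupLieAlgebra 𝓘(ℂ, E) G :=
  let dzv : ℂ := mfderiv 𝓘(ℝ, ℂ) 𝓘(ℝ, ℂ) z p v
  dzv • A p + (starRingEnd ℂ dzv) • B p

/-- The zero curvature condition on `W` for the connection form `A dz + B dz̄`. -/
def ZeroCurvature (z : OpenPartialHomeomorph M ℂ) (A B : M → GroupLieAlgebra 𝓘(ℂ, E) G)
    (W : Set M) : Prop :=
  ∀ p ∈ W, dz z B p - dzbar z A p + ⁅A p, B p⁆ = 0

/-- Antiholomorphic mappings: real differentiable with antilinear derivative. -/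
def AntiholomorphicOn (f : M → G) (W : Set M) : Prop :=
  MDifferentiableOn 𝓘(ℝ, ℂ) 𝓘(ℝ, E) f W ∧
    ∀ p ∈ W,
      let L : ℂ →L[ℝ] E := mfderiv 𝓘(ℝ, ℂ) 𝓘(ℝ, E) f p
      ∀ w : ℂ, L (Complex.I * w) = -(Complex.I • L w)

end Forms

section Main

variable {E : Type*} [NormedAddCommGroup E] [NormedSpace ℂ E]
  {G : Type*} [TopologicalSpace G] [ChartedSpace E G] [Group G]
  {M : Type*} [TopologicalSpace M] [ChartedSpace ℂ M]

/-- The (specified) grading condition on `φ`: in any local holomorphic coordinate `z`, the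
`(1,0)`-component of `φ^* θ` takes values in `𝔤_{-1} ⊕ 𝔤_0`, and the `(0,1)`-component takes
values in `𝔤_0 ⊕ 𝔤_1`. -/
def GradingCondition (gr : ℤ → Submodule ℂ (GroupLieAlgebra 𝓘(ℂ, E) G)) (φ : M → G) : Prop :=
  ∀ z ∈ IsManifold.maximalAtlas 𝓘(ℂ, ℂ) ω M, ∀ p ∈ z.source,
    dzComp z (mcForm φ) p ∈ gr (-1) ⊔ gr 0 ∧ dzbarComp z (mcForm φ) p ∈ gr 0 ⊔ gr 1

/-- Admissible mappings: `φ` satisfies the grading condition and, in any local coordinate `z`, the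
vector `φ_{-*} ∂_z` lies in `π_{-*} (L_{g*} 𝒪_-)` for all `g ∈ G` with `π_-(g) = φ_-(p)`, and
`φ_{+*} ∂_z̄` lies in `π_{+*} (L_{g*} 𝒪_+)` for all `g ∈ G` with `π_+(g) = φ_+(p)`.  Here
`𝒪_±` are the `H̃`-orbits of `x_±`, `π_±` is the projection of `G` onto `F_± = G / B̃_∓`, and
`φ_± = π_± ∘ φ`; the `(1,0)`-vector `φ_{-*} ∂_z` is the image under `π_{-*}` of `L_{φ(p)*}` of the
`dz`-component of `φ^* θ`, and similarly for `φ_{+*} ∂_z̄`. -/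
structure Admissible (gr : ℤ → Submodule ℂ (GroupLieAlgebra 𝓘(ℂ, E) G))
    (xm xp : GroupLieAlgebra 𝓘(ℂ, E) G) (φ : M → G) : Prop where
  grading : GradingCondition gr φ
  minus : ∀ z ∈ IsManifold.maximalAtlas 𝓘(ℂ, ℂ) ω M, ∀ p ∈ z.source, ∀ g : G,
    (φ p)⁻¹ * g ∈ BPlus gr →
      ∃ y ∈ orbitHTilde gr xm, SamePush (bPlus gr) (φ p) (dzComp z (mcForm φ) p) g y
  plus : ∀ z ∈ IsManifold.maximalAtlas 𝓘(ℂ, ℂ) ω M, ∀ p ∈ z.source, ∀ g : G,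
    (φ p)⁻¹ * g ∈ BMinus gr →
      ∃ y ∈ orbitHTilde gr xp, SamePush (bMinus gr) (φ p) (dzbarComp z (mcForm φ) p) g y

/-- On the open set `W`: smooth mappings which decompose `φ` as `φ = μ₊ ν₋ η₋ = μ₋ ν₊ η₊`
according to the modified Gauss decompositions with base elements `gp`, `gm`
(so `μ₊` takes values in `gp Ñ₊` and `μ₋` in `gm Ñ₋`), together with an antiholomorphic
lift `γ₊` and a holomorphic lift `γ₋` to `H̃` of the mappings `λ_±` given by
`μ₋^* θ = λ₋ dz`, `μ₊^* θ = λ₊ dz̄`, that is `λ_± = √-1 Ad(γ_±) x_±`. -/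
structure GaussData (gr : ℤ → Submodule ℂ (GroupLieAlgebra 𝓘(ℂ, E) G))
    (xm xp : GroupLieAlgebra 𝓘(ℂ, E) G) (φ : M → G) (z : OpenPartialHomeomorph M ℂ)
    (W : Set M) (gp gm : G) where
  μp : M → G
  νm : M → G
  ηm : M → G
  μm : M → G
  νp : M → G
  ηp : M → G
  γp : M → G
  γm : M → G
  smooth_μp : ContMDiffOn 𝓘(ℝ, ℂ) 𝓘(ℝ, E) ∞ μp W
  smooth_νm : ContMDiffOn 𝓘(ℝ, ℂ) 𝓘(ℝ, E) ∞ νm W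
  smooth_ηm : ContMDiffOn 𝓘(ℝ, ℂ) 𝓘(ℝ, E) ∞ ηm W
  smooth_μm : ContMDiffOn 𝓘(ℝ, ℂ) 𝓘(ℝ, E) ∞ μm W
  smooth_νp : ContMDiffOn 𝓘(ℝ, ℂ) 𝓘(ℝ, E) ∞ νp W
  smooth_ηp : ContMDiffOn 𝓘(ℝ, ℂ) 𝓘(ℝ, E) ∞ ηp W
  μp_mem : ∀ q ∈ W, gp⁻¹ * μp q ∈ NPlus gr
  νm_mem : ∀ q ∈ W, νm q ∈ NMinus gr
  ηm_mem : ∀ q ∈ W, ηm q ∈ HTilde gr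
  μm_mem : ∀ q ∈ W, gm⁻¹ * μm q ∈ NMinus gr
  νp_mem : ∀ q ∈ W, νp q ∈ NPlus gr
  ηp_mem : ∀ q ∈ W, ηp q ∈ HTilde gr
  decomp_plus : ∀ q ∈ W, φ q = μp q * νm q * ηm q
  decomp_minus : ∀ q ∈ W, φ q = μm q * νp q * ηp q
  γp_mem : ∀ q ∈ W, γp q ∈ HTilde gr
  γm_mem : ∀ q ∈ W, γm q ∈ HTilde gr
  γp_antiholomorphic : AntiholomorphicOn (E := E) γp W
  γm_holomorphic : MDifferentiableOn 𝓘(ℂ, ℂ) 𝓘(ℂ, E) γm W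
  lift_plus : ∀ q ∈ W, dzbarComp z (mcForm μp) q = Complex.I • Ad (γp q) xp
  lift_minus : ∀ q ∈ W, dzComp z (mcForm μm) q = Complex.I • Ad (γm q) xm

/-- The mapping `γ = γ₊⁻¹ η γ₋`, where `η = η₋ η₊⁻¹`. -/
def GaussData.γ {gr : ℤ → Submodule ℂ (GroupLieAlgebra 𝓘(ℂ, E) G)}
    {xm xp : GroupLieAlgebra 𝓘(ℂ, E) G} {φ : M → G} {z : OpenPartialHomeomorph M ℂ}
    {W : Set M} {gp gm : G} (D : GaussData gr xm xp φ z W gp gm) (q : M) : G :=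
  (D.γp q)⁻¹ * (D.ηm q * (D.ηp q)⁻¹) * D.γm q

/-- The `dz`-component `√-1 x_- + (γ^* θ)_-` of the Toda connection. -/
def todaMinus (z : OpenPartialHomeomorph M ℂ) (xm : GroupLieAlgebra 𝓘(ℂ, E) G) (γ : M → G)
    (p : M) : GroupLieAlgebra 𝓘(ℂ, E) G :=
  Complex.I • xm + dzComp z (mcForm γ) p

/-- The `dz̄`-component `√-1 Ad(γ⁻¹) x_+` of the Toda connection. -/
def todaPlus (xp : GroupLieAlgebra 𝓘(ℂ, E) G) (γ : M → G) (p : M) : GroupLieAlgebra 𝓘(ℂ, E) G :=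
  Complex.I • Ad (γ p)⁻¹ xp

/-- The Toda equation `∂_z̄ ((γ^* θ)_-) = [Ad(γ⁻¹) x_+, x_-]` on `W`; for a linear group,
`(γ^* θ)_- = γ⁻¹ ∂_z γ` and `Ad(γ⁻¹) x_+ = γ⁻¹ x_+ γ`. -/
def TodaEquation (z : OpenPartialHomeomorph M ℂ) (xm xp : GroupLieAlgebra 𝓘(ℂ, E) G)
    (γ : M → G) (W : Set M) : Prop :=
  ∀ p ∈ W, dzbar z (dzComp z (mcForm γ)) p = ⁅Ad (γ p)⁻¹ xp, xm⁆

end Main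

end Toda

end

/-!
# Admissible mappings and the Toda equation

Write `K_S` for the connected subgroup of `G` with the Lie algebra `⨁_{m ∈ S} 𝔤_m`, and `φ^* θ` for the
Maurer-Cartan form pulled back by `φ` (below: the logarithmic derivative `logDer`, which satisfies
`(f g)^* θ = Ad(g⁻¹) f^* θ + g^* θ` and has zero curvature).

*The Toda equation.* From Gauss data `φ = μ₊ ν₋ η₋ = μ₋ ν₊ η₊` put `ψ = η₊⁻¹ γ₋`.  Then
`φ ψ = μ₋ ν₊ γ₋ = μ₊ ν₋ γ₊ γ`.  The grading condition leaves only the components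
`√-1 Ad(γ₋) x₋ dz` of `μ₋^* θ` and `√-1 Ad(γ₊) x₊ dz̄` of `μ₊^* θ`, so that the first factorization
determines `(φ ψ)^* θ` modulo positive degrees and the second one modulo negative degrees.  Comparing
degrees identifies it with the Toda connection of `γ` (`wirt_logDer_gauge`).  The curvature of the Toda
connection of any `γ` is the difference of the two sides of the Toda equation (`toda_curvature`); this
gives the equivalence in the second part, and the Toda equation for Gauss data because `(φ ψ)^* θ` is
flat (`GaussData.toda`).

*Existence of Gauss data.* Near the identity `G` is a product `K_P K_Q H̃` for `P`, `Q` the positive and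
the negative degrees or conversely, by the inverse function theorem; together with `B̃ = K_Q H̃` this
gives the decompositions of `φ` near a point (`IsTriangular.exists_gauss`).  Admissibility says that
the remaining component of `μ_±^* θ` takes values in the orbit `𝒪_±`.  Such a mapping lifts to `H̃`
(`exists_orbit_lift`): in a slice for the orbit, the transversal coordinates of the orbit form a
countable set, hence are constant along a continuous mapping.  By the Maurer-Cartan equation the
component is holomorphic or antiholomorphic, and the lift inherits this.  The factor `√-1` in the
normalization of `γ_±` is a value of `Ad` on the one-parameter group of the grading element
(`IsGradation.exists_adE_eq_I_smul`).

The groups `K_S` are not known to be closed, and they are only given by generators.  Two facts replace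
the closed subgroup theorem.  The elements of `K_S` raise degrees by elements of `S`, and since `𝔤` has
trivial centre, a mapping into a coset of `K_S` has its logarithmic derivative in `⨁_{m ∈ S} 𝔤_m`
(`HasLogDeriv.mem_gradSum`).  Conversely, a mapping whose logarithmic derivative has degrees in `Q`
stays in a coset of `K_Q`, as is seen from the local Gauss decomposition
(`eventually_mem_of_logDer_mem`).

Smoothness is meant over `ℝ`.  All computations take place in the model space `E` of `G`, to which the
Lie algebra `GroupLieAlgebra` is equal by definition, and on `M` in the coordinate `z`.
-/

noncomputable section

namespace Toda

open Filter Topology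

set_option linter.unusedSectionVars false

/-! ### The complex Lie group as a real Lie group -/

section RestrictScalars

variable {E : Type*} [NormedAddCommGroup E] [NormedSpace ℂ E]
  {F : Type*} [NormedAddCommGroup F] [NormedSpace ℂ F]
  {N : Type*} [TopologicalSpace N] [ChartedSpace F N]
  {G : Type*} [TopologicalSpace G] [ChartedSpace E G]

theorem contMDiffOn_restrictScalars {n : WithTop ℕ∞} {f : N → G} {s : Set N}
    (h : ContMDiffOn 𝓘(ℂ, F) 𝓘(ℂ, E) n f s) : ContMDiffOn 𝓘(ℝ, F) 𝓘(ℝ, E) n f s := by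
  intro x hx
  have h1 := contMDiffWithinAt_iff.1 (h x hx)
  rw [contMDiffWithinAt_iff]
  exact ⟨h1.1, h1.2.restrict_scalars ℝ⟩

theorem contMDiff_restrictScalars {n : WithTop ℕ∞} {f : N → G}
    (h : ContMDiff 𝓘(ℂ, F) 𝓘(ℂ, E) n f) : ContMDiff 𝓘(ℝ, F) 𝓘(ℝ, E) n f :=
  contMDiffOn_univ.1 (contMDiffOn_restrictScalars (contMDiffOn_univ.2 h))

theorem hasMFDerivAt_restrictScalars {f : N → G} {x : N}
    {L : F →L[ℂ] E}
    (h : HasMFDerivAt 𝓘(ℂ, F) 𝓘(ℂ, E) f x L) :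
    HasMFDerivAt 𝓘(ℝ, F) 𝓘(ℝ, E) f x (L.restrictScalars ℝ) :=
  ⟨h.1, HasFDerivWithinAt.restrictScalars ℝ (E := F) (F := E) h.2⟩

theorem isManifold_restrictScalars {n : WithTop ℕ∞} [IsManifold 𝓘(ℂ, F) n N] :
    IsManifold 𝓘(ℝ, F) n N := by
  apply isManifold_of_contDiffOn
  intro e e' he he'
  have := contDiffGroupoid n 𝓘(ℂ, F)|>.compatible he he'
  rw [contDiffGroupoid, mem_groupoid_of_pregroupoid, contDiffPregroupoid] at this
  exact this.1.restrict_scalars ℝ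

variable [Group G]

/-- A complex Lie group is also a real Lie group: smoothness over `ℝ` is meant in this sense. -/
instance realLieGroup {n : WithTop ℕ∞} [LieGroup 𝓘(ℂ, E) n G] : LieGroup 𝓘(ℝ, E) n G := by
  have : IsManifold 𝓘(ℝ, E) n G := isManifold_restrictScalars
  refine { contMDiff_mul := ?_, contMDiff_inv := ?_ }
  · intro x
    have h1 := contMDiffWithinAt_iff.1 (contMDiff_mul 𝓘(ℂ, E) (G := G) n x)
    rw [ContMDiffAt, contMDiffWithinAt_iff]
    exact ⟨h1.1, h1.2.restrict_scalars ℝ⟩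
  · exact contMDiff_restrictScalars (contMDiff_inv 𝓘(ℂ, E) n)

end RestrictScalars

/-! ### Logarithmic derivatives -/

section LogDeriv

variable {E : Type*} [NormedAddCommGroup E] [NormedSpace ℂ E]
  {F : Type*} [NormedAddCommGroup F] [NormedSpace ℝ F]
  {F' : Type*} [NormedAddCommGroup F'] [NormedSpace ℝ F']
  {G : Type*} [TopologicalSpace G] [ChartedSpace E G] [Group G]

variable (E G) in
/-- The preferred chart of the Lie group at its identity element. -/
abbrev oneChart : OpenPartialHomeomorph G E := chartAt E (1 : G)

variable (E G) in
/-- The group multiplication read in the chart at the identity. -/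
def mulLoc (p : E × E) : E := oneChart E G ((oneChart E G).symm p.1 * (oneChart E G).symm p.2)

variable (E G) in
/-- The mapping `(g, h) ↦ g⁻¹ * h` read in the chart at the identity. -/
def divLoc (p : E × E) : E :=
  oneChart E G (((oneChart E G).symm p.1)⁻¹ * (oneChart E G).symm p.2)

/-- `f : F → G` has the logarithmic derivative `L` at `x`: the linear mapping `L` is the
differential at `x` of `y ↦ f(x)⁻¹ f(y)`, read in the chart at the identity.  In other words `L` is
the value at `x` of the pull-back by `f` of the Maurer-Cartan form. -/
def HasLogDeriv (f : F → G) (L : F →L[ℝ] E) (x : F) : Prop :=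
  ContinuousAt f x ∧ HasFDerivAt (fun y => oneChart E G ((f x)⁻¹ * f y)) L x

/-- The logarithmic derivative of `f : F → G`, that is `f^* θ` for the Maurer-Cartan form `θ`, with
values in the model space `E` of `G`.  Junk value `0` where it does not exist. -/
def logDer (f : F → G) (x : F) : F →L[ℝ] E :=
  fderiv ℝ (fun y => oneChart E G ((f x)⁻¹ * f y)) x

variable (E) in
/-- The adjoint representation on the model space `E`, computed in the chart at the identity; see
`Ad_eq_adE` for the comparison with `Ad`. -/
def adE (g : G) : E →L[ℂ] E :=
  fderiv ℂ (fun x => oneChart E G (g * (oneChart E G).symm x * g⁻¹)) (oneChart E G 1)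

variable (G) in
/-- The bracket of the Lie algebra of `G`, on the model space: `GroupLieAlgebra` is `E` by
definition, but carries no norm. -/
def lieE (X Y : E) : E :=
  Bracket.bracket (L := GroupLieAlgebra 𝓘(ℂ, E) G) (M := GroupLieAlgebra 𝓘(ℂ, E) G) X Y

theorem HasLogDeriv.logDer {f : F → G} {L : F →L[ℝ] E} {x : F} (h : HasLogDeriv f L x) :
    logDer f x = L := h.2.fderiv

theorem HasLogDeriv.unique {f : F → G} {L L' : F →L[ℝ] E} {x : F} (h : HasLogDeriv f L x)
    (h' : HasLogDeriv f L' x) : L = L' := h.2.unique h'.2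

variable [LieGroup 𝓘(ℂ, E) ω G]

theorem contMDiffAt_oneChart {g : G} (hg : g ∈ (oneChart E G).source) :
    ContMDiffAt 𝓘(ℂ, E) 𝓘(ℂ, E) ω (oneChart E G) g :=
  (contMDiffOn_chart (I := 𝓘(ℂ, E)) (n := ω)).contMDiffAt ((oneChart E G).open_source.mem_nhds hg)

theorem contMDiffAt_oneChart_symm {x : E} (hx : x ∈ (oneChart E G).target) :
    ContMDiffAt 𝓘(ℂ, E) 𝓘(ℂ, E) ω (oneChart E G).symm x :=
  (contMDiffOn_chart_symm (I := 𝓘(ℂ, E)) (n := ω)).contMDiffAt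
    ((oneChart E G).open_target.mem_nhds hx)

theorem one_mem_oneChart : (1 : G) ∈ (oneChart E G).source := mem_chart_source E 1
theorem oneChart_one_mem : oneChart E G 1 ∈ (oneChart E G).target := mem_chart_target E 1
@[simp] theorem oneChart_symm_one : (oneChart E G).symm (oneChart E G 1) = 1 :=
  (oneChart E G).left_inv one_mem_oneChart

theorem contDiffAt_mulLoc {p : E × E} (h1 : p.1 ∈ (oneChart E G).target)
    (h2 : p.2 ∈ (oneChart E G).target)
    (h3 : (oneChart E G).symm p.1 * (oneChart E G).symm p.2 ∈ (oneChart E G).source) :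
    ContDiffAt ℂ ω (mulLoc E G) p := by
  rw [← contMDiffAt_iff_contDiffAt]
  have a := (contMDiffAt_oneChart_symm h1).comp p contDiffAt_fst.contMDiffAt
  have b := (contMDiffAt_oneChart_symm h2).comp p contDiffAt_snd.contMDiffAt
  exact ContMDiffAt.comp (I' := 𝓘(ℂ, E)) p (contMDiffAt_oneChart h3) (a.mul b)

theorem contDiffAt_divLoc {p : E × E} (h1 : p.1 ∈ (oneChart E G).target)
    (h2 : p.2 ∈ (oneChart E G).target)
    (h3 : ((oneChart E G).symm p.1)⁻¹ * (oneChart E G).symm p.2 ∈ (oneChart E G).source) :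
    ContDiffAt ℂ ω (divLoc E G) p := by
  rw [← contMDiffAt_iff_contDiffAt]
  have a := (contMDiffAt_oneChart_symm h1).comp p contDiffAt_fst.contMDiffAt
  have b := (contMDiffAt_oneChart_symm h2).comp p contDiffAt_snd.contMDiffAt
  exact ContMDiffAt.comp (I' := 𝓘(ℂ, E)) p (contMDiffAt_oneChart h3) (a.inv.mul b)

theorem contDiffAt_conjLoc (g : G) : ContDiffAt ℂ ω
    (fun x => oneChart E G (g * (oneChart E G).symm x * g⁻¹)) (oneChart E G 1) := by
  rw [← contMDiffAt_iff_contDiffAt]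
  have a := contMDiffAt_oneChart_symm (oneChart_one_mem (E := E) (G := G))
  refine ContMDiffAt.comp (I' := 𝓘(ℂ, E)) _ (contMDiffAt_oneChart ?_)
    ((contMDiffAt_const.mul a).mul contMDiffAt_const)
  simp

theorem hasFDerivAt_conjLoc (g : G) : HasFDerivAt
    (fun x => oneChart E G (g * (oneChart E G).symm x * g⁻¹)) ((adE E g).restrictScalars ℝ)
      (oneChart E G 1) :=
  (((contDiffAt_conjLoc g).differentiableAt (by simp)).hasFDerivAt).restrictScalars ℝ

theorem mulLoc_left_eventually : ∀ᶠ x in 𝓝 (oneChart E G 1), mulLoc E G (x, oneChart E G 1) = x := by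
  filter_upwards [(oneChart E G).open_target.mem_nhds oneChart_one_mem] with x hx
  simp [mulLoc, (oneChart E G).right_inv hx]

theorem mulLoc_right_eventually : ∀ᶠ x in 𝓝 (oneChart E G 1), mulLoc E G (oneChart E G 1, x) = x := by
  filter_upwards [(oneChart E G).open_target.mem_nhds oneChart_one_mem] with x hx
  simp [mulLoc, (oneChart E G).right_inv hx]

theorem contDiffAt_mulLoc_one : ContDiffAt ℂ ω (mulLoc E G) (oneChart E G 1, oneChart E G 1) :=
  contDiffAt_mulLoc oneChart_one_mem oneChart_one_mem (by simp)

theorem hasFDerivAt_mulLoc : HasFDerivAt (mulLoc E G)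
    (ContinuousLinearMap.fst ℝ E E + ContinuousLinearMap.snd ℝ E E)
      (oneChart E G 1, oneChart E G 1) := by
  have h := ((contDiffAt_mulLoc_one (E := E) (G := G)).differentiableAt (by simp)).hasFDerivAt.restrictScalars ℝ
  set D := (fderiv ℂ (mulLoc E G) (oneChart E G 1, oneChart E G 1)).restrictScalars ℝ with hD
  have h1 : HasFDerivAt (fun x => mulLoc E G (x, oneChart E G 1)) (D.comp (ContinuousLinearMap.inl ℝ E E))
      (oneChart E G 1) :=
    HasFDerivAt.comp (g := mulLoc E G) (oneChart E G 1) h (hasFDerivAt_prodMk_left _ _)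
  have h2 : HasFDerivAt (fun x => mulLoc E G (oneChart E G 1, x)) (D.comp (ContinuousLinearMap.inr ℝ E E))
      (oneChart E G 1) :=
    HasFDerivAt.comp (g := mulLoc E G) (oneChart E G 1) h (hasFDerivAt_prodMk_right _ _)
  have h1' := h1.unique ((hasFDerivAt_id (𝕜 := ℝ) _).congr_of_eventuallyEq mulLoc_left_eventually)
  have h2' := h2.unique ((hasFDerivAt_id (𝕜 := ℝ) _).congr_of_eventuallyEq mulLoc_right_eventually)
  refine h.congr_fderiv (ContinuousLinearMap.ext fun p => ?_)
  have e1 := congrArg (fun T => T p.1) h1'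
  have e2 := congrArg (fun T => T p.2) h2'
  simp only [ContinuousLinearMap.comp_apply, ContinuousLinearMap.inl_apply,
    ContinuousLinearMap.inr_apply, ContinuousLinearMap.id_apply] at e1 e2
  have : p = (p.1, 0) + (0, p.2) := by simp
  conv_lhs => rw [this, map_add, e1, e2]
  simp

/-- The differentials of two mappings with the value `1` at `x` add up under multiplication. -/
theorem hasFDerivAt_oneChart_mul {A B : F → G} {L L' : F →L[ℝ] E} {x : F}
    (hA1 : A x = 1) (hA : ContinuousAt A x) (hA' : HasFDerivAt (fun y => oneChart E G (A y)) L x)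
    (hB1 : B x = 1) (hB : ContinuousAt B x) (hB' : HasFDerivAt (fun y => oneChart E G (B y)) L' x) :
    HasFDerivAt (fun y => oneChart E G (A y * B y)) (L + L') x := by
  have h1 : ∀ᶠ y in 𝓝 x, A y ∈ (oneChart E G).source :=
    hA.eventually ((oneChart E G).open_source.mem_nhds (by rw [hA1]; exact one_mem_oneChart))
  have h2 : ∀ᶠ y in 𝓝 x, B y ∈ (oneChart E G).source :=
    hB.eventually ((oneChart E G).open_source.mem_nhds (by rw [hB1]; exact one_mem_oneChart))
  have h3 : HasFDerivAt (mulLoc E G) (ContinuousLinearMap.fst ℝ E E + ContinuousLinearMap.snd ℝ E E)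
      (oneChart E G (A x), oneChart E G (B x)) := by rw [hA1, hB1]; exact hasFDerivAt_mulLoc
  have h4 := HasFDerivAt.comp (g := mulLoc E G) x h3 (hA'.prodMk hB')
  refine (h4.congr_of_eventuallyEq ?_).congr_fderiv (by ext; simp)
  filter_upwards [h1, h2] with y hy1 hy2
  simp [mulLoc, (oneChart E G).left_inv hy1, (oneChart E G).left_inv hy2]

theorem hasFDerivAt_oneChart_conj {A : F → G} {L : F →L[ℝ] E} {x : F} (g : G)
    (hA1 : A x = 1) (hA : ContinuousAt A x) (hA' : HasFDerivAt (fun y => oneChart E G (A y)) L x) :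
    HasFDerivAt (fun y => oneChart E G (g * A y * g⁻¹)) (((adE E g).restrictScalars ℝ).comp L) x := by
  have h1 : ∀ᶠ y in 𝓝 x, A y ∈ (oneChart E G).source :=
    hA.eventually ((oneChart E G).open_source.mem_nhds (by rw [hA1]; exact one_mem_oneChart))
  have h3 := hasFDerivAt_conjLoc (E := E) g
  rw [← hA1] at h3
  have h4 := HasFDerivAt.comp x h3 hA'
  refine h4.congr_of_eventuallyEq ?_
  filter_upwards [h1] with y hy1
  simp [(oneChart E G).left_inv hy1]

theorem HasLogDeriv.const_mul {f : F → G} {L : F →L[ℝ] E} {x : F} (h : HasLogDeriv f L x) (g : G) :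
    HasLogDeriv (fun y => g * f y) L x := by
  have : IsTopologicalGroup G := topologicalGroup_of_lieGroup 𝓘(ℂ, E) ω
  refine ⟨continuousAt_const.mul h.1, ?_⟩
  simpa [mul_assoc] using h.2

theorem hasLogDeriv_const (g : G) (x : F) : HasLogDeriv (fun _ => g) (0 : F →L[ℝ] E) x :=
  ⟨continuousAt_const, hasFDerivAt_const _ _⟩

/-- The product rule: `(f g)^* θ = Ad(g⁻¹) f^* θ + g^* θ`. -/
theorem HasLogDeriv.mul {f g : F → G} {L L' : F →L[ℝ] E} {x : F} (hf : HasLogDeriv f L x)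
    (hg : HasLogDeriv g L' x) :
    HasLogDeriv (fun y => f y * g y) (((adE E (g x)⁻¹).restrictScalars ℝ).comp L + L') x := by
  have : IsTopologicalGroup G := topologicalGroup_of_lieGroup 𝓘(ℂ, E) ω
  refine ⟨hf.1.mul hg.1, ?_⟩
  have h1 := hasFDerivAt_oneChart_conj (A := fun y => (f x)⁻¹ * f y) (g x)⁻¹ (by simp)
    (continuousAt_const.mul hf.1) hf.2
  have h2 := hasFDerivAt_oneChart_mul (by simp)
    ((continuousAt_const.mul (continuousAt_const.mul hf.1)).mul continuousAt_const) h1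
    (by simp) (continuousAt_const.mul hg.1) hg.2
  refine h2.congr_of_eventuallyEq (Eventually.of_forall fun y => congrArg _ ?_)
  simp only [Pi.mul_apply]
  group

theorem HasLogDeriv.comp {f : F → G} {L : F →L[ℝ] E} {u : F' → F} {U : F' →L[ℝ] F} {x : F'}
    (hf : HasLogDeriv f L (u x)) (hu : HasFDerivAt u U x) :
    HasLogDeriv (fun y => f (u y)) (L.comp U) x :=
  ⟨ContinuousAt.comp (f := u) (g := f) hf.1 hu.continuousAt, HasFDerivAt.comp x hf.2 hu⟩

end LogDeriv

/-! ### The Lie bracket in the chart at the identity -/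

section Bracket

variable {E : Type*} [NormedAddCommGroup E] [NormedSpace ℂ E]
  {F : Type*} [NormedAddCommGroup F] [NormedSpace ℝ F]
  {F' : Type*} [NormedAddCommGroup F'] [NormedSpace ℝ F']
  {G : Type*} [TopologicalSpace G] [ChartedSpace E G] [Group G] [LieGroup 𝓘(ℂ, E) ω G]

/-- The chart at the identity has the identity as its differential at the identity. -/
theorem hasMFDerivAt_oneChart_symm_one : HasMFDerivAt 𝓘(ℂ, E) 𝓘(ℂ, E) (oneChart E G).symm
    (oneChart E G 1) (ContinuousLinearMap.id ℂ E) := by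
  refine ⟨(contMDiffAt_oneChart_symm (oneChart_one_mem (E := E) (G := G))).continuousAt, ?_⟩
  simp only [mfld_simps, oneChart]
  refine HasFDerivAt.hasFDerivWithinAt (E := E) (F := E)
    (HasFDerivAt.congr_of_eventuallyEq (E := E) (F := E) (hasFDerivAt_id (𝕜 := ℂ) _) ?_)
  filter_upwards [(oneChart E G).open_target.mem_nhds
    (oneChart_one_mem (E := E) (G := G))] with x hx
  exact (oneChart E G).right_inv hx

theorem hasMFDerivAt_oneChart_one : HasMFDerivAt 𝓘(ℂ, E) 𝓘(ℂ, E) (oneChart E G)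
    (1 : G) (ContinuousLinearMap.id ℂ E) := by
  refine ⟨(contMDiffAt_oneChart (one_mem_oneChart (E := E) (G := G))).continuousAt, ?_⟩
  simp only [mfld_simps]
  refine HasFDerivAt.hasFDerivWithinAt (E := E) (F := E)
    (HasFDerivAt.congr_of_eventuallyEq (E := E) (F := E) (hasFDerivAt_id (𝕜 := ℂ) _) ?_)
  filter_upwards [(oneChart E G).open_target.mem_nhds
    (oneChart_one_mem (E := E) (G := G))] with x hx
  exact (oneChart E G).right_inv hx

variable (G) in
/-- A left invariant vector field read in the chart at the identity. -/
def invField (X : E) (x : E) : E :=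
  VectorField.mpullback 𝓘(ℂ, E) 𝓘(ℂ, E) (oneChart E G).symm
      (mulInvariantVectorField (I := 𝓘(ℂ, E)) (G := G) X) x

/-- In the chart, `X_g = (L_g)_* X` is a partial derivative of the multiplication. -/
theorem invField_eventually (X : E) : ∀ᶠ x in 𝓝 (oneChart E G 1),
    invField G X x = fderiv ℂ (mulLoc E G) (x, oneChart E G 1) (0, X) := by
  filter_upwards [(oneChart E G).open_target.mem_nhds oneChart_one_mem] with x hx
  have hs : (oneChart E G).symm x ∈ (oneChart E G).source := (oneChart E G).map_target hx
  have hinv := isInvertible_mfderivWithin_extChartAt_symm (I := 𝓘(ℂ, E)) (x := (1 : G)) (y := x)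
    (by simpa using hx)
  simp only [mfld_simps, mfderivWithin_univ] at hinv
  let A : E →L[ℂ] E := mfderiv 𝓘(ℂ, E) 𝓘(ℂ, E) (oneChart E G).symm x
  change A.inverse _ = _
  refine (ContinuousLinearMap.IsInvertible.inverse_apply_eq (f := A) hinv).2 ?_
  have hd : HasMFDerivAt 𝓘(ℂ, E) 𝓘(ℂ, E) (oneChart E G).symm x
      (mfderiv 𝓘(ℂ, E) 𝓘(ℂ, E) (oneChart E G).symm x) :=
    ((contMDiffAt_oneChart_symm hx).mdifferentiableAt (by simp)).hasMFDerivAt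
  have e1 : mulLoc E G (x, oneChart E G 1) = x := by
    simp [mulLoc, (oneChart E G).right_inv hx]
  have hm0 : HasFDerivAt (mulLoc E G) (fderiv ℂ (mulLoc E G) (x, oneChart E G 1))
      (x, oneChart E G 1) :=
    ((contDiffAt_mulLoc (p := (x, oneChart E G 1)) hx oneChart_one_mem
      (by simpa using hs)).differentiableAt (by simp)).hasFDerivAt
  have hm : HasFDerivAt (fun y => mulLoc E G (x, y))
      ((fderiv ℂ (mulLoc E G) (x, oneChart E G 1)).comp (ContinuousLinearMap.inr ℂ E E))
      (oneChart E G 1) :=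
    HasFDerivAt.comp (g := mulLoc E G) _ hm0 (hasFDerivAt_prodMk_right _ _)
  have hc1 := HasMFDerivAt.comp (I' := 𝓘(ℂ, E)) (g := (oneChart E G).symm)
    (f := fun y => mulLoc E G (x, y)) (oneChart E G 1) (by rw [e1]; exact hd) hm.hasMFDerivAt
  have hl : HasMFDerivAt 𝓘(ℂ, E) 𝓘(ℂ, E) (fun h : G => (oneChart E G).symm x * h) 1
      (mfderiv 𝓘(ℂ, E) 𝓘(ℂ, E) (fun h : G => (oneChart E G).symm x * h) 1) :=
    ((contMDiff_mul_left (I := 𝓘(ℂ, E)) (n := ω)).mdifferentiable (by simp) _).hasMFDerivAt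
  have hc2 := HasMFDerivAt.comp (I' := 𝓘(ℂ, E)) (g := fun h : G => (oneChart E G).symm x * h)
    (f := (oneChart E G).symm) (oneChart E G 1) (by rw [oneChart_symm_one]; exact hl)
    hasMFDerivAt_oneChart_symm_one
  have hcong : ((fun h : G => (oneChart E G).symm x * h) ∘ (oneChart E G).symm) =ᶠ[𝓝 (oneChart E G 1)]
      ((oneChart E G).symm ∘ (fun y => mulLoc E G (x, y))) := by
    have : ContinuousAt (fun y => (oneChart E G).symm x * (oneChart E G).symm y) (oneChart E G 1) := by
      have : IsTopologicalGroup G := topologicalGroup_of_lieGroup 𝓘(ℂ, E) ω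
      exact continuousAt_const.mul (contMDiffAt_oneChart_symm oneChart_one_mem).continuousAt
    filter_upwards [this.eventually ((oneChart E G).open_source.mem_nhds (by simpa using hs))] with y hy
    simp [mulLoc, (oneChart E G).left_inv hy]
  have := hasMFDerivAt_unique (hc1.congr_of_eventuallyEq hcong) hc2
  have := congrArg (fun T : E →L[ℂ] E => T X) this
  exact this.symm

/-- The bracket is the commutator of the left invariant vector fields `x ↦ ∂₂ m(x, 1) X`, where `m` is
the multiplication in the chart. -/
theorem lieE_eq (X Y : E) : lieE G X Y =
    fderiv ℂ (fun x => fderiv ℂ (mulLoc E G) (x, oneChart E G 1) (0, Y)) (oneChart E G 1) X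
    - fderiv ℂ (fun x => fderiv ℂ (mulLoc E G) (x, oneChart E G 1) (0, X)) (oneChart E G 1) Y := by
  have h1 : lieE G X Y = (ContinuousLinearMap.inverse (M := E) (M₂ := E)
      (mfderiv 𝓘(ℂ, E) 𝓘(ℂ, E) (oneChart E G) (1 : G)) : E →L[ℂ] E)
      (VectorField.lieBracket ℂ (invField G X) (invField G Y) (oneChart E G 1)) := by
    let V : E → E → E := fun X => VectorField.mpullbackWithin 𝓘(ℂ, E) 𝓘(ℂ, E) (oneChart E G).symm
      (mulInvariantVectorField (I := 𝓘(ℂ, E)) (G := G) X) (range (id : E → E))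
    have hV : ∀ X, V X = invField G X := by
      intro X
      simp only [V, range_id, VectorField.mpullbackWithin_univ]
      rfl
    have hS : (oneChart E G).symm ⁻¹' univ ∩ range (id : E → E) = univ := by simp
    have h2 : VectorField.lieBracketWithin ℂ (V X) (V Y)
        ((oneChart E G).symm ⁻¹' univ ∩ range (id : E → E)) (oneChart E G 1) =
        VectorField.lieBracket ℂ (invField G X) (invField G Y) (oneChart E G 1) := by
      rw [hV, hV, hS, VectorField.lieBracketWithin_univ]
    rw [← h2]
    rfl
  rw [h1, hasMFDerivAt_oneChart_one.mfderiv]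
  have hX := invField_eventually (G := G) X
  have hY := invField_eventually (G := G) Y
  have hid : ∀ X : E, fderiv ℂ (mulLoc E G) (oneChart E G 1, oneChart E G 1) (0, X) = X := by
    intro X
    have := (((contDiffAt_mulLoc_one (E := E) (G := G)).differentiableAt
      (by simp)).hasFDerivAt.restrictScalars ℝ).unique hasFDerivAt_mulLoc
    have := congrArg (fun T => T (0, X)) this
    simpa using this
  have e := VectorField.lieBracket_eq (𝕜 := ℂ)
    (V := fun x => fderiv ℂ (mulLoc E G) (x, oneChart E G 1) (0, X))
    (W := fun x => fderiv ℂ (mulLoc E G) (x, oneChart E G 1) (0, Y))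
  have e' := (Filter.EventuallyEq.lieBracket_vectorField_eq (𝕜 := ℂ) hX hY).trans (congrFun e _)
  simp only [hid] at e'
  refine Eq.trans ?_ e'
  exact congrFun (congrArg _ (ContinuousLinearMap.inverse_id (R := ℂ) (M := E))) _

end Bracket

/-! ### The Maurer-Cartan equation -/

section MaurerCartanEquation

variable {E : Type*} [NormedAddCommGroup E] [NormedSpace ℂ E]
  {F : Type*} [NormedAddCommGroup F] [NormedSpace ℝ F]
  {F' : Type*} [NormedAddCommGroup F'] [NormedSpace ℝ F']
  {G : Type*} [TopologicalSpace G] [ChartedSpace E G] [Group G] [LieGroup 𝓘(ℂ, E) ω G]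

variable (E G) in
/-- The Maurer-Cartan form read in the chart at the identity: the derivative of `y ↦ x⁻¹ y` at
`y = x`. -/
def mcLoc (x : E) : E →L[ℝ] E :=
  (fderiv ℝ (divLoc E G) (x, x)).comp (ContinuousLinearMap.inr ℝ E E)

variable (E G) in
/-- The inverse of `mcLoc`: the trivialization of the tangent bundle by left invariant vector
fields. -/
def trivLoc (x : E) : E →L[ℝ] E :=
  (fderiv ℝ (mulLoc E G) (x, oneChart E G 1)).comp (ContinuousLinearMap.inr ℝ E E)

theorem contDiffAt_divLoc_diag {x : E} (hx : x ∈ (oneChart E G).target) :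
    ContDiffAt ℝ ω (divLoc E G) (x, x) :=
  (contDiffAt_divLoc (p := (x, x)) hx hx (by simp)).restrict_scalars ℝ

theorem contDiffAt_mulLoc_left {x : E} (hx : x ∈ (oneChart E G).target) :
    ContDiffAt ℂ ω (mulLoc E G) (x, oneChart E G 1) :=
  contDiffAt_mulLoc (p := (x, oneChart E G 1)) hx oneChart_one_mem
    (by simpa using (oneChart E G).map_target hx)

theorem contDiffAt_mcLoc {x : E} (hx : x ∈ (oneChart E G).target) :
    ContDiffAt ℝ ω (mcLoc E G) x := by
  have h : ContDiffAt ℝ ω (fun x => fderiv ℝ (divLoc E G) (x, x)) x :=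
    ContDiffAt.comp (g := fderiv ℝ (divLoc E G)) x
      ((contDiffAt_divLoc_diag hx).fderiv_right (m := ω) (by simp))
      (contDiffAt_id.prodMk contDiffAt_id)
  exact h.clm_comp contDiffAt_const

theorem contDiffAt_trivLoc {x : E} (hx : x ∈ (oneChart E G).target) :
    ContDiffAt ℝ ω (trivLoc E G) x := by
  have h : ContDiffAt ℝ ω (fun x => fderiv ℝ (mulLoc E G) (x, oneChart E G 1)) x :=
    ContDiffAt.comp (g := fderiv ℝ (mulLoc E G)) x
      (((contDiffAt_mulLoc_left hx).restrict_scalars ℝ).fderiv_right (m := ω) (by simp))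
      (contDiffAt_id.prodMk contDiffAt_const)
  exact h.clm_comp contDiffAt_const

theorem hasFDerivAt_mulLoc_left {x : E} (hx : x ∈ (oneChart E G).target) :
    HasFDerivAt (fun y => mulLoc E G (x, y)) (trivLoc E G x) (oneChart E G 1) :=
  HasFDerivAt.comp (g := mulLoc E G) _
    (((contDiffAt_mulLoc_left hx).restrict_scalars ℝ).differentiableAt (by simp)).hasFDerivAt
    (hasFDerivAt_prodMk_right _ _)

theorem hasFDerivAt_divLoc_left {x : E} (hx : x ∈ (oneChart E G).target) :
    HasFDerivAt (fun y => divLoc E G (x, y)) (mcLoc E G x) x :=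
  HasFDerivAt.comp (g := divLoc E G) _
    ((contDiffAt_divLoc_diag hx).differentiableAt (by simp)).hasFDerivAt
    (hasFDerivAt_prodMk_right _ _)

theorem mulLoc_one {x : E} (hx : x ∈ (oneChart E G).target) :
    mulLoc E G (x, oneChart E G 1) = x := by
  simp [mulLoc, (oneChart E G).right_inv hx]

theorem mcLoc_trivLoc {x : E} (hx : x ∈ (oneChart E G).target) :
    (mcLoc E G x).comp (trivLoc E G x) = ContinuousLinearMap.id ℝ E := by
  have : IsTopologicalGroup G := topologicalGroup_of_lieGroup 𝓘(ℂ, E) ω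
  have h1 := HasFDerivAt.comp (g := fun y => divLoc E G (x, y)) (oneChart E G 1)
    (by rw [mulLoc_one hx]; exact hasFDerivAt_divLoc_left hx) (hasFDerivAt_mulLoc_left hx)
  refine h1.unique ((hasFDerivAt_id _).congr_of_eventuallyEq ?_)
  have hc : ContinuousAt (fun y => (oneChart E G).symm x * (oneChart E G).symm y)
      (oneChart E G 1) :=
    continuousAt_const.mul (contMDiffAt_oneChart_symm oneChart_one_mem).continuousAt
  filter_upwards [hc.eventually ((oneChart E G).open_source.mem_nhds
    (by simpa using (oneChart E G).map_target hx)),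
    (oneChart E G).open_target.mem_nhds oneChart_one_mem] with y hy hy'
  simp [mulLoc, divLoc, (oneChart E G).left_inv hy, (oneChart E G).right_inv hy']

theorem mcLoc_one : mcLoc E G (oneChart E G 1) = ContinuousLinearMap.id ℝ E := by
  refine (hasFDerivAt_divLoc_left oneChart_one_mem).unique
    ((hasFDerivAt_id _).congr_of_eventuallyEq ?_)
  filter_upwards [(oneChart E G).open_target.mem_nhds oneChart_one_mem] with y hy'
  simp [divLoc, (oneChart E G).right_inv hy']

theorem trivLoc_one : trivLoc E G (oneChart E G 1) = ContinuousLinearMap.id ℝ E := by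
  have := mcLoc_trivLoc (oneChart_one_mem (E := E) (G := G))
  rwa [mcLoc_one, ContinuousLinearMap.id_comp] at this

/-- The bracket is the antisymmetric part of the derivative of left invariant vector fields. -/
theorem lieE_eq_trivLoc (X Y : E) : lieE G X Y =
    fderiv ℝ (trivLoc E G) (oneChart E G 1) X Y - fderiv ℝ (trivLoc E G) (oneChart E G 1) Y X := by
  have key : ∀ X Y : E, fderiv ℂ (fun x => fderiv ℂ (mulLoc E G) (x, oneChart E G 1) (0, Y))
      (oneChart E G 1) X = fderiv ℝ (trivLoc E G) (oneChart E G 1) X Y := by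
    intro X Y
    have h1 : ContDiffAt ℂ ω (fun x => fderiv ℂ (mulLoc E G) (x, oneChart E G 1) (0, Y))
        (oneChart E G 1) := by
      have h : ContDiffAt ℂ ω (fun x => fderiv ℂ (mulLoc E G) (x, oneChart E G 1))
          (oneChart E G 1) :=
        ContDiffAt.comp (g := fderiv ℂ (mulLoc E G)) _
          ((contDiffAt_mulLoc_left oneChart_one_mem).fderiv_right (m := ω) (by simp))
          (contDiffAt_id.prodMk contDiffAt_const)
      exact h.clm_apply contDiffAt_const
    have h2 := (h1.differentiableAt (by simp)).hasFDerivAt.restrictScalars ℝ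
    have h3 : HasFDerivAt (fun x => trivLoc E G x Y)
        ((ContinuousLinearMap.apply ℝ E Y).comp (fderiv ℝ (trivLoc E G) (oneChart E G 1)))
        (oneChart E G 1) :=
      (ContinuousLinearMap.apply ℝ E Y).hasFDerivAt.comp _
        ((contDiffAt_trivLoc oneChart_one_mem).differentiableAt (by simp)).hasFDerivAt
    have h4 := h3.unique (h2.congr_of_eventuallyEq ?_)
    · exact (congrArg (fun T => T X) h4).symm
    · filter_upwards [(oneChart E G).open_target.mem_nhds oneChart_one_mem] with x hx
      have := (((contDiffAt_mulLoc_left hx).differentiableAt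
        (by simp)).hasFDerivAt.restrictScalars ℝ).fderiv
      simp [trivLoc, this]
  rw [lieE_eq, key, key]

/-- The Maurer-Cartan equation at the identity. -/
theorem lieE_eq_mcLoc (X Y : E) : fderiv ℝ (mcLoc E G) (oneChart E G 1) X Y -
    fderiv ℝ (mcLoc E G) (oneChart E G 1) Y X = - lieE G X Y := by
  -- differentiate `mcLoc x ∘ trivLoc x = id` at the identity
  have key : fderiv ℝ (mcLoc E G) (oneChart E G 1) = - fderiv ℝ (trivLoc E G) (oneChart E G 1) := by
    have h1 := ((contDiffAt_mcLoc (oneChart_one_mem (E := E) (G := G))).differentiableAt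
      (by simp)).hasFDerivAt
    have h2 := ((contDiffAt_trivLoc (oneChart_one_mem (E := E) (G := G))).differentiableAt
      (by simp)).hasFDerivAt
    have h3 := h1.clm_comp h2
    have h4 := h3.unique ((hasFDerivAt_const (ContinuousLinearMap.id ℝ E) _).congr_of_eventuallyEq
      (by
        filter_upwards [(oneChart E G).open_target.mem_nhds (oneChart_one_mem (E := E) (G := G))] with x hx
        exact mcLoc_trivLoc hx))
    ext X Y
    have := congrArg (fun T => T X Y) h4
    simp only [mcLoc_one, trivLoc_one] at this
    simp at this
    simpa using eq_neg_of_add_eq_zero_right this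
  rw [lieE_eq_trivLoc, key]
  simp; abel

theorem logDer_const_mul (g : G) (f : F → G) :
    logDer (E := E) (fun y => g * f y) = logDer (E := E) f := by
  funext x
  simp [logDer, mul_assoc]

theorem hasLogDeriv_of_mdifferentiableAt {f : F → G} {x : F}
    (hf : MDifferentiableAt 𝓘(ℝ, F) 𝓘(ℝ, E) f x) : HasLogDeriv f (logDer (E := E) f x) x := by
  refine ⟨hf.continuousAt, ?_⟩
  have h1 : MDifferentiableAt 𝓘(ℝ, E) 𝓘(ℝ, E) (fun h : G => (f x)⁻¹ * h) (f x) :=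
    (contMDiff_mul_left (I := 𝓘(ℝ, E)) (n := ω)).mdifferentiable (by simp) _
  have h2 : MDifferentiableAt 𝓘(ℝ, E) 𝓘(ℝ, E) (oneChart E G) ((f x)⁻¹ * f x) :=
    ((contMDiffOn_chart (I := 𝓘(ℝ, E)) (n := ω)).contMDiffAt ((oneChart E G).open_source.mem_nhds
      (by simp))).mdifferentiableAt (by simp)
  have h3 := (MDifferentiableAt.comp (I' := 𝓘(ℝ, E)) x
    (MDifferentiableAt.comp (I' := 𝓘(ℝ, E)) (f x) h2 h1) hf)
  exact h3.differentiableAt.hasFDerivAt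

theorem HasLogDeriv.mdifferentiableAt {f : F → G} {L : F →L[ℝ] E} {x : F}
    (hf : HasLogDeriv f L x) : MDifferentiableAt 𝓘(ℝ, F) 𝓘(ℝ, E) f x := by
  have : IsTopologicalGroup G := topologicalGroup_of_lieGroup 𝓘(ℂ, E) ω
  have h1 : MDifferentiableAt 𝓘(ℝ, E) 𝓘(ℝ, E) (fun h : G => f x * h)
      ((oneChart E G).symm (oneChart E G ((f x)⁻¹ * f x))) :=
    (contMDiff_mul_left (I := 𝓘(ℝ, E)) (n := ω)).mdifferentiable (by simp) _
  have h2 : MDifferentiableAt 𝓘(ℝ, E) 𝓘(ℝ, E) (oneChart E G).symm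
      (oneChart E G ((f x)⁻¹ * f x)) :=
    ((contMDiffOn_chart_symm (I := 𝓘(ℝ, E)) (n := ω)).contMDiffAt
      ((oneChart E G).open_target.mem_nhds (by simp))).mdifferentiableAt (by simp)
  have h3 := MDifferentiableAt.comp (I' := 𝓘(ℝ, E)) x
    (MDifferentiableAt.comp (I' := 𝓘(ℝ, E)) _ h1 h2) hf.2.differentiableAt.mdifferentiableAt
  refine h3.congr_of_eventuallyEq ?_
  have hc : ContinuousAt (fun y => (f x)⁻¹ * f y) x := continuousAt_const.mul hf.1
  filter_upwards [hc.eventually ((oneChart E G).open_source.mem_nhds (by simp))] with y hy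
  simp [(oneChart E G).left_inv hy]

/-- The chart at the identity, composed with a mapping which has a logarithmic derivative. -/
theorem HasLogDeriv.hasFDerivAt_oneChart {f : F → G} {L : F →L[ℝ] E} {x : F}
    (hf : HasLogDeriv f L x) (hx : f x ∈ (oneChart E G).source) :
    HasFDerivAt (fun y => oneChart E G (f y)) ((trivLoc E G (oneChart E G (f x))).comp L) x := by
  have : IsTopologicalGroup G := topologicalGroup_of_lieGroup 𝓘(ℂ, E) ω
  have h1 := HasFDerivAt.comp (g := fun y => mulLoc E G (oneChart E G (f x), y)) x
    (by simpa using hasFDerivAt_mulLoc_left ((oneChart E G).map_source hx)) hf.2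
  refine h1.congr_of_eventuallyEq ?_
  have hc : ContinuousAt (fun y => (f x)⁻¹ * f y) x := continuousAt_const.mul hf.1
  filter_upwards [hc.eventually ((oneChart E G).open_source.mem_nhds (by simp))] with y hy
  simp [mulLoc, (oneChart E G).left_inv hy, (oneChart E G).left_inv hx]

/-- The logarithmic derivative expressed in the chart at the identity. -/
theorem logDer_eq_mcLoc {f : F → G} {x : F} (hx : f x ∈ (oneChart E G).source)
    (hc : ContinuousAt f x) (hd : DifferentiableAt ℝ (fun y => oneChart E G (f y)) x) :
    logDer f x = (mcLoc E G (oneChart E G (f x))).comp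
      (fderiv ℝ (fun y => oneChart E G (f y)) x) := by
  have h1 := HasFDerivAt.comp (g := fun y => divLoc E G (oneChart E G (f x), y)) x
    (hasFDerivAt_divLoc_left ((oneChart E G).map_source hx)) hd.hasFDerivAt
  refine (h1.congr_of_eventuallyEq ?_).fderiv
  filter_upwards [hc.eventually ((oneChart E G).open_source.mem_nhds hx)] with y hy
  simp [divLoc, (oneChart E G).left_inv hy, (oneChart E G).left_inv hx]

theorem contDiffAt_oneChart_comp {f : F → G} {x : F} {n : WithTop ℕ∞} (hx : f x ∈ (oneChart E G).source)
    (hf : ContMDiffAt 𝓘(ℝ, F) 𝓘(ℝ, E) n f x) :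
    ContDiffAt ℝ n (fun y => oneChart E G (f y)) x := by
  rw [← contMDiffAt_iff_contDiffAt]
  exact ContMDiffAt.comp (I' := 𝓘(ℝ, E)) x
    (((contMDiffOn_chart (I := 𝓘(ℝ, E)) (n := ω)).of_le le_top).contMDiffAt
      ((oneChart E G).open_source.mem_nhds hx)) hf

theorem logDer_eventuallyEq {f : F → G} {x : F} (hx : f x ∈ (oneChart E G).source)
    (hf : ContMDiffAt 𝓘(ℝ, F) 𝓘(ℝ, E) ∞ f x) : logDer f =ᶠ[𝓝 x]
      fun y => (mcLoc E G (oneChart E G (f y))).comp (fderiv ℝ (fun y => oneChart E G (f y)) y) := by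
  have h1 : ContMDiffAt 𝓘(ℝ, F) 𝓘(ℝ, E) 1 f x := hf.of_le (by simp)
  have h2 := (contMDiffAt_iff_contMDiffAt_nhds (by simp)).1 h1
  filter_upwards [h2, hf.continuousAt.eventually ((oneChart E G).open_source.mem_nhds hx)] with y hy hy'
  exact logDer_eq_mcLoc hy' hy.continuousAt ((contDiffAt_oneChart_comp hy' hy).differentiableAt (by simp))

/-- The logarithmic derivative of a smooth mapping is smooth. -/
theorem contDiffAt_logDer {f : F → G} {x : F} (hf : ContMDiffAt 𝓘(ℝ, F) 𝓘(ℝ, E) ∞ f x) :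
    ContDiffAt ℝ ∞ (logDer (E := E) f) x := by
  rw [← logDer_const_mul (f x)⁻¹ f]
  have hf' : ContMDiffAt 𝓘(ℝ, F) 𝓘(ℝ, E) ∞ (fun y => (f x)⁻¹ * f y) x := contMDiffAt_const.mul hf
  set f' : F → G := fun y => (f x)⁻¹ * f y with hf'def
  have hx : f' x ∈ (oneChart E G).source := by simp [hf'def]
  have hu := contDiffAt_oneChart_comp hx hf'
  refine ContDiffAt.congr_of_eventuallyEq ?_ (logDer_eventuallyEq hx hf')
  refine ContDiffAt.clm_comp ?_ (hu.fderiv_right (m := ∞) (by simp))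
  exact ContDiffAt.comp x ((contDiffAt_mcLoc ((oneChart E G).map_source hx)).of_le le_top) hu

/-- The Maurer-Cartan equation `dα + [α, α] / 2 = 0` for `α = f^* θ`, evaluated at two constant
vector fields. By left invariance one may assume `f x = 1`; what remains is the symmetry of second
derivatives and `lieE_eq_mcLoc`. -/
theorem maurerCartan_equation {f : F → G} {x : F} (hf : ContMDiffAt 𝓘(ℝ, F) 𝓘(ℝ, E) ∞ f x)
    (v w : F) : fderiv ℝ (logDer (E := E) f) x v w - fderiv ℝ (logDer (E := E) f) x w v +
      lieE G (logDer (E := E) f x v) (logDer (E := E) f x w) = 0 := by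
  rw [← logDer_const_mul (f x)⁻¹ f]
  have hf' : ContMDiffAt 𝓘(ℝ, F) 𝓘(ℝ, E) ∞ (fun y => (f x)⁻¹ * f y) x := contMDiffAt_const.mul hf
  set f' : F → G := fun y => (f x)⁻¹ * f y with hf'def
  have hx1 : f' x = 1 := by simp [hf'def]
  have hx : f' x ∈ (oneChart E G).source := by simp [hx1]
  have hu := contDiffAt_oneChart_comp hx hf'
  have he := logDer_eventuallyEq hx hf'
  have hD : logDer (E := E) f' x = fderiv ℝ (fun y => oneChart E G (f' y)) x := by
    rw [he.self_of_nhds]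
    simp only [hx1, mcLoc_one, ContinuousLinearMap.id_comp]
  have h1 : HasFDerivAt (fun y => mcLoc E G (oneChart E G (f' y))) _ x :=
    HasFDerivAt.comp (g := mcLoc E G) x
    (((contDiffAt_mcLoc ((oneChart E G).map_source hx)).differentiableAt (by simp)).hasFDerivAt)
    (hu.differentiableAt (by simp)).hasFDerivAt
  have h2 := ((hu.fderiv_right (m := ∞) (by simp)).differentiableAt (by simp)).hasFDerivAt
  have h3 := (h1.clm_comp h2).congr_of_eventuallyEq he
  have hsymm := hu.isSymmSndFDerivAt (n := ∞) (by
    rw [minSmoothness_of_isRCLikeNormedField]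
    exact WithTop.coe_le_coe.2 (le_top : (2 : ℕ∞) ≤ ⊤))
  rw [h3.fderiv, hD]
  have hb := lieE_eq_mcLoc (G := G) (fderiv ℝ (fun y => oneChart E G (f' y)) x v)
    (fderiv ℝ (fun y => oneChart E G (f' y)) x w)
  simp only [hx1, mcLoc_one]
  simp
  rw [hsymm.eq v w, ← sub_eq_zero.2 hb]
  abel

end MaurerCartanEquation

/-! ### The adjoint representation -/

section Adjoint

variable {E : Type*} [NormedAddCommGroup E] [NormedSpace ℂ E]
  {F : Type*} [NormedAddCommGroup F] [NormedSpace ℝ F]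
  {G : Type*} [TopologicalSpace G] [ChartedSpace E G] [Group G] [LieGroup 𝓘(ℂ, E) ω G]

theorem hasLogDeriv_oneChart_symm : HasLogDeriv (oneChart E G).symm (ContinuousLinearMap.id ℝ E)
    (oneChart E G 1) := by
  refine ⟨(contMDiffAt_oneChart_symm oneChart_one_mem).continuousAt, ?_⟩
  refine (hasFDerivAt_id _).congr_of_eventuallyEq ?_
  filter_upwards [(oneChart E G).open_target.mem_nhds (oneChart_one_mem (E := E) (G := G))] with x hx
  simp [(oneChart E G).right_inv hx]

theorem contMDiffAt_oneChart_symm_real {x : E} (hx : x ∈ (oneChart E G).target) :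
    ContMDiffAt 𝓘(ℝ, E) 𝓘(ℝ, E) ∞ (oneChart E G).symm x :=
  (((contMDiffOn_chart_symm (I := 𝓘(ℝ, E)) (n := ω)).contMDiffAt
    ((oneChart E G).open_target.mem_nhds hx))).of_le le_top

@[simp] theorem adE_one : adE E (1 : G) = ContinuousLinearMap.id ℂ E := by
  have h : HasFDerivAt (fun x => oneChart E G (1 * (oneChart E G).symm x * 1⁻¹))
      (ContinuousLinearMap.id ℂ E) (oneChart E G 1) := by
    refine (hasFDerivAt_id _).congr_of_eventuallyEq ?_
    filter_upwards [(oneChart E G).open_target.mem_nhds oneChart_one_mem] with x hx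
    simp [(oneChart E G).right_inv hx]
  exact h.fderiv

theorem adE_mul (g h : G) : adE E (g * h) = (adE E g).comp (adE E h) := by
  have : IsTopologicalGroup G := topologicalGroup_of_lieGroup 𝓘(ℂ, E) ω
  have h1 := ((contDiffAt_conjLoc (E := E) g).differentiableAt (by simp)).hasFDerivAt
  have h2 := ((contDiffAt_conjLoc (E := E) h).differentiableAt (by simp)).hasFDerivAt
  have h3 := HasFDerivAt.comp (g := fun x => oneChart E G (g * (oneChart E G).symm x * g⁻¹))
    (oneChart E G 1) (by simpa using h1) h2
  refine (h3.congr_of_eventuallyEq ?_).fderiv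
  have hc : ContinuousAt (fun x => h * (oneChart E G).symm x * h⁻¹) (oneChart E G 1) :=
    (continuousAt_const.mul (contMDiffAt_oneChart_symm oneChart_one_mem).continuousAt).mul
      continuousAt_const
  filter_upwards [hc.eventually ((oneChart E G).open_source.mem_nhds (by simp))] with x hx
  simp only [Function.comp_apply, (oneChart E G).left_inv hx]
  simp [mul_assoc]

theorem adE_mul_apply (g h : G) (Y : E) : adE E (g * h) Y = adE E g (adE E h Y) := by
  rw [adE_mul]; rfl

@[simp] theorem adE_inv_apply_self (g : G) (Y : E) : adE E g⁻¹ (adE E g Y) = Y := by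
  rw [← adE_mul_apply]; simp

@[simp] theorem adE_apply_inv_self (g : G) (Y : E) : adE E g (adE E g⁻¹ Y) = Y := by
  rw [← adE_mul_apply]; simp

/-- The logarithmic derivative of the pointwise inverse. -/
theorem HasLogDeriv.inv {f : F → G} {L : F →L[ℝ] E} {x : F} (hf : HasLogDeriv f L x) :
    HasLogDeriv (fun y => (f y)⁻¹) (-((adE E (f x)).restrictScalars ℝ).comp L) x := by
  have h1 : MDifferentiableAt 𝓘(ℝ, F) 𝓘(ℝ, E) (fun y => (f y)⁻¹) x :=
    MDifferentiableAt.comp (I' := 𝓘(ℝ, E)) x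
      ((contMDiff_inv (G := G) 𝓘(ℝ, E) ω).mdifferentiable (by simp) _) hf.mdifferentiableAt
  have h2 := hasLogDeriv_of_mdifferentiableAt h1
  have h3 := hf.mul h2
  simp only [mul_inv_cancel, inv_inv] at h3
  have h4 := h3.unique (hasLogDeriv_const 1 x)
  rwa [← eq_neg_iff_add_eq_zero.2 ((add_comm _ _).trans h4)]

/-- The vector `Ad(f y) s` is a value of the logarithmic derivative of the auxiliary mapping
`(s, y) ↦ χ⁻¹(s) * f(y)⁻¹`, where `χ` is the chart.  Hence the smoothness of `Ad` and its derivative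
follow from those of logarithmic derivatives. -/
theorem adE_eq_logDer {f : F → G} {x : F} (hf : MDifferentiableAt 𝓘(ℝ, F) 𝓘(ℝ, E) f x) (s : E) :
    adE E (f x) s = logDer (E := E) (fun p : E × F => (oneChart E G).symm p.1 * (f p.2)⁻¹)
      (oneChart E G 1, x) (s, 0) := by
  have h1 : HasLogDeriv (fun p : E × F => (oneChart E G).symm p.1) _ (oneChart E G 1, x) :=
    HasLogDeriv.comp (u := Prod.fst) (f := (oneChart E G).symm) hasLogDeriv_oneChart_symm
      (hasFDerivAt_fst (𝕜 := ℝ))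
  have h2 : HasLogDeriv (fun p : E × F => (f p.2)⁻¹) _ (oneChart E G 1, x) :=
    HasLogDeriv.comp (u := Prod.snd) (f := fun y => (f y)⁻¹)
      (hasLogDeriv_of_mdifferentiableAt (x := x) hf).inv (hasFDerivAt_snd (𝕜 := ℝ))
  rw [(h1.mul h2).logDer]
  simp

theorem contMDiffAt_oneChart_symm_mul_inv {f : F → G} {x : F}
    (hf : ContMDiffAt 𝓘(ℝ, F) 𝓘(ℝ, E) ∞ f x) : ContMDiffAt 𝓘(ℝ, E × F) 𝓘(ℝ, E) ∞
      (fun p : E × F => (oneChart E G).symm p.1 * (f p.2)⁻¹) (oneChart E G 1, x) := by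
  have a : ContMDiffAt 𝓘(ℝ, E × F) 𝓘(ℝ, E) ∞ (fun p : E × F => (oneChart E G).symm p.1)
      (oneChart E G 1, x) :=
    ContMDiffAt.comp (I' := 𝓘(ℝ, E)) (f := Prod.fst) _
      (contMDiffAt_oneChart_symm_real oneChart_one_mem) contDiffAt_fst.contMDiffAt
  have b : ContMDiffAt 𝓘(ℝ, E × F) 𝓘(ℝ, E) ∞ (fun p : E × F => f p.2) (oneChart E G 1, x) :=
    ContMDiffAt.comp (I' := 𝓘(ℝ, F)) (f := Prod.snd) _ hf contDiffAt_snd.contMDiffAt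
  exact a.mul b.inv

theorem contDiffAt_adE {f : F → G} {x : F} (hf : ContMDiffAt 𝓘(ℝ, F) 𝓘(ℝ, E) ∞ f x) (s : E) :
    ContDiffAt ℝ ∞ (fun y => adE E (f y) s) x := by
  have h1 := contDiffAt_logDer (contMDiffAt_oneChart_symm_mul_inv hf)
  have h2 : ContDiffAt ℝ ∞ (fun y => logDer (E := E)
      (fun p : E × F => (oneChart E G).symm p.1 * (f p.2)⁻¹) (oneChart E G 1, y) (s, 0)) x := by
    refine ContDiffAt.clm_apply ?_ contDiffAt_const
    exact ContDiffAt.comp x h1 (contDiffAt_const.prodMk contDiffAt_id)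
  refine h2.congr_of_eventuallyEq ?_
  have h3 := (contMDiffAt_iff_contMDiffAt_nhds (by simp)).1 (hf.of_le (m := 1) (by simp))
  filter_upwards [h3] with y hy
  exact adE_eq_logDer (hy.mdifferentiableAt (by simp)) s

variable [CompleteSpace E]

theorem lieE_add_left (X Y Z : E) : lieE G (X + Y) Z = lieE G X Z + lieE G Y Z :=
  add_lie (L := GroupLieAlgebra 𝓘(ℂ, E) G) (M := GroupLieAlgebra 𝓘(ℂ, E) G) X Y Z

theorem lieE_add_right (X Y Z : E) : lieE G X (Y + Z) = lieE G X Y + lieE G X Z :=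
  lie_add (L := GroupLieAlgebra 𝓘(ℂ, E) G) (M := GroupLieAlgebra 𝓘(ℂ, E) G) X Y Z

theorem lieE_smul_left (c : ℂ) (X Y : E) : lieE G (c • X) Y = c • lieE G X Y :=
  smul_lie (L := GroupLieAlgebra 𝓘(ℂ, E) G) (M := GroupLieAlgebra 𝓘(ℂ, E) G) c X Y

theorem lieE_smul_right (c : ℂ) (X Y : E) : lieE G X (c • Y) = c • lieE G X Y :=
  lie_smul (L := GroupLieAlgebra 𝓘(ℂ, E) G) (M := GroupLieAlgebra 𝓘(ℂ, E) G) c X Y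

theorem lieE_skew (X Y : E) : lieE G X Y = - lieE G Y X :=
  (lie_skew (L := GroupLieAlgebra 𝓘(ℂ, E) G) X Y).symm

variable (G) in
/-- The bracket as a bilinear mapping. -/
def lieLin : E →ₗ[ℂ] E →ₗ[ℂ] E :=
  LinearMap.mk₂ ℂ (lieE G) lieE_add_left lieE_smul_left lieE_add_right lieE_smul_right

variable [FiniteDimensional ℂ E]

variable (G) in
/-- The bracket as a continuous bilinear mapping. -/
def lieL : E →L[ℂ] E →L[ℂ] E := (lieLin G).toContinuousBilinearMap

@[simp] theorem lieL_apply (X Y : E) : lieL G X Y = lieE G X Y := rfl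

/-- The differential of `Ad` at the identity is `ad`. -/
theorem hasFDerivAt_adE_oneChart_symm (Y : E) :
    HasFDerivAt (fun t => adE E ((oneChart E G).symm t) Y)
      (((lieL G).flip Y).restrictScalars ℝ) (oneChart E G 1) := by
  have hf := contMDiffAt_oneChart_symm_real (oneChart_one_mem (E := E) (G := G))
  have hd := ((contDiffAt_adE hf Y).differentiableAt (by simp)).hasFDerivAt
  convert hd using 1
  ext w
  -- the Maurer-Cartan equation for `(s, t) ↦ χ⁻¹(s) χ⁻¹(t)⁻¹` in the directions `(Y, 0)`, `(0, w)`
  set Φ : E × E → G := fun p => (oneChart E G).symm p.1 * ((oneChart E G).symm p.2)⁻¹ with hΦ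
  have hΦs : ContMDiffAt 𝓘(ℝ, E × E) 𝓘(ℝ, E) ∞ Φ (oneChart E G 1, oneChart E G 1) :=
    contMDiffAt_oneChart_symm_mul_inv hf
  have hmc := maurerCartan_equation hΦs (Y, 0) (0, w)
  have hl := (contDiffAt_logDer hΦs).differentiableAt (by simp) |>.hasFDerivAt
  set x1 := oneChart E G 1 with hx1
  have htgt := (oneChart E G).open_target.mem_nhds (oneChart_one_mem (E := E) (G := G))
  have hl1 : HasFDerivAt (fun t => logDer (E := E) Φ (t, x1) (0, w)) _ x1 :=
    HasFDerivAt.comp (g := fun T : E × E →L[ℝ] E => T (0, w)) x1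
      (ContinuousLinearMap.apply ℝ E ((0, w) : E × E)).hasFDerivAt
      (HasFDerivAt.comp (g := logDer (E := E) Φ) (f := fun t => (t, x1)) x1 hl
        (hasFDerivAt_prodMk_left x1 x1))
  have hl2 : HasFDerivAt (fun t => logDer (E := E) Φ (x1, t) (Y, 0)) _ x1 :=
    HasFDerivAt.comp (g := fun T : E × E →L[ℝ] E => T (Y, 0)) x1
      (ContinuousLinearMap.apply ℝ E ((Y, 0) : E × E)).hasFDerivAt
      (HasFDerivAt.comp (g := logDer (E := E) Φ) (f := fun t => (x1, t)) x1 hl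
        (hasFDerivAt_prodMk_right x1 x1))
  have hsymm : ∀ᶠ t in 𝓝 x1, MDifferentiableAt 𝓘(ℝ, E) 𝓘(ℝ, E) (oneChart E G).symm t := by
    filter_upwards [htgt] with t ht
    exact (contMDiffAt_oneChart_symm_real ht).mdifferentiableAt (by simp)
  have hval : ∀ t, MDifferentiableAt 𝓘(ℝ, E) 𝓘(ℝ, E) (oneChart E G).symm t →
      logDer (E := E) Φ (t, x1) (0, w) = -w := by
    intro t ht
    have h1 : HasLogDeriv (fun p : E × E => (oneChart E G).symm p.1) _ (t, x1) :=
      HasLogDeriv.comp (u := Prod.fst) (f := (oneChart E G).symm)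
        (hasLogDeriv_of_mdifferentiableAt (x := t) ht) (hasFDerivAt_fst (𝕜 := ℝ))
    have h2 : HasLogDeriv (fun p : E × E => ((oneChart E G).symm p.2)⁻¹) _ (t, x1) :=
      HasLogDeriv.comp (u := Prod.snd) (f := fun y => ((oneChart E G).symm y)⁻¹)
        (hasLogDeriv_oneChart_symm).inv (hasFDerivAt_snd (𝕜 := ℝ))
    rw [hΦ, (h1.mul h2).logDer]
    simp [hx1]
  have e1 := hl1.unique ((hasFDerivAt_const (-w) x1).congr_of_eventuallyEq
    (hsymm.mono fun t ht => hval t ht))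
  have e2 := hl2.unique (hd.congr_of_eventuallyEq
    (hsymm.mono fun t ht => (adE_eq_logDer (f := (oneChart E G).symm) ht Y).symm))
  have e1' := congrArg (fun T => T Y) e1
  have e2' := congrArg (fun T => T w) e2
  simp only [ContinuousLinearMap.comp_apply, ContinuousLinearMap.inl_apply,
    ContinuousLinearMap.inr_apply, ContinuousLinearMap.apply_apply] at e1' e2'
  have e3 := (adE_eq_logDer (f := (oneChart E G).symm) hsymm.self_of_nhds Y)
  rw [← hΦ, ← hx1] at e3
  rw [e1', e2', ← e3, hval _ hsymm.self_of_nhds] at hmc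
  simp [hx1] at hmc
  have e4 : lieE G Y (-w) = lieE G w Y := by
    rw [lieE_skew, ← lieL_apply, map_neg, neg_apply, neg_neg, lieL_apply]
  rw [e4] at hmc
  simpa [hx1] using (neg_add_eq_zero.1 hmc).symm

/-- The derivative of the adjoint representation along a mapping into the group. -/
theorem HasLogDeriv.adE {f : F → G} {L : F →L[ℝ] E} {x : F} (hf : HasLogDeriv f L x) (Y : E) :
    HasFDerivAt (fun y => adE E (f y) Y)
      ((((Toda.adE E (f x)).comp ((lieL G).flip Y)).restrictScalars ℝ).comp L) x := by
  have : IsTopologicalGroup G := topologicalGroup_of_lieGroup 𝓘(ℂ, E) ω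
  have h1 := HasFDerivAt.comp (g := fun t => Toda.adE E ((oneChart E G).symm t) Y) x
    (by simpa using hasFDerivAt_adE_oneChart_symm Y) hf.2
  have h2 := ((Toda.adE E (f x)).restrictScalars ℝ).hasFDerivAt.comp x h1
  refine h2.congr_of_eventuallyEq ?_
  have hc : ContinuousAt (fun y => (f x)⁻¹ * f y) x := continuousAt_const.mul hf.1
  filter_upwards [hc.eventually ((oneChart E G).open_source.mem_nhds (by simp))] with y hy
  simp [(oneChart E G).left_inv hy, ← adE_mul_apply]

/-- `Ad g` is an automorphism of the Lie algebra. -/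
theorem adE_lieE (g : G) (X Y : E) :
    adE E g (lieE G X Y) = lieE G (adE E g X) (adE E g Y) := by
  have h1 := (hasLogDeriv_oneChart_symm (E := E) (G := G))
  have h2 := ((h1.const_mul g).mul (hasLogDeriv_const g⁻¹ _)).adE (adE E g Y)
  have h3 := ((adE E g).restrictScalars ℝ).hasFDerivAt.comp _ (h1.adE Y)
  have h4 := h2.unique (h3.congr_of_eventuallyEq (Eventually.of_forall fun t => by
    simp [← adE_mul_apply, mul_assoc]))
  have := congrArg (fun T => T X) h4
  simpa using this.symm

theorem eventually_eq_of_hasLogDeriv_zero {f : F → G} {x : F}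
    (hf : ∀ᶠ y in 𝓝 x, HasLogDeriv f (0 : F →L[ℝ] E) y) : ∀ᶠ y in 𝓝 x, f y = f x := by
  have : IsTopologicalGroup G := topologicalGroup_of_lieGroup 𝓘(ℂ, E) ω
  have hc : ContinuousAt (fun y => (f x)⁻¹ * f y) x :=
    continuousAt_const.mul hf.self_of_nhds.1
  have hc' := hc.eventually ((oneChart E G).open_source.mem_nhds (by simp))
  obtain ⟨r, hr, hball⟩ := Metric.eventually_nhds_iff_ball.1 (hf.and hc')
  filter_upwards [Metric.ball_mem_nhds x hr] with y hy
  have hd : ∀ z ∈ Metric.ball x r,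
      HasFDerivAt (fun y => oneChart E G ((f x)⁻¹ * f y)) (0 : F →L[ℝ] E) z := by
    intro z hz
    simpa using ((hball z hz).1.const_mul (f x)⁻¹).hasFDerivAt_oneChart (hball z hz).2
  have hconst := (convex_ball x r).is_const_of_fderivWithin_eq_zero (𝕜 := ℝ)
    (fun z hz => (hd z hz).differentiableAt.differentiableWithinAt)
    (fun z hz => by
      rw [fderivWithin_of_isOpen Metric.isOpen_ball hz, (hd z hz).fderiv]) hy
    (Metric.mem_ball_self hr)
  have h : (f x)⁻¹ * f y = (f x)⁻¹ * f x := (oneChart E G).injOn (hball y hy).2 (hball x (Metric.mem_ball_self hr)).2 hconst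
  exact mul_left_cancel h

end Adjoint

/-! ### One-parameter groups -/

section Exponential

variable {E : Type*} [NormedAddCommGroup E] [NormedSpace ℂ E]
  {F : Type*} [NormedAddCommGroup F] [NormedSpace ℝ F]
  {G : Type*} [TopologicalSpace G] [ChartedSpace E G] [Group G] [LieGroup 𝓘(ℂ, E) ω G]

variable (E) in
/-- The Maurer-Cartan form, as a mapping of the model space. -/
def mcE (g : G) : E →L[ℂ] E := maurerCartan (E := E) g

variable (E) in
/-- The differential at `1` of the left translation by `g`, as a mapping of the model space. -/
def leftE (g : G) : E →L[ℂ] E := mfderiv 𝓘(ℂ, E) 𝓘(ℂ, E) (fun h : G => g * h) 1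

theorem hasMFDerivAt_mcE (g : G) :
    HasMFDerivAt 𝓘(ℂ, E) 𝓘(ℂ, E) (fun h : G => g⁻¹ * h) g (mcE E g) :=
  ((contMDiff_mul_left (I := 𝓘(ℂ, E)) (n := ω)).mdifferentiable (by simp) _).hasMFDerivAt

theorem hasMFDerivAt_leftE (g : G) :
    HasMFDerivAt 𝓘(ℂ, E) 𝓘(ℂ, E) (fun h : G => g * h) 1 (leftE E g) :=
  ((contMDiff_mul_left (I := 𝓘(ℂ, E)) (n := ω)).mdifferentiable (by simp) _).hasMFDerivAt

theorem leftE_mcE (g : G) : (leftE E g).comp (mcE E g) = ContinuousLinearMap.id ℂ E := by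
  have h := HasMFDerivAt.comp (I' := 𝓘(ℂ, E)) (g := fun h : G => g * h) (f := fun h : G => g⁻¹ * h) g
    (by rw [inv_mul_cancel]; exact hasMFDerivAt_leftE g) (hasMFDerivAt_mcE (E := E) g)
  have h' : HasMFDerivAt 𝓘(ℂ, E) 𝓘(ℂ, E) (fun h : G => g * (g⁻¹ * h)) g
      (ContinuousLinearMap.id ℂ E) := by
    exact (hasMFDerivAt_id (I := 𝓘(ℂ, E)) g).congr_of_eventuallyEq
      (Eventually.of_forall fun h => by simp)
  exact hasMFDerivAt_unique h h'

theorem hasLogDeriv_of_hasMFDerivAt {f : F → G} {x : F} {L : F →L[ℝ] E}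
    (hf : HasMFDerivAt 𝓘(ℝ, F) 𝓘(ℝ, E) f x L) :
    HasLogDeriv f (((mcE E (f x)).restrictScalars ℝ).comp L) x := by
  refine ⟨hf.continuousAt, ?_⟩
  have h1 := hasMFDerivAt_restrictScalars (hasMFDerivAt_mcE (E := E) (f x))
  have h2 : HasMFDerivAt 𝓘(ℝ, E) 𝓘(ℝ, E) (oneChart E G) ((f x)⁻¹ * f x)
      (ContinuousLinearMap.id ℝ E) := by
    rw [inv_mul_cancel]
    exact hasMFDerivAt_restrictScalars (hasMFDerivAt_oneChart_one (E := E) (G := G))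
  have h3 := HasMFDerivAt.comp (I' := 𝓘(ℝ, E)) x (HasMFDerivAt.comp (I' := 𝓘(ℝ, E)) (f x) h2 h1) hf
  exact h3.hasFDerivAt

theorem HasLogDeriv.hasMFDerivAt {f : F → G} {x : F} {L : F →L[ℝ] E} (hf : HasLogDeriv f L x) :
    HasMFDerivAt 𝓘(ℝ, F) 𝓘(ℝ, E) f x (((leftE E (f x)).restrictScalars ℝ).comp L) := by
  have h1 := hf.mdifferentiableAt.hasMFDerivAt
  set D : F →L[ℝ] E := mfderiv 𝓘(ℝ, F) 𝓘(ℝ, E) f x with hD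
  have h2 := hf.unique (hasLogDeriv_of_hasMFDerivAt h1)
  have h3 : ((leftE E (f x)).restrictScalars ℝ).comp L = D := by
    rw [h2]
    ext v
    exact congrArg (fun T => T (D v)) (leftE_mcE (E := E) (f x))
  exact (congrArg (fun T : F →L[ℝ] E => HasMFDerivAt 𝓘(ℝ, F) 𝓘(ℝ, E) f x T) h3).mpr h1

theorem mcE_leftE (g : G) (X : E) : mcE E g (leftE E g X) = X := by
  have hm : HasMFDerivAt 𝓘(ℂ, E) 𝓘(ℂ, E) (fun h : G => g⁻¹ * h) (g * 1) (mcE E g) := by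
    rw [mul_one]; exact hasMFDerivAt_mcE g
  have h := HasMFDerivAt.comp (I' := 𝓘(ℂ, E)) (g := fun h : G => g⁻¹ * h) (f := fun h : G => g * h) 1
    hm (hasMFDerivAt_leftE (E := E) g)
  have h' : HasMFDerivAt 𝓘(ℂ, E) 𝓘(ℂ, E) (fun h : G => g⁻¹ * (g * h)) 1
      (ContinuousLinearMap.id ℂ E) := by
    exact (hasMFDerivAt_id (I := 𝓘(ℂ, E)) (1 : G)).congr_of_eventuallyEq
      (Eventually.of_forall fun h => by simp)
  exact congrArg (fun T : E →L[ℂ] E => T X) (hasMFDerivAt_unique h h')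

theorem mulInvariantVectorField_real (X : E) (g : G) :
    mulInvariantVectorField (I := 𝓘(ℝ, E)) (G := G) X g = leftE E g X := by
  have := (hasMFDerivAt_restrictScalars (hasMFDerivAt_leftE (E := E) g)).mfderiv
  exact congrArg (fun T : E →L[ℝ] E => T X) this

/-- Integral curves of left invariant vector fields are the curves with constant logarithmic
derivative. -/
theorem hasMFDerivAt_iff_hasLogDeriv {c : ℝ → G} {X : E} {t : ℝ} :
    HasMFDerivAt 𝓘(ℝ, ℝ) 𝓘(ℝ, E) c t ((1 : ℝ →L[ℝ] ℝ).smulRight (leftE E (c t) X)) ↔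
    HasLogDeriv c ((1 : ℝ →L[ℝ] ℝ).smulRight X) t := by
  constructor
  · intro h
    have e : ((mcE E (c t)).restrictScalars ℝ).comp
        ((1 : ℝ →L[ℝ] ℝ).smulRight (leftE E (c t) X)) = (1 : ℝ →L[ℝ] ℝ).smulRight X := by
      ext
      simp [mcE_leftE]
    exact e ▸ hasLogDeriv_of_hasMFDerivAt h
  · intro h
    have e : ((leftE E (c t)).restrictScalars ℝ).comp ((1 : ℝ →L[ℝ] ℝ).smulRight X) =
        (1 : ℝ →L[ℝ] ℝ).smulRight (leftE E (c t) X) := by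
      ext
      simp
    exact (congrArg (fun T : ℝ →L[ℝ] E => HasMFDerivAt 𝓘(ℝ, ℝ) 𝓘(ℝ, E) c t T) e).mp h.hasMFDerivAt

theorem isExp_iff {X : E} {g : G} : IsExp (E := E) X g ↔
    ∃ c : ℝ → G, (∀ t, HasLogDeriv c ((1 : ℝ →L[ℝ] ℝ).smulRight X) t) ∧ c 0 = 1 ∧ c 1 = g := by
  unfold IsExp IsMIntegralCurve
  constructor
  · rintro ⟨c, h, h'⟩
    exact ⟨c, fun t => hasMFDerivAt_iff_hasLogDeriv.1 (h t), h'⟩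
  · rintro ⟨c, h, h'⟩
    exact ⟨c, fun t => hasMFDerivAt_iff_hasLogDeriv.2 (h t), h'⟩

variable [FiniteDimensional ℂ E] [CompleteSpace E] [T2Space G]

/-- Local integral curves through `1` extend to all times, since left translations carry them to
integral curves through any point with the same time of existence. -/
theorem exists_oneParam (X : E) : ∃ c : ℝ → G,
    (∀ t, HasLogDeriv c ((1 : ℝ →L[ℝ] ℝ).smulRight X) t) ∧ c 0 = 1 := by
  have hv : ContMDiff 𝓘(ℝ, E) 𝓘(ℝ, E).tangent 1 (fun g : G =>
      (⟨g, mulInvariantVectorField (I := 𝓘(ℝ, E)) (G := G) X g⟩ : TangentBundle 𝓘(ℝ, E) G)) :=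
    (contMDiff_mulInvariantVectorField (I := 𝓘(ℝ, E)) (G := G) X).of_le (by
      rw [minSmoothness_of_isRCLikeNormedField]; exact one_le_two)
  obtain ⟨c, hc0, hc⟩ := exists_isMIntegralCurveAt_of_contMDiffAt_boundaryless (t₀ := 0) (x₀ := (1 : G))
    hv.contMDiffAt
  obtain ⟨ε, hε, hc⟩ := Metric.eventually_nhds_iff_ball.1 hc
  have hlog : ∀ t ∈ Ioo (-ε) ε, HasLogDeriv c ((1 : ℝ →L[ℝ] ℝ).smulRight X) t := by
    intro t ht
    have := hc t (by simpa [abs_lt] using ht)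
    rw [mulInvariantVectorField_real] at this
    exact hasMFDerivAt_iff_hasLogDeriv.1 this
  obtain ⟨γ, h0, h1⟩ := exists_isMIntegralCurve_of_isMIntegralCurveOn hv hε (fun g => by
    refine ⟨fun t => g * c t, by simp [hc0], fun t ht => ?_⟩
    rw [mulInvariantVectorField_real]
    exact (hasMFDerivAt_iff_hasLogDeriv.2 ((hlog t ht).const_mul g)).hasMFDerivWithinAt) 1
  refine ⟨γ, fun t => ?_, h0⟩
  have := h1 t
  rw [mulInvariantVectorField_real] at this
  exact hasMFDerivAt_iff_hasLogDeriv.1 this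

/-- The real linear mapping `w ↦ w • X` of the complex line. -/
def spanC (X : E) : ℂ →L[ℝ] E := (ContinuousLinearMap.toSpanSingleton ℂ X).restrictScalars ℝ

@[simp] theorem spanC_apply (X : E) (w : ℂ) : spanC X w = w • X := rfl

theorem hasMFDerivAt_of_restrictScalars {F : Type*} [NormedAddCommGroup F] [NormedSpace ℂ F]
    {N : Type*} [TopologicalSpace N] [ChartedSpace F N] {f : N → G} {x : N}
    {L : F →L[ℂ] E} (h : HasMFDerivAt 𝓘(ℝ, F) 𝓘(ℝ, E) f x (L.restrictScalars ℝ)) :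
    HasMFDerivAt 𝓘(ℂ, F) 𝓘(ℂ, E) f x L :=
  ⟨h.1, HasFDerivWithinAt.of_restrictScalars ℝ (E := F) (F := E) h.2 rfl⟩

/-- A mapping of the complex line with complex linear logarithmic derivative is holomorphic, hence
analytic and smooth. -/
theorem contMDiffAt_of_hasLogDeriv_spanC {f : ℂ → G} {x : ℂ}
    (h : ∀ᶠ y in 𝓝 x, ∃ X : E, HasLogDeriv f (spanC X) y) :
    ContMDiffAt 𝓘(ℝ, ℂ) 𝓘(ℝ, E) ∞ f x := by
  have : IsTopologicalGroup G := topologicalGroup_of_lieGroup 𝓘(ℂ, E) ω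
  obtain ⟨X0, hX0⟩ := h.self_of_nhds
  have hc : ContinuousAt (fun y => (f x)⁻¹ * f y) x := continuousAt_const.mul hX0.1
  have hs := hc.eventually ((oneChart E G).open_source.mem_nhds (by simp))
  have hd : ∀ᶠ y in 𝓝 x, DifferentiableAt ℂ (fun y => oneChart E G ((f x)⁻¹ * f y)) y := by
    filter_upwards [h, hs] with y hy hys
    obtain ⟨X, hX⟩ := hy
    have h1 := hasMFDerivAt_of_restrictScalars (F := ℂ)
      (L := (leftE E ((f x)⁻¹ * f y)).comp (ContinuousLinearMap.toSpanSingleton ℂ X))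
      (hX.const_mul (f x)⁻¹).hasMFDerivAt
    exact (MDifferentiableAt.comp (I' := 𝓘(ℂ, E)) y
      ((contMDiffAt_oneChart hys).mdifferentiableAt (by simp)) h1.mdifferentiableAt).differentiableAt
  have ha : AnalyticAt ℂ (fun y => oneChart E G ((f x)⁻¹ * f y)) x :=
    Complex.analyticAt_iff_eventually_differentiableAt.2 hd
  have hr : ContDiffAt ℝ ∞ (fun y => oneChart E G ((f x)⁻¹ * f y)) x :=
    (ha.contDiffAt (n := ∞)).restrict_scalars ℝ
  have h2 : ContMDiffAt 𝓘(ℝ, ℂ) 𝓘(ℝ, E) ∞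
      (fun y => f x * (oneChart E G).symm (oneChart E G ((f x)⁻¹ * f y))) x :=
    contMDiffAt_const.mul (ContMDiffAt.comp (I' := 𝓘(ℝ, E)) (g := (oneChart E G).symm) x
      (contMDiffAt_oneChart_symm_real ((oneChart E G).map_source (by simp))) hr.contMDiffAt)
  refine h2.congr_of_eventuallyEq ?_
  filter_upwards [hs] with y hy
  simp [(oneChart E G).left_inv hy]

theorem lieE_self (X : E) : lieE G X X = 0 :=
  lie_self (L := GroupLieAlgebra 𝓘(ℂ, E) G) X

/-- The operators `Ad (exp (t X))` fix the vectors that commute with `X`. -/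
theorem adE_oneParam_of_lieE_eq_zero {X Y : E} {c : ℝ → G}
    (hc : ∀ t, HasLogDeriv c ((1 : ℝ →L[ℝ] ℝ).smulRight X) t) (h0 : c 0 = 1)
    (hXY : lieE G X Y = 0) (t : ℝ) : adE E (c t) Y = Y := by
  have h1 : ∀ t, HasFDerivAt (fun t => adE E (c t) Y) (0 : ℝ →L[ℝ] E) t := by
    intro t
    refine ((hc t).adE Y).congr_fderiv ?_
    ext
    simp [hXY]
  have := is_const_of_fderiv_eq_zero (𝕜 := ℝ) (fun t => (h1 t).differentiableAt)
    (fun t => (h1 t).fderiv) t 0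
  simpa [h0] using this

/-- The product `exp (Re(w) X) exp (Im(w) √-1 X)` has the complex linear logarithmic derivative
`w ↦ w • X`, since `Ad (exp (t √-1 X))` fixes `X`. -/
theorem exists_expC (X : E) : ∃ e : ℂ → G, e 0 = 1 ∧ ∀ w, HasLogDeriv e (spanC X) w := by
  obtain ⟨c, hc, hc0⟩ := exists_oneParam (G := G) X
  obtain ⟨d, hd, hd0⟩ := exists_oneParam (G := G) (Complex.I • X)
  refine ⟨fun w => c w.re * d w.im, by simp [hc0, hd0], fun w => ?_⟩
  have h1 := (hc w.re).comp (u := Complex.re) (x := w) Complex.reCLM.hasFDerivAt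
  have h2 := (hd w.im).comp (u := Complex.im) (x := w) Complex.imCLM.hasFDerivAt
  have h3 := h1.mul h2
  have hfix : adE E (d w.im)⁻¹ X = X := by
    have := adE_oneParam_of_lieE_eq_zero hd hd0 (Y := X)
      (by rw [lieE_smul_left, lieE_self, smul_zero]) w.im
    conv_lhs => rw [← this]
    simp
  convert h3 using 1
  ext v
  simp only [spanC_apply, add_apply, ContinuousLinearMap.comp_apply]
  simp [hfix]
  conv_lhs => rw [← Complex.re_add_im v]
  rw [add_smul, mul_smul]
  simp

/-- The complex one-parameter subgroup `w ↦ exp (w X)`. -/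
def expC (G : Type*) [TopologicalSpace G] [ChartedSpace E G] [Group G] [LieGroup 𝓘(ℂ, E) ω G]
    [T2Space G] (X : E) : ℂ → G := (exists_expC (G := G) X).choose

@[simp] theorem expC_zero (X : E) : expC G X 0 = 1 := (exists_expC (G := G) X).choose_spec.1

theorem hasLogDeriv_expC (X : E) (w : ℂ) : HasLogDeriv (expC G X) (spanC X) w :=
  (exists_expC (G := G) X).choose_spec.2 w

theorem contMDiff_expC (X : E) : ContMDiff 𝓘(ℝ, ℂ) 𝓘(ℝ, E) ∞ (expC G X) := fun _ =>
  contMDiffAt_of_hasLogDeriv_spanC (Eventually.of_forall fun y => ⟨X, hasLogDeriv_expC X y⟩)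

theorem hasLogDeriv_expC_smul (X : E) (w : ℂ) (t : ℝ) :
    HasLogDeriv (fun t : ℝ => expC G X (t * w)) ((1 : ℝ →L[ℝ] ℝ).smulRight (w • X)) t := by
  have h1 : HasFDerivAt (fun t : ℝ => (t : ℂ) * w) (Complex.ofRealCLM.smulRight w) t :=
    (Complex.ofRealCLM.smulRight w).hasFDerivAt
  convert HasLogDeriv.comp (u := fun t : ℝ => (t : ℂ) * w) (hasLogDeriv_expC (G := G) X (t * w)) h1
    using 1
  ext
  simp

theorem isExp_expC (X : E) (w : ℂ) : IsExp (E := E) (w • X) (expC G X w) :=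
  isExp_iff.2 ⟨fun t => expC G X (t * w), hasLogDeriv_expC_smul X w, by simp, by simp⟩

end Exponential

/-! ### The adjoint action of exponentials -/

section AdExp

variable {E : Type*} [NormedAddCommGroup E] [NormedSpace ℂ E]
  {F : Type*} [NormedAddCommGroup F] [NormedSpace ℝ F]
  {G : Type*} [TopologicalSpace G] [ChartedSpace E G] [Group G] [LieGroup 𝓘(ℂ, E) ω G]
  [FiniteDimensional ℂ E] [CompleteSpace E]

/-- The product rule for `Ad (f y) (Y y)`. -/
theorem HasLogDeriv.adE_apply {f : F → G} {L : F →L[ℝ] E} {x : F} (hf : HasLogDeriv f L x)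
    {Y : F → E} {Y' : F →L[ℝ] E} (hY : HasFDerivAt Y Y' x) :
    HasFDerivAt (fun y => Toda.adE E (f y) (Y y))
      (((Toda.adE E (f x)).restrictScalars ℝ).comp
        ((((lieL G).flip (Y x)).restrictScalars ℝ).comp L + Y')) x := by
  set b := Module.finBasis ℂ E
  let κ : Fin (Module.finrank ℂ E) → E →L[ℂ] ℂ := fun i => LinearMap.toContinuousLinearMap (b.coord i)
  have hb : ∀ y : E, ∑ i, κ i y • b i = y := fun y => b.sum_repr y
  have h1 : ∀ i, HasFDerivAt (fun y => κ i (Y y)) (((κ i).restrictScalars ℝ).comp Y') x := fun i =>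
    ((κ i).restrictScalars ℝ).hasFDerivAt.comp x hY
  have h2 := HasFDerivAt.fun_sum (u := Finset.univ) fun i _ => (h1 i).smul (hf.adE (b i))
  have h3 : (fun y => Toda.adE E (f y) (Y y)) = fun y => ∑ i, κ i (Y y) • Toda.adE E (f y) (b i) := by
    funext y
    conv_lhs => rw [← hb (Y y)]
    simp
  rw [h3]
  refine h2.congr_fderiv (ContinuousLinearMap.ext fun v => Eq.symm ?_)
  simp only [ContinuousLinearMap.comp_apply, add_apply, sum_apply, map_add,
    Finset.sum_add_distrib, ContinuousLinearMap.coe_restrictScalars']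
  congr 1
  · conv_lhs => rw [← hb (Y x)]
    simp
  · conv_lhs => rw [← hb (Y' v)]
    simp

theorem exp_apply_sub_mem {T : E →L[ℂ] E} {A B : Submodule ℂ E} (hA : ∀ y ∈ A, T y ∈ A)
    (hB : ∀ y ∈ B, T y ∈ A) {y : E} (hy : y ∈ B) : NormedSpace.exp T y - y ∈ A := by
  have h1 := NormedSpace.exp_series_hasSum_exp' (𝕂 := ℂ) T
  have h2 := (ContinuousLinearMap.apply ℂ E y).hasSum h1
  have h3 := (hasSum_nat_add_iff' 1).2 h2
  simp only [ContinuousLinearMap.apply_apply, smul_apply, Finset.range_one, Finset.sum_singleton,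
    Nat.factorial_zero, Nat.cast_one, inv_one, one_smul, pow_zero, one_apply_eq_self] at h3
  have hpow : ∀ n, (T ^ (n + 1)) y ∈ A := by
    intro n
    induction n with
    | zero => simpa using hB y hy
    | succ n ih => rw [pow_succ']; exact hA _ ih
  refine (Submodule.closed_of_finiteDimensional A).mem_of_tendsto h3.tendsto_sum_nat
    (Eventually.of_forall fun n => A.sum_mem fun i _ => A.smul_mem _ (hpow i))

/-- `Ad (exp X) = exp (ad X)`. -/
theorem adE_oneParam {X : E} {c : ℝ → G}
    (hc : ∀ t, HasLogDeriv c ((1 : ℝ →L[ℝ] ℝ).smulRight X) t) (h0 : c 0 = 1) (y : E) :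
    adE E (c 1) y = NormedSpace.exp (lieL G X) y := by
  set z := NormedSpace.exp (lieL G X) y with hz
  -- the curve `t ↦ Ad (exp (t X)) (exp (-t ad X) z)` is constant
  have hexp : ∀ t : ℝ, HasFDerivAt (fun t : ℝ => NormedSpace.exp ((t : ℂ) • (-lieL G X)) z)
      ((1 : ℝ →L[ℝ] ℝ).smulRight ((-lieL G X) (NormedSpace.exp ((t : ℂ) • (-lieL G X)) z))) t := by
    intro t
    have h1 := hasDerivAt_exp_smul_const' (𝕂 := ℂ) (-lieL G X) (t : ℂ)
    have h2 := (ContinuousLinearMap.apply ℂ E z).hasFDerivAt.comp_hasDerivAt (t : ℂ) h1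
    have h3 := (h2.hasFDerivAt.restrictScalars ℝ).comp t Complex.ofRealCLM.hasFDerivAt
    refine h3.congr_fderiv ?_
    ext
    simp
  have hd : ∀ t : ℝ, HasFDerivAt
      (fun t : ℝ => adE E (c t) (NormedSpace.exp ((t : ℂ) • (-lieL G X)) z)) (0 : ℝ →L[ℝ] E) t := by
    intro t
    refine ((hc t).adE_apply (hexp t)).congr_fderiv ?_
    ext
    simp
  have h := is_const_of_fderiv_eq_zero (𝕜 := ℝ) (fun t => (hd t).differentiableAt)
    (fun t => (hd t).fderiv) 1 0
  have hinv : NormedSpace.exp (-lieL G X) z = y := by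
    have : NormedSpace.exp (-lieL G X) * NormedSpace.exp (lieL G X) = 1 := by
      let : NormedAlgebra ℚ (E →L[ℂ] E) := NormedAlgebra.restrictScalars ℚ ℂ _
      refine (NormedSpace.exp_add_of_commute (𝔸 := E →L[ℂ] E)
        (Commute.neg_left (Commute.refl (lieL G X)))).symm.trans ?_
      simp
    exact congrArg (fun T : E →L[ℂ] E => T y) this
  simpa [h0, hinv] using h

/-- If `ad X` maps `A` and `B` to `A`, then `Ad (exp X) - 1` maps `B` to `A`. -/
theorem IsExp.adE_sub_mem {X : E} {g : G} (hg : IsExp (E := E) X g) {A B : Submodule ℂ E}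
    (hA : ∀ y ∈ A, lieE G X y ∈ A) (hB : ∀ y ∈ B, lieE G X y ∈ A) {y : E} (hy : y ∈ B) :
    adE E g y - y ∈ A := by
  obtain ⟨c, hc, h0, rfl⟩ := isExp_iff.1 hg
  rw [adE_oneParam hc h0]
  exact exp_apply_sub_mem hA hB hy

end AdExp

/-! ### Sums of graded pieces -/

section Gradation

variable {E : Type*} [NormedAddCommGroup E] [NormedSpace ℂ E]

/-- The sum `⨁_{m ∈ S} 𝔤_m` of the graded pieces with degree in the set `S`. -/
def gradSum (gr : ℤ → Submodule ℂ E) (S : Set ℤ) : Submodule ℂ E := ⨆ m : S, gr m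

variable {gr : ℤ → Submodule ℂ E}

theorem mem_gradSum {S : Set ℤ} {m : ℤ} (hm : m ∈ S) {x : E} (hx : x ∈ gr m) : x ∈ gradSum gr S :=
  Submodule.mem_iSup_of_mem (p := fun m : S => gr m) ⟨m, hm⟩ hx

theorem gradSum_mono {S T : Set ℤ} (h : S ⊆ T) : gradSum gr S ≤ gradSum gr T :=
  iSup_le fun m => fun _ hx => mem_gradSum (h m.2) hx

theorem gradSum_singleton (m : ℤ) : gradSum gr {m} = gr m :=
  le_antisymm (iSup_le fun i => by rw [show (i : ℤ) = m from i.2]) fun _ hx =>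
    mem_gradSum (mem_singleton m) hx

theorem gradSum_induction {S : Set ℤ} {P : E → Prop} (h0 : P 0)
    (hadd : ∀ x y, P x → P y → P (x + y)) (hm : ∀ m ∈ S, ∀ x ∈ gr m, P x) {x : E}
    (hx : x ∈ gradSum gr S) : P x :=
  Submodule.iSup_induction (fun m : S => gr m) (motive := P) hx (fun m x hx => hm m m.2 x hx) h0 hadd

/-- The linear mapping that acts on `𝔤_m` as the multiplication by `a m`. -/
def gradMap (h : DirectSum.IsInternal gr) (a : ℤ → ℂ) : E →ₗ[ℂ] E :=
  DirectSum.toModule ℂ ℤ E (fun m => a m • (gr m).subtype) ∘ₗ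
    (LinearEquiv.ofBijective (DirectSum.coeLinearMap gr) h).symm.toLinearMap

theorem gradMap_apply (h : DirectSum.IsInternal gr) (a : ℤ → ℂ) {m : ℤ} {x : E} (hx : x ∈ gr m) :
    gradMap h a x = a m • x := by
  have : (LinearEquiv.ofBijective (DirectSum.coeLinearMap gr) h).symm x =
      DirectSum.lof ℂ ℤ (fun m => gr m) m ⟨x, hx⟩ := by
    rw [LinearEquiv.symm_apply_eq]
    exact (DirectSum.coeLinearMap_lof gr m ⟨x, hx⟩).symm
  rw [gradMap, LinearMap.comp_apply]
  change DirectSum.toModule ℂ ℤ E (fun m => a m • (gr m).subtype)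
    ((LinearEquiv.ofBijective (DirectSum.coeLinearMap gr) h).symm x) = _
  rw [this, DirectSum.toModule_lof]
  rfl

open Classical in
/-- The projection onto `⨁_{m ∈ S} 𝔤_m`. -/
def gradProj (h : DirectSum.IsInternal gr) (S : Set ℤ) : E →ₗ[ℂ] E :=
  gradMap h fun m => if m ∈ S then 1 else 0

theorem mem_gradSum_univ (h : DirectSum.IsInternal gr) (x : E) : x ∈ gradSum gr univ := by
  have h1 : x ∈ ⨆ m, gr m := by rw [h.submodule_iSup_eq_top]; trivial
  exact (iSup_le fun m _ hx => mem_gradSum (mem_univ m) hx : (⨆ m, gr m) ≤ gradSum gr univ) h1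

theorem grad_induction (h : DirectSum.IsInternal gr) {P : E → Prop} (h0 : P 0)
    (hadd : ∀ x y, P x → P y → P (x + y)) (hm : ∀ m, ∀ x ∈ gr m, P x) (x : E) : P x :=
  gradSum_induction (P := P) h0 hadd (fun m _ => hm m) (mem_gradSum_univ h x)

theorem gradProj_mem (h : DirectSum.IsInternal gr) (S : Set ℤ) (x : E) :
    gradProj h S x ∈ gradSum gr S := by
  refine grad_induction h (P := fun x => gradProj h S x ∈ gradSum gr S) (by simp)
    (fun x y hx hy => ?_) (fun m x hx => ?_) x
  · rw [map_add]; exact Submodule.add_mem _ hx hy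
  · rw [gradProj, gradMap_apply h _ hx]
    split_ifs with hm
    · simpa using mem_gradSum hm hx
    · simp

theorem gradProj_of_mem (h : DirectSum.IsInternal gr) {S : Set ℤ} {x : E} (hx : x ∈ gradSum gr S) :
    gradProj h S x = x := by
  refine gradSum_induction (P := fun x => gradProj h S x = x) (by simp)
    (fun x y hx hy => ?_) (fun m hm x hx => ?_) hx
  · rw [map_add, hx, hy]
  · simp [gradProj, gradMap_apply h _ hx, hm]

theorem gradProj_of_disjoint (h : DirectSum.IsInternal gr) {S T : Set ℤ} (hST : Disjoint S T)
    {x : E} (hx : x ∈ gradSum gr T) : gradProj h S x = 0 := by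
  refine gradSum_induction (P := fun x => gradProj h S x = 0) (by simp)
    (fun x y hx hy => ?_) (fun m hm x hx => ?_) hx
  · rw [map_add, hx, hy, add_zero]
  · simp [gradProj, gradMap_apply h _ hx, disjoint_right.1 hST hm]

theorem gradProj_add_compl (h : DirectSum.IsInternal gr) (S : Set ℤ) (x : E) :
    gradProj h S x + gradProj h Sᶜ x = x := by
  refine grad_induction h (P := fun x => gradProj h S x + gradProj h Sᶜ x = x) (by simp)
    (fun x y hx hy => ?_) (fun m x hx => ?_) x
  · rw [map_add, map_add, add_add_add_comm, hx, hy]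
  · by_cases hm : m ∈ S <;> simp [gradProj, gradMap_apply h _ hx, hm]

theorem eq_zero_of_mem_gradSum (h : DirectSum.IsInternal gr) {S T : Set ℤ} (hST : Disjoint S T)
    {x : E} (hS : x ∈ gradSum gr S) (hT : x ∈ gradSum gr T) : x = 0 := by
  rw [← gradProj_of_mem h hS, gradProj_of_disjoint h hST hT]

variable {G : Type*} [TopologicalSpace G] [ChartedSpace E G] [Group G] [LieGroup 𝓘(ℂ, E) ω G]
  [FiniteDimensional ℂ E] [CompleteSpace E]

theorem IsGradation.internal (hgr : IsGradation (E := E) (G := G) gr) : DirectSum.IsInternal gr :=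
  hgr.isInternal

theorem IsGradation.lieE_mem (hgr : IsGradation (E := E) (G := G) gr) {m k : ℤ} {x y : E}
    (hx : x ∈ gr m) (hy : y ∈ gr k) : lieE G x y ∈ gr (m + k) := hgr.bracket_mem m k x hx y hy

theorem IsGradation.lieE_mem_gradSum (hgr : IsGradation (E := E) (G := G) gr) {S T U : Set ℤ}
    (hST : ∀ s ∈ S, ∀ t ∈ T, s + t ∈ U) {x y : E} (hx : x ∈ gradSum gr S) (hy : y ∈ gradSum gr T) :
    lieE G x y ∈ gradSum gr U := by
  refine gradSum_induction (P := fun x => lieE G x y ∈ gradSum gr U) ?_ ?_ (fun m hm x hx => ?_) hx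
  · rw [← lieL_apply, map_zero]; exact Submodule.zero_mem _
  · intro x x' h h'; rw [lieE_add_left]; exact Submodule.add_mem _ h h'
  · refine gradSum_induction (P := fun y => lieE G x y ∈ gradSum gr U) ?_ ?_ (fun k hk y hy => ?_) hy
    · rw [← lieL_apply, map_zero]; exact Submodule.zero_mem _
    · intro x x' h h'; rw [lieE_add_right]; exact Submodule.add_mem _ h h'
    · exact mem_gradSum (hST m hm k hk) (hgr.lieE_mem hx hy)

variable [LieAlgebra.IsSemisimple ℂ (GroupLieAlgebra 𝓘(ℂ, E) G)]

theorem eq_zero_of_lieE_eq_zero {x : E} (h : ∀ y, lieE G x y = 0) : x = 0 := by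
  have h1 : (x : GroupLieAlgebra 𝓘(ℂ, E) G) ∈ LieAlgebra.center ℂ (GroupLieAlgebra 𝓘(ℂ, E) G) := by
    refine (LieModule.mem_maxTrivSubmodule (R := ℂ) (L := GroupLieAlgebra 𝓘(ℂ, E) G)
      (M := GroupLieAlgebra 𝓘(ℂ, E) G) x).2 fun y => ?_
    exact (lieE_skew (E := E) (G := G) y x).trans ((congrArg Neg.neg (h y)).trans neg_zero)
  rw [LieAlgebra.center_eq_bot] at h1
  exact h1

/-- An element `x` such that `ad x` raises degrees only by elements of `S` has all its components of
degree in `S`, because the centre is trivial. -/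
theorem IsGradation.mem_gradSum_of_lieE (hgr : IsGradation (E := E) (G := G) gr) {S : Set ℤ} {x : E}
    (h : ∀ j, ∀ y ∈ gr j, lieE G x y ∈ gradSum gr {i | i - j ∈ S}) : x ∈ gradSum gr S := by
  have h0 : gradProj hgr.internal Sᶜ x = 0 := by
    refine eq_zero_of_lieE_eq_zero (G := G) fun y => ?_
    refine grad_induction hgr.internal (P := fun y => lieE G (gradProj hgr.internal Sᶜ x) y = 0)
      ?_ (fun y y' h h' => by rw [lieE_add_right, h, h', add_zero]) (fun j y hy => ?_) y
    · rw [← lieL_apply, map_zero]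
    · have hy' : y ∈ gradSum gr {j} := by rwa [gradSum_singleton]
      refine eq_zero_of_mem_gradSum hgr.internal (S := {i | i - j ∈ S}) (T := {i | i - j ∈ Sᶜ})
        (disjoint_left.2 fun i hi hi' => hi' hi) ?_ ?_
      · have e : gradProj hgr.internal Sᶜ x = x - gradProj hgr.internal S x :=
          eq_sub_of_add_eq' (gradProj_add_compl _ _ _)
        rw [e, ← lieL_apply, map_sub, sub_apply]
        refine Submodule.sub_mem _ (h j y hy) ?_
        exact hgr.lieE_mem_gradSum (S := S) (T := {j}) (by rintro s hs _ rfl; simpa using hs)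
          (gradProj_mem _ _ _) hy'
      · exact hgr.lieE_mem_gradSum (S := Sᶜ) (T := {j}) (by rintro s hs _ rfl; simpa using hs)
          (gradProj_mem _ _ _) hy'
  rw [← gradProj_add_compl hgr.internal S x, h0, add_zero]
  exact gradProj_mem _ _ _

/-- The grading element exists: the derivation which multiplies `𝔤_m` by `m` is inner, as `𝔤` is
semisimple. -/
theorem IsGradation.exists_gradingElement (hgr : IsGradation (E := E) (G := G) gr) :
    ∃ d ∈ gr 0, ∀ m, ∀ x ∈ gr m, lieE G d x = (m : ℂ) • x := by
  let D : E →ₗ[ℂ] E := gradMap hgr.internal fun m => m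
  have hD : ∀ x y, D (lieE G x y) = lieE G x (D y) - lieE G y (D x) := by
    intro x y
    refine grad_induction hgr.internal
      (P := fun x => D (lieE G x y) = lieE G x (D y) - lieE G y (D x)) ?_ ?_ (fun m x hx => ?_) x
    · simp [← lieL_apply]
    · intro x x' h h'
      rw [lieE_add_left, map_add, map_add, h, h', lieE_add_left, lieE_add_right]; abel
    · refine grad_induction hgr.internal
        (P := fun y => D (lieE G x y) = lieE G x (D y) - lieE G y (D x)) ?_ ?_ (fun k y hy => ?_) y
      · simp [← lieL_apply]
      · intro x x' h h'
        rw [lieE_add_right, map_add, map_add, h, h', lieE_add_right, lieE_add_left]; abel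
      · rw [gradMap_apply _ _ hx, gradMap_apply _ _ hy, gradMap_apply _ _ (hgr.lieE_mem hx hy),
          lieE_smul_right, lieE_smul_right, lieE_skew y x, smul_neg, sub_neg_eq_add, ← add_smul]
        push_cast
        rw [add_comm]
  let D' : LieDerivation ℂ (GroupLieAlgebra 𝓘(ℂ, E) G) (GroupLieAlgebra 𝓘(ℂ, E) G) :=
    { toLinearMap := D
      leibniz' := hD }
  have : FiniteDimensional ℂ (GroupLieAlgebra 𝓘(ℂ, E) G) := ‹FiniteDimensional ℂ E›
  obtain ⟨d, hd⟩ : ∃ d, LieDerivation.ad ℂ (GroupLieAlgebra 𝓘(ℂ, E) G) d = D' :=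
    LieDerivation.IsKilling.exists_eq_ad D'
  have hd' : ∀ x : E, lieE (E := E) G d x = D x := fun x => by
    have e := congrArg (fun T => T (x : GroupLieAlgebra 𝓘(ℂ, E) G)) hd
    exact (congrArg (fun T => T (x : GroupLieAlgebra 𝓘(ℂ, E) G))
      (LieDerivation.coe_ad_apply_eq_ad_apply (R := ℂ) (L := GroupLieAlgebra 𝓘(ℂ, E) G) d)).symm.trans e
  have hd'' : ∀ m, ∀ x ∈ gr m, lieE (E := E) G d x = (m : ℂ) • x := fun m x hx =>
    (hd' x).trans (gradMap_apply _ _ hx)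
  refine ⟨d, ?_, hd''⟩
  rw [← gradSum_singleton (gr := gr) 0]
  refine hgr.mem_gradSum_of_lieE fun j y hy => ?_
  rw [hd'' j y hy]
  exact Submodule.smul_mem _ _ (mem_gradSum (by simp) hy)

end Gradation

/-! ### The subgroups defined by sets of degrees -/

section GradedGroup

variable {E : Type*} [NormedAddCommGroup E] [NormedSpace ℂ E]
  {F : Type*} [NormedAddCommGroup F] [NormedSpace ℝ F]
  {G : Type*} [TopologicalSpace G] [ChartedSpace E G] [Group G] [LieGroup 𝓘(ℂ, E) ω G]
  [FiniteDimensional ℂ E] [CompleteSpace E]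

theorem IsExp.inv {X : E} {g : G} (hg : IsExp (E := E) X g) : IsExp (E := E) (-X) g⁻¹ := by
  obtain ⟨c, hc, h0, rfl⟩ := isExp_iff.1 hg
  refine isExp_iff.2 ⟨fun t => (c 1)⁻¹ * c (1 - t), fun t => ?_, by simp, by simp [h0]⟩
  have h1 : HasFDerivAt (fun t : ℝ => 1 - t) (-(1 : ℝ →L[ℝ] ℝ)) t :=
    (hasFDerivAt_id t).const_sub 1
  have h2 := ((hc (1 - t)).comp (u := fun t : ℝ => 1 - t) h1).const_mul (c 1)⁻¹
  have e : ((1 : ℝ →L[ℝ] ℝ).smulRight X).comp (-(1 : ℝ →L[ℝ] ℝ)) =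
      (1 : ℝ →L[ℝ] ℝ).smulRight (-X) := by ext; simp
  rw [e] at h2
  exact h2

theorem IsExp.conj {X : E} {g : G} (hg : IsExp (E := E) X g) (h : G) :
    IsExp (E := E) (adE E h X) (h * g * h⁻¹) := by
  obtain ⟨c, hc, h0, rfl⟩ := isExp_iff.1 hg
  refine isExp_iff.2 ⟨fun t => h * c t * h⁻¹, fun t => ?_, by simp [h0], rfl⟩
  have h2 := ((hc t).const_mul h).mul (hasLogDeriv_const (F := ℝ) h⁻¹ t)
  have e : ((adE E (h⁻¹)⁻¹).restrictScalars ℝ).comp ((1 : ℝ →L[ℝ] ℝ).smulRight X) + 0 =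
      (1 : ℝ →L[ℝ] ℝ).smulRight (adE E h X) := by ext; simp
  rw [e] at h2
  exact h2

variable (G) in
/-- The connected subgroup `K_S` of `G` which corresponds to the sum of the graded pieces with
degree in `S`. -/
def gradGroup (gr : ℤ → Submodule ℂ E) (S : Set ℤ) : Subgroup G :=
  connectedSubgroup (E := E) (G := G) (gradSum gr S : Submodule ℂ E)

variable {gr : ℤ → Submodule ℂ E} {S T U : Set ℤ}

theorem IsExp.mem_gradGroup {X : E} {g : G} (hg : IsExp (E := E) X g) (hX : X ∈ gradSum gr S) :
    g ∈ gradGroup G gr S := Subgroup.subset_closure ⟨X, hX, hg⟩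

theorem gradGroup_mono (h : S ⊆ T) : gradGroup G gr S ≤ gradGroup G gr T :=
  Subgroup.closure_mono fun _ ⟨X, hX, hg⟩ => ⟨X, gradSum_mono (E := E) h hX, hg⟩

/-- No inverses are needed in the induction, because `(exp X)⁻¹ = exp (-X)`. -/
theorem gradGroup_induction {P : G → Prop} (h1 : P 1)
    (hmul : ∀ X ∈ gradSum gr S, ∀ g h : G, IsExp (E := E) X g → P h → P (g * h)) {g : G}
    (hg : g ∈ gradGroup G gr S) : P g := by
  refine Subgroup.closure_induction_left (p := fun g _ => P g) h1 ?_ ?_ hg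
  · rintro x ⟨X, hX, hx⟩ y _ hy
    exact hmul X hX x y hx hy
  · rintro x ⟨X, hX, hx⟩ y _ hy
    exact hmul (-X) (Submodule.neg_mem _ hX) x⁻¹ y hx.inv hy

/-- If `S + T` and `S + U` are contained in `U`, then `Ad g - 1` maps degrees in `T` to degrees in `U`
for all `g ∈ K_S`. -/
theorem IsGradation.adE_sub_mem (hgr : IsGradation (E := E) (G := G) gr)
    (hST : ∀ s ∈ S, ∀ t ∈ T, s + t ∈ U) (hSU : ∀ s ∈ S, ∀ u ∈ U, s + u ∈ U) {g : G}
    (hg : g ∈ gradGroup G gr S) {y : E} (hy : y ∈ gradSum gr T) :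
    adE E g y - y ∈ gradSum gr U := by
  refine gradGroup_induction (P := fun g => adE E g y - y ∈ gradSum gr U) ?_ ?_ hg
  · simp [adE_one]
  · intro X hX g h hg hh
    have h1 := hg.adE_sub_mem (fun y hy => hgr.lieE_mem_gradSum hSU hX hy)
      (fun y hy => hgr.lieE_mem_gradSum hSU hX hy) hh
    have h2 := hg.adE_sub_mem (fun y hy => hgr.lieE_mem_gradSum hSU hX hy)
      (fun y hy => hgr.lieE_mem_gradSum hST hX hy) hy
    have h3 := Submodule.add_mem _ (Submodule.add_mem _ h1 h2) hh
    rw [adE_mul_apply]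
    convert h3 using 1
    rw [map_sub]
    abel

theorem IsGradation.adE_mem (hgr : IsGradation (E := E) (G := G) gr)
    (hST : ∀ s ∈ S, ∀ t ∈ T, s + t ∈ T) {g : G} (hg : g ∈ gradGroup G gr S) {y : E}
    (hy : y ∈ gradSum gr T) : adE E g y ∈ gradSum gr T := by
  have h := Submodule.add_mem _ (hgr.adE_sub_mem hST hST hg hy) hy
  rwa [sub_add_cancel] at h

theorem IsGradation.conj_mem (hgr : IsGradation (E := E) (G := G) gr)
    (hST : ∀ s ∈ S, ∀ t ∈ T, s + t ∈ T) {g h : G} (hg : g ∈ gradGroup G gr S)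
    (hh : h ∈ gradGroup G gr T) : g * h * g⁻¹ ∈ gradGroup G gr T := by
  refine gradGroup_induction (P := fun h => g * h * g⁻¹ ∈ gradGroup G gr T) ?_ ?_ hh
  · simp
  · intro X hX h k hX' hk
    have := mul_mem ((hX'.conj g).mem_gradGroup (hgr.adE_mem hST hg hX)) hk
    simpa [mul_assoc] using this

variable [LieAlgebra.IsSemisimple ℂ (GroupLieAlgebra 𝓘(ℂ, E) G)]

/-- The logarithmic derivative of a mapping into a coset of `K_S` takes its values in the Lie
algebra of `K_S`.  As `K_S` is not known to be closed, this rests on the fact that its elements raise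
degrees by elements of `S`: so does `ad (L v)`, and `IsGradation.mem_gradSum_of_lieE` applies. -/
theorem HasLogDeriv.mem_gradSum (hgr : IsGradation (E := E) (G := G) gr)
    (hS : ∀ s ∈ S, ∀ t ∈ S, s + t ∈ S) {f : F → G} {L : F →L[ℝ] E} {x : F}
    (hf : HasLogDeriv f L x) (hK : ∀ᶠ y in 𝓝 x, (f x)⁻¹ * f y ∈ gradGroup G gr S) (v : F) :
    L v ∈ gradSum gr S := by
  refine hgr.mem_gradSum_of_lieE fun j Y hY => ?_
  set U : Set ℤ := {i | i - j ∈ S}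
  let π : E →L[ℂ] E := LinearMap.toContinuousLinearMap (gradProj hgr.internal Uᶜ)
  have h1 := (π.restrictScalars ℝ).hasFDerivAt.comp x ((hf.const_mul (f x)⁻¹).adE Y)
  have h2 : (fun y => π (Toda.adE E ((f x)⁻¹ * f y) Y)) =ᶠ[𝓝 x] fun _ => π Y := by
    filter_upwards [hK] with y hy
    have h3 : Toda.adE E ((f x)⁻¹ * f y) Y - Y ∈ gradSum gr U := by
      refine hgr.adE_sub_mem (T := {j}) ?_ ?_ hy (by rwa [gradSum_singleton])
      · rintro s hs _ rfl
        simpa [U] using hs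
      · intro s hs u hu
        have := hS s hs _ hu
        simpa [U, add_sub_assoc] using this
    have h4 : π (Toda.adE E ((f x)⁻¹ * f y) Y - Y) = 0 :=
      gradProj_of_disjoint hgr.internal disjoint_compl_left h3
    rwa [map_sub, sub_eq_zero] at h4
  have h5 := (hasFDerivAt_const (𝕜 := ℝ) (π Y) x).congr_of_eventuallyEq h2
  have h6 := congrArg (fun T : F →L[ℝ] E => T v) (h1.unique h5)
  have h7 : gradProj hgr.internal Uᶜ (lieE G (L v) Y) = 0 := by
    simpa [π, adE_one] using h6
  rw [← gradProj_add_compl hgr.internal U (lieE G (L v) Y), h7, add_zero]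
  exact gradProj_mem _ _ _

end GradedGroup

/-! ### Smooth local inverses -/

section LocalInverse

variable {V : Type*} [NormedAddCommGroup V] [NormedSpace ℝ V] [CompleteSpace V]

/-- The inverse function theorem, at a point where the differential is the identity.  The inverse is
smooth near the image of the point, and not only at that point. -/
theorem exists_smooth_localInverse {f : V → V} {x : V} (hf : ∀ᶠ y in 𝓝 x, ContDiffAt ℝ ∞ f y)
    (hd : HasFDerivAt f (ContinuousLinearMap.id ℝ V) x) :
    ∃ g : V → V, g (f x) = x ∧ (∀ᶠ y in 𝓝 (f x), f (g y) = y ∧ ContDiffAt ℝ ∞ g y) ∧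
      ∀ᶠ y in 𝓝 x, g (f y) = y := by
  have h0 := hf.self_of_nhds
  have hd' : HasFDerivAt f ((ContinuousLinearEquiv.refl ℝ V : V ≃L[ℝ] V) : V →L[ℝ] V) x := hd
  set e := h0.toOpenPartialHomeomorph f hd' (by simp)
  have hx : x ∈ e.source := h0.mem_toOpenPartialHomeomorph_source hd' (by simp)
  have hsymm : e.symm (f x) = x := e.left_inv hx
  refine ⟨e.symm, hsymm, ?_, ?_⟩
  · have hy : f x ∈ e.target := e.map_source hx
    have hc : Tendsto e.symm (𝓝 (f x)) (𝓝 x) := by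
      have := e.symm.continuousAt (x := f x) hy
      rwa [ContinuousAt, hsymm] at this
    have hfd : ContinuousAt (fderiv ℝ f) x := (h0.fderiv_right (m := 0) (by simp)).continuousAt
    have hinv : ∀ᶠ y in 𝓝 x, ∃ L : V ≃L[ℝ] V, (L : V →L[ℝ] V) = fderiv ℝ f y := by
      refine hfd.eventually (p := fun T : V →L[ℝ] V => ∃ L : V ≃L[ℝ] V, (L : V →L[ℝ] V) = T) ?_
      rw [hd'.fderiv]
      exact ContinuousLinearEquiv.nhds _
    filter_upwards [hc.eventually hinv, hc.eventually hf, e.open_target.mem_nhds hy] with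
      y ⟨L, hL⟩ hfy hyt
    refine ⟨e.right_inv hyt, e.contDiffAt_symm (f₀' := L) hyt ?_ hfy⟩
    rw [hL]
    exact (hfy.differentiableAt (by simp)).hasFDerivAt
  · filter_upwards [e.open_source.mem_nhds hx] with y hy using e.left_inv hy

end LocalInverse

/-! ### Products of one-parameter groups -/

section WordExp

variable {E : Type*} [NormedAddCommGroup E] [NormedSpace ℂ E]
  {F : Type*} [NormedAddCommGroup F] [NormedSpace ℂ F]
  (G : Type*) [TopologicalSpace G] [ChartedSpace E G] [Group G] [LieGroup 𝓘(ℂ, E) ω G]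
  [FiniteDimensional ℂ E] [CompleteSpace E] [T2Space G]

/-- The mapping `u ↦ exp (ℓ₁(u) X₁) ⋯ exp (ℓₙ(u) Xₙ)` defined by a list of pairs `(ℓ, X)`. -/
def wordExp (l : List ((F →L[ℂ] ℂ) × E)) (u : F) : G := (l.map fun p => expC G p.2 (p.1 u)).prod

variable {G}

@[simp] theorem wordExp_zero (l : List ((F →L[ℂ] ℂ) × E)) : wordExp G l 0 = 1 := by
  refine List.prod_eq_one fun x hx => ?_
  obtain ⟨p, -, rfl⟩ := List.mem_map.1 hx
  simp

/-- The logarithmic derivative of a product of one-parameter groups is complex linear; at `0` it is the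
sum of the logarithmic derivatives of the factors. -/
theorem exists_hasLogDeriv_wordExp (l : List ((F →L[ℂ] ℂ) × E)) (u : F) :
    ∃ L : F →L[ℂ] E, HasLogDeriv (wordExp G l) (L.restrictScalars ℝ) u ∧
      (u = 0 → ∀ v, L v = (l.map fun p => p.1 v • p.2).sum) := by
  induction l with
  | nil => exact ⟨0, hasLogDeriv_const 1 u, by simp⟩
  | cons p l ih =>
    obtain ⟨L, hL, hL0⟩ := ih
    have h1 := ((hasLogDeriv_expC (G := G) p.2 (p.1 u)).comp (u := p.1)
      (p.1.restrictScalars ℝ).hasFDerivAt).mul hL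
    refine ⟨(adE E (wordExp G l u)⁻¹).comp (p.1.smulRight p.2) + L, ?_, ?_⟩
    · exact h1
    · rintro rfl v
      simp [hL0 rfl, adE_one]

theorem contMDiff_wordExp (l : List ((F →L[ℂ] ℂ) × E)) :
    ContMDiff 𝓘(ℝ, F) 𝓘(ℝ, E) ∞ (wordExp G l) := by
  induction l with
  | nil => exact contMDiff_const
  | cons p l ih =>
    have h1 : ContMDiff 𝓘(ℝ, F) 𝓘(ℝ, ℂ) ∞ (fun u => p.1 u) :=
      (p.1.restrictScalars ℝ).contDiff.contMDiff
    exact ((contMDiff_expC (G := G) p.2).comp h1).mul ih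

theorem wordExp_mem {l : List ((F →L[ℂ] ℂ) × E)} {gr : ℤ → Submodule ℂ E} {S : Set ℤ}
    (hl : ∀ p ∈ l, p.2 ∈ gradSum gr S) (u : F) : wordExp G l u ∈ gradGroup G gr S := by
  refine Subgroup.list_prod_mem _ fun x hx => ?_
  obtain ⟨p, hp, rfl⟩ := List.mem_map.1 hx
  exact (isExp_expC p.2 (p.1 u)).mem_gradGroup (Submodule.smul_mem _ _ (hl p hp))

variable {gr : ℤ → Submodule ℂ E}

variable (G) in
/-- A mapping `E → G` whose differential at `0` is the linear mapping `A`.  It is a product of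
one-parameter groups in the directions `A b`, where `b` runs over a basis of `E`. -/
def linExp (A : E →ₗ[ℂ] E) : E → G :=
  wordExp G (List.ofFn fun i => (LinearMap.toContinuousLinearMap ((Module.finBasis ℂ E).coord i),
    A (Module.finBasis ℂ E i)))

theorem linExp_zero (A : E →ₗ[ℂ] E) : linExp G A 0 = 1 := wordExp_zero _

theorem linExp_mem {A : E →ₗ[ℂ] E} {S : Set ℤ} (hA : ∀ x, A x ∈ gradSum gr S) (u : E) :
    linExp G A u ∈ gradGroup G gr S := by
  refine wordExp_mem (fun p hp => ?_) u
  obtain ⟨i, rfl⟩ := (List.mem_ofFn' _ _).1 hp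
  exact hA _

theorem contMDiff_linExp (A : E →ₗ[ℂ] E) : ContMDiff 𝓘(ℝ, E) 𝓘(ℝ, E) ∞ (linExp G A) :=
  contMDiff_wordExp _

theorem exists_hasLogDeriv_linExp (A : E →ₗ[ℂ] E) (u : E) :
    ∃ L : E →L[ℂ] E, HasLogDeriv (linExp G A) (L.restrictScalars ℝ) u ∧
      (u = 0 → ∀ v, L v = A v) := by
  obtain ⟨L, h1, h2⟩ := exists_hasLogDeriv_wordExp (G := G) (List.ofFn fun i =>
    (LinearMap.toContinuousLinearMap ((Module.finBasis ℂ E).coord i), A (Module.finBasis ℂ E i))) u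
  refine ⟨L, h1, fun hu v => ?_⟩
  rw [h2 hu]
  conv_rhs => rw [← (Module.finBasis ℂ E).sum_repr v, map_sum]
  simp [List.sum_ofFn, List.map_ofFn]

variable (G) in
/-- A mapping `E → K_S` whose differential at `0` is the projection onto the Lie algebra of
`K_S`. -/
def gradExp (h : DirectSum.IsInternal gr) (S : Set ℤ) : E → G := linExp G (gradProj h S)

theorem gradExp_zero (h : DirectSum.IsInternal gr) (S : Set ℤ) : gradExp G h S 0 = 1 :=
  linExp_zero _

theorem gradExp_mem (h : DirectSum.IsInternal gr) (S : Set ℤ) (u : E) :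
    gradExp G h S u ∈ gradGroup G gr S := linExp_mem (gradProj_mem h S) u

theorem contMDiff_gradExp (h : DirectSum.IsInternal gr) (S : Set ℤ) :
    ContMDiff 𝓘(ℝ, E) 𝓘(ℝ, E) ∞ (gradExp G h S) := contMDiff_linExp _

theorem exists_hasLogDeriv_gradExp (h : DirectSum.IsInternal gr) (S : Set ℤ) (u : E) :
    ∃ L : E →L[ℂ] E, HasLogDeriv (gradExp G h S) (L.restrictScalars ℝ) u ∧
      (u = 0 → ∀ v, L v = gradProj h S v) := exists_hasLogDeriv_linExp _ u

end WordExp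

/-! ### Triangular splittings of the set of degrees -/

section Triangular

/-- The degrees are split into two sets `P` and `Q`, closed under addition, and `{0}`. -/
structure IsTriangular (P Q : Set ℤ) : Prop where
  add_left : ∀ s ∈ P, ∀ t ∈ P, s + t ∈ P
  add_right : ∀ s ∈ Q, ∀ t ∈ Q, s + t ∈ Q
  disjoint : Disjoint P Q
  zero_left : 0 ∉ P
  zero_right : 0 ∉ Q
  cover : ∀ m, m ∈ P ∨ m ∈ Q ∨ m = 0

theorem isTriangular_pos_neg : IsTriangular {m | 0 < m} {m | m < 0} where
  add_left s hs t ht := by simp at *; omega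
  add_right s hs t ht := by simp at *; omega
  disjoint := disjoint_left.2 fun m hm hm' => by simp at *; omega
  zero_left := by simp
  zero_right := by simp
  cover m := by simp; omega

theorem isTriangular_neg_pos : IsTriangular {m | m < 0} {m | 0 < m} where
  add_left s hs t ht := by simp at *; omega
  add_right s hs t ht := by simp at *; omega
  disjoint := disjoint_left.2 fun m hm hm' => by simp at *; omega
  zero_left := by simp
  zero_right := by simp
  cover m := by simp; omega

end Triangular

/-! ### The Gauss decomposition near the identity -/

section Gauss

variable {E : Type*} [NormedAddCommGroup E] [NormedSpace ℂ E]
  {F : Type*} [NormedAddCommGroup F] [NormedSpace ℝ F]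
  {G : Type*} [TopologicalSpace G] [ChartedSpace E G] [Group G] [LieGroup 𝓘(ℂ, E) ω G]
  [FiniteDimensional ℂ E] [CompleteSpace E] {gr : ℤ → Submodule ℂ E}

theorem gradProj_triangular (h : DirectSum.IsInternal gr) {P Q : Set ℤ} (hPQ : IsTriangular P Q)
    (x : E) : gradProj h P x + gradProj h Q x + gradProj h {0} x = x := by
  refine grad_induction h
    (P := fun x => gradProj h P x + gradProj h Q x + gradProj h {0} x = x) (by simp)
    (fun x y hx hy => ?_) (fun m x hx => ?_) x
  · conv_rhs => rw [← hx, ← hy]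
    simp only [map_add]
    abel
  · rcases hPQ.cover m with hm | hm | rfl
    · have h1 := disjoint_left.1 hPQ.disjoint hm
      have h2 : m ≠ 0 := by rintro rfl; exact hPQ.zero_left hm
      simp [gradProj, gradMap_apply h _ hx, hm, h1, h2]
    · have h1 := disjoint_right.1 hPQ.disjoint hm
      have h2 : m ≠ 0 := by rintro rfl; exact hPQ.zero_right hm
      simp [gradProj, gradMap_apply h _ hx, hm, h1, h2]
    · simp [gradProj, gradMap_apply h _ hx, hPQ.zero_left, hPQ.zero_right]

/-- The local Gauss decomposition: near the identity, `x = a(x) b(x) c(x)` with smooth factors in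
`K_P`, `K_Q` and `H̃`, by the inverse function theorem.  It is also recorded that `c(x)` is a value of
the fixed mapping `gradExp` with finite-dimensional source; this is needed in `gradGroup_zero_le`. -/
theorem exists_local_gauss [T2Space G] (h : DirectSum.IsInternal gr) {P Q : Set ℤ}
    (hPQ : IsTriangular P Q) :
    ∃ a b c : G → G, a 1 = 1 ∧ b 1 = 1 ∧ c 1 = 1 ∧
      (∀ x, a x ∈ gradGroup G gr P ∧ b x ∈ gradGroup G gr Q ∧ c x ∈ range (gradExp G h {0})) ∧
      ∀ᶠ x in 𝓝 (1 : G), a x * b x * c x = x ∧ ContMDiffAt 𝓘(ℝ, E) 𝓘(ℝ, E) ∞ a x ∧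
        ContMDiffAt 𝓘(ℝ, E) 𝓘(ℝ, E) ∞ b x ∧ ContMDiffAt 𝓘(ℝ, E) 𝓘(ℝ, E) ∞ c x := by
  set σ : E → G := fun u => gradExp G h P u * gradExp G h Q u * gradExp G h {0} u with hσ
  have hσs : ContMDiff 𝓘(ℝ, E) 𝓘(ℝ, E) ∞ σ :=
    ((contMDiff_gradExp h P).mul (contMDiff_gradExp h Q)).mul (contMDiff_gradExp h {0})
  have hσ0 : σ 0 = 1 := by simp [hσ, gradExp_zero]
  have hσd : HasLogDeriv σ (ContinuousLinearMap.id ℝ E) 0 := by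
    obtain ⟨L1, h1, h1'⟩ := exists_hasLogDeriv_gradExp (G := G) h P 0
    obtain ⟨L2, h2, h2'⟩ := exists_hasLogDeriv_gradExp (G := G) h Q 0
    obtain ⟨L3, h3, h3'⟩ := exists_hasLogDeriv_gradExp (G := G) h {0} 0
    have h4 := (h1.mul h2).mul h3
    convert h4 using 1
    ext v
    simp [gradExp_zero, adE_one, h1' rfl, h2' rfl, h3' rfl, gradProj_triangular h hPQ]
  set f : E → E := fun u => oneChart E G (σ u) with hfdef
  have hf0 : f 0 = oneChart E G 1 := by simp [hfdef, hσ0]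
  have hfd : HasFDerivAt f (ContinuousLinearMap.id ℝ E) 0 := by
    have := hσd.2
    simpa [hσ0, hfdef] using this
  have hfs : ∀ᶠ y in 𝓝 0, ContDiffAt ℝ ∞ (fun u => f u - oneChart E G 1) y := by
    have : ∀ᶠ y in 𝓝 (0 : E), σ y ∈ (oneChart E G).source :=
      hσs.continuous.continuousAt.eventually
        ((oneChart E G).open_source.mem_nhds (by rw [hσ0]; exact one_mem_oneChart))
    filter_upwards [this] with y hy
    have := contDiffAt_oneChart_comp hy (hσs y)
    simpa [hfdef] using this.sub contDiffAt_const
  -- the chart at the identity is translated such that `1` has the coordinate `0`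
  obtain ⟨g, hg0, hg1, -⟩ := exists_smooth_localInverse hfs (hfd.sub_const _)
  rw [hf0, sub_self] at hg0
  rw [hf0, sub_self] at hg1
  set u : G → E := fun x => g (oneChart E G x - oneChart E G 1) with hu
  have hu1 : u 1 = 0 := by simp [hu, hg0]
  have hus : ∀ᶠ x in 𝓝 (1 : G), σ (u x) = x ∧ ContMDiffAt 𝓘(ℝ, E) 𝓘(ℝ, E) ∞ u x := by
    have hc : Tendsto (fun x => oneChart E G x - oneChart E G 1) (𝓝 (1 : G)) (𝓝 0) := by
      have := ((oneChart E G).continuousAt one_mem_oneChart).tendsto.sub_const (oneChart E G 1)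
      rwa [sub_self] at this
    have hs1 : ∀ᶠ x in 𝓝 (1 : G), ContMDiffAt 𝓘(ℝ, E) 𝓘(ℝ, E) ∞ u x := by
      filter_upwards [hc.eventually hg1, (oneChart E G).open_source.mem_nhds one_mem_oneChart]
        with x hx hx'
      have h1 : ContMDiffAt 𝓘(ℝ, E) 𝓘(ℝ, E) ∞ (oneChart E G) x :=
        ((contMDiffOn_chart (I := 𝓘(ℝ, E)) (n := ∞)).contMDiffAt
          ((oneChart E G).open_source.mem_nhds hx'))
      exact ContMDiffAt.comp (I' := 𝓘(ℝ, E)) x hx.2.contMDiffAt (h1.sub contMDiffAt_const)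
    have hcu : ContinuousAt u 1 := hs1.self_of_nhds.continuousAt
    have : ∀ᶠ x in 𝓝 (1 : G), σ (u x) ∈ (oneChart E G).source := by
      refine (hσs.continuous.continuousAt.comp hcu).eventually
        ((oneChart E G).open_source.mem_nhds ?_)
      simp only [Function.comp_apply, hu1, hσ0]
      exact one_mem_oneChart
    filter_upwards [this, hs1, hc.eventually hg1,
      (oneChart E G).open_source.mem_nhds one_mem_oneChart] with x hx hx1 hx2 hx3
    refine ⟨?_, hx1⟩
    have e := hx2.1
    simp only [hfdef, sub_left_inj] at e
    exact (oneChart E G).injOn hx hx3 e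
  refine ⟨fun x => gradExp G h P (u x), fun x => gradExp G h Q (u x),
    fun x => gradExp G h {0} (u x), by simp [hu1, gradExp_zero], by simp [hu1, gradExp_zero],
    by simp [hu1, gradExp_zero], fun x => ⟨gradExp_mem _ _ _, gradExp_mem _ _ _, _, rfl⟩, ?_⟩
  filter_upwards [hus] with x hx
  exact ⟨hx.1, (contMDiff_gradExp h P _).comp x hx.2, (contMDiff_gradExp h Q _).comp x hx.2,
    (contMDiff_gradExp h {0} _).comp x hx.2⟩

variable [LieAlgebra.IsSemisimple ℂ (GroupLieAlgebra 𝓘(ℂ, E) G)]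

/-- If the logarithmic derivative of `A B` has no components in the degrees of `A`, then `A` is locally
constant. -/
theorem eventually_left_const (hgr : IsGradation (E := E) (G := G) gr) {S R T : Set ℤ}
    (hS : ∀ s ∈ S, ∀ t ∈ S, s + t ∈ S) (hR : ∀ s ∈ R, ∀ t ∈ R, s + t ∈ R) (hRT : R ⊆ T)
    (hRT' : ∀ r ∈ R, ∀ t ∈ T, r + t ∈ T) (hST : Disjoint S T) {A B : F → G} {x : F}
    (hA : ∀ᶠ y in 𝓝 x, MDifferentiableAt 𝓘(ℝ, F) 𝓘(ℝ, E) A y)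
    (hB : ∀ᶠ y in 𝓝 x, MDifferentiableAt 𝓘(ℝ, F) 𝓘(ℝ, E) B y)
    (hAS : ∀ y, A y ∈ gradGroup G gr S) (hBR : ∀ y, B y ∈ gradGroup G gr R)
    (hAB : ∀ᶠ y in 𝓝 x, ∀ v, logDer (E := E) (fun y => A y * B y) y v ∈ gradSum gr T) :
    ∀ᶠ y in 𝓝 x, A y = A x := by
  refine eventually_eq_of_hasLogDeriv_zero (E := E) ?_
  filter_upwards [hA, hB, hAB] with y hAy hBy hABy
  have h1 := hasLogDeriv_of_mdifferentiableAt hAy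
  have h2 := hasLogDeriv_of_mdifferentiableAt hBy
  suffices h : logDer (E := E) A y = 0 by rwa [h] at h1
  ext v
  have h3 := hABy v
  rw [(h1.mul h2).logDer] at h3
  have h4 := h1.mem_gradSum hgr hS
    (Eventually.of_forall fun z => mul_mem (inv_mem (hAS y)) (hAS z)) v
  have h5 := h2.mem_gradSum hgr hR
    (Eventually.of_forall fun z => mul_mem (inv_mem (hBR y)) (hBR z)) v
  have h6 : adE E (B y)⁻¹ (logDer (E := E) A y v) ∈ gradSum gr T := by
    have := Submodule.sub_mem _ h3 (gradSum_mono hRT h5)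
    simpa using this
  have h7 := hgr.adE_mem hRT' (hBR y) h6
  rw [adE_apply_inv_self] at h7
  exact eq_zero_of_mem_gradSum hgr.internal hST h4 h7

/-- If the logarithmic derivative of `A B` only has components in the degrees of `A`, then `B` is
locally constant. -/
theorem eventually_right_const (hgr : IsGradation (E := E) (G := G) gr) {S R : Set ℤ}
    (hS : ∀ s ∈ S, ∀ t ∈ S, s + t ∈ S) (hR : ∀ s ∈ R, ∀ t ∈ R, s + t ∈ R)
    (hRS : ∀ r ∈ R, ∀ s ∈ S, r + s ∈ S) (hRS' : Disjoint R S) {A B : F → G} {x : F}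
    (hA : ∀ᶠ y in 𝓝 x, MDifferentiableAt 𝓘(ℝ, F) 𝓘(ℝ, E) A y)
    (hB : ∀ᶠ y in 𝓝 x, MDifferentiableAt 𝓘(ℝ, F) 𝓘(ℝ, E) B y)
    (hAS : ∀ y, A y ∈ gradGroup G gr S) (hBR : ∀ y, B y ∈ gradGroup G gr R)
    (hAB : ∀ᶠ y in 𝓝 x, ∀ v, logDer (E := E) (fun y => A y * B y) y v ∈ gradSum gr S) :
    ∀ᶠ y in 𝓝 x, B y = B x := by
  refine eventually_eq_of_hasLogDeriv_zero (E := E) ?_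
  filter_upwards [hA, hB, hAB] with y hAy hBy hABy
  have h1 := hasLogDeriv_of_mdifferentiableAt hAy
  have h2 := hasLogDeriv_of_mdifferentiableAt hBy
  suffices h : logDer (E := E) B y = 0 by rwa [h] at h2
  ext v
  have h3 := hABy v
  rw [(h1.mul h2).logDer] at h3
  have h4 := h1.mem_gradSum hgr hS
    (Eventually.of_forall fun z => mul_mem (inv_mem (hAS y)) (hAS z)) v
  have h5 := h2.mem_gradSum hgr hR
    (Eventually.of_forall fun z => mul_mem (inv_mem (hBR y)) (hBR z)) v
  have h6 := hgr.adE_mem hRS (inv_mem (hBR y)) h4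
  have h7 : logDer (E := E) B y v ∈ gradSum gr S := by
    have := Submodule.sub_mem _ h3 h6
    simpa using this
  exact eq_zero_of_mem_gradSum hgr.internal hRS' h5 h7

end Gauss

/-! ### Gauss decompositions of mappings -/

section Factorization

variable {E : Type*} [NormedAddCommGroup E] [NormedSpace ℂ E]
  {F : Type*} [NormedAddCommGroup F] [NormedSpace ℝ F]
  {G : Type*} [TopologicalSpace G] [ChartedSpace E G] [Group G] [LieGroup 𝓘(ℂ, E) ω G]
  [FiniteDimensional ℂ E] [CompleteSpace E] [T2Space G] {gr : ℤ → Submodule ℂ E}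
  [LieAlgebra.IsSemisimple ℂ (GroupLieAlgebra 𝓘(ℂ, E) G)]

theorem logDer_congr {f g : F → G} {x : F} (h : f =ᶠ[𝓝 x] g) :
    logDer (E := E) f x = logDer (E := E) g x := by
  unfold logDer
  rw [h.self_of_nhds]
  refine Filter.EventuallyEq.fderiv_eq ?_
  filter_upwards [h] with w hw
  rw [hw]

theorem eventually_mdifferentiableAt_comp {f : F → G} {x : F} {a : G → G}
    (hf : ∀ᶠ y in 𝓝 x, MDifferentiableAt 𝓘(ℝ, F) 𝓘(ℝ, E) f y)
    (ha : ∀ᶠ z in 𝓝 (f x), ContMDiffAt 𝓘(ℝ, E) 𝓘(ℝ, E) ∞ a z) :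
    ∀ᶠ y in 𝓝 x, MDifferentiableAt 𝓘(ℝ, F) 𝓘(ℝ, E) (fun y => a (f y)) y := by
  filter_upwards [hf, hf.self_of_nhds.continuousAt.eventually ha] with y hy hy'
  exact MDifferentiableAt.comp (I' := 𝓘(ℝ, E)) y (hy'.mdifferentiableAt (by simp)) hy

/-- A mapping whose logarithmic derivative takes values in the Lie algebra of `K_Q` stays locally
in a coset of `K_Q`, and similarly for `H̃`; in the latter case the values are even products of
the one-parameter groups used to define `gradExp`. -/
theorem eventually_mem_of_logDer_mem (hgr : IsGradation (E := E) (G := G) gr) {P Q : Set ℤ}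
    (hPQ : IsTriangular P Q) {f : F → G} {x : F}
    (hf : ∀ᶠ y in 𝓝 x, MDifferentiableAt 𝓘(ℝ, F) 𝓘(ℝ, E) f y) :
    ((∀ᶠ y in 𝓝 x, ∀ v, logDer (E := E) f y v ∈ gradSum gr Q) →
      ∀ᶠ y in 𝓝 x, (f x)⁻¹ * f y ∈ gradGroup G gr Q) ∧
    ((∀ᶠ y in 𝓝 x, ∀ v, logDer (E := E) f y v ∈ gr 0) →
      ∀ᶠ y in 𝓝 x, (f x)⁻¹ * f y ∈ range (gradExp G hgr.internal {0})) := by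
  have : IsTopologicalGroup G := topologicalGroup_of_lieGroup 𝓘(ℂ, E) ω
  obtain ⟨a, b, c, ha1, hb1, hc1, habc, hloc⟩ := exists_local_gauss (G := G) hgr.internal hPQ
  set k : F → G := fun y => (f x)⁻¹ * f y with hk
  have hkx : k x = 1 := by simp [hk]
  have hkd : ∀ᶠ y in 𝓝 x, MDifferentiableAt 𝓘(ℝ, F) 𝓘(ℝ, E) k y := by
    filter_upwards [hf] with y hy
    exact ((hasLogDeriv_of_mdifferentiableAt hy).const_mul (f x)⁻¹).mdifferentiableAt
  rw [← hkx] at hloc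
  have hkc : ContinuousAt k x := hkd.self_of_nhds.continuousAt
  have hA := eventually_mdifferentiableAt_comp hkd (hloc.mono fun z hz => hz.2.1)
  have hB := eventually_mdifferentiableAt_comp hkd (hloc.mono fun z hz => hz.2.2.1)
  have hC := eventually_mdifferentiableAt_comp hkd (hloc.mono fun z hz => hz.2.2.2)
  have hBC : ∀ᶠ y in 𝓝 x,
      MDifferentiableAt 𝓘(ℝ, F) 𝓘(ℝ, E) (fun y => b (k y) * c (k y)) y := by
    filter_upwards [hB, hC] with y hy hy'
    exact ((hasLogDeriv_of_mdifferentiableAt hy).mul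
      (hasLogDeriv_of_mdifferentiableAt hy')).mdifferentiableAt
  have hkeq : ∀ᶠ y in 𝓝 x, a (k y) * b (k y) * c (k y) = k y :=
    hkc.eventually (hloc.mono fun z hz => hz.1)
  have hC0 : ∀ z, c z ∈ gradGroup G gr {0} := by
    intro z
    obtain ⟨u, hu⟩ := (habc z).2.2
    rw [← hu]
    exact gradExp_mem _ _ _
  -- the first factor is constant as soon as the logarithmic derivative has no component in `P`
  have key : (∀ᶠ y in 𝓝 x, ∀ v, logDer (E := E) f y v ∈ gradSum gr (Q ∪ {0})) →
      ∀ᶠ y in 𝓝 x, k y = b (k y) * c (k y) := by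
    intro hld
    have hadd : ∀ s ∈ Q ∪ {0}, ∀ t ∈ Q ∪ {0}, s + t ∈ Q ∪ {0} := by
      rintro s (hs | rfl) t (ht | rfl)
      · exact Or.inl (hPQ.add_right s hs t ht)
      · exact Or.inl (by simpa using hs)
      · exact Or.inl (by simpa using ht)
      · simp
    have h := eventually_left_const (E := E) hgr (S := P) (R := Q ∪ {0}) (T := Q ∪ {0})
      hPQ.add_left hadd subset_rfl hadd (by
        rw [disjoint_union_right]
        exact ⟨hPQ.disjoint, disjoint_singleton_right.2 hPQ.zero_left⟩) hA hBC
      (fun y => (habc _).1)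
      (fun y => mul_mem (gradGroup_mono subset_union_left (habc _).2.1)
        (gradGroup_mono subset_union_right (hC0 _))) (by
        filter_upwards [hld, hkeq.eventually_nhds] with y hy hy'
        have e : (fun y => a (k y) * (b (k y) * c (k y))) =ᶠ[𝓝 y] k := by
          filter_upwards [hy'] with w hw
          rw [← mul_assoc, hw]
        intro v
        have e2 : logDer (E := E) (fun y => a (k y) * (b (k y) * c (k y))) y =
            logDer (E := E) k y := logDer_congr e
        rw [e2, hk, logDer_const_mul]
        exact hy v)
    filter_upwards [h, hkeq] with y hy hy'
    rw [hkx, ha1] at hy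
    conv_lhs => rw [← hy', hy, one_mul]
  have key2 : (∀ᶠ y in 𝓝 x, k y = b (k y) * c (k y)) → ∀ {S : Set ℤ},
      (∀ᶠ y in 𝓝 x, ∀ v, logDer (E := E) f y v ∈ gradSum gr S) →
      ∀ᶠ y in 𝓝 x, ∀ v, logDer (E := E) (fun y => b (k y) * c (k y)) y v ∈ gradSum gr S := by
    intro h S hS
    filter_upwards [h.eventually_nhds, hS] with y hy hy'
    have e2 : logDer (E := E) (fun y => b (k y) * c (k y)) y = logDer (E := E) k y :=
      logDer_congr (hy.mono fun w hw => hw.symm)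
    rw [e2, hk, logDer_const_mul]
    exact hy'
  constructor
  · intro hld
    have h1 := key (hld.mono fun y hy v => gradSum_mono subset_union_left (hy v))
    have h2 := eventually_right_const (E := E) hgr (S := Q) (R := {0}) hPQ.add_right (by simp)
      (by simp) (disjoint_singleton_left.2 hPQ.zero_right) hB hC (fun y => (habc _).2.1)
      (fun y => hC0 _) (key2 h1 hld)
    filter_upwards [h1, h2] with y hy hy'
    rw [hkx, hc1] at hy'
    rw [hy', mul_one] at hy
    change k y ∈ _
    rw [hy]
    exact (habc _).2.1
  · intro hld
    rw [← gradSum_singleton (gr := gr) 0] at hld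
    have h1 := key (hld.mono fun y hy v => gradSum_mono subset_union_right (hy v))
    have h2 := eventually_left_const (E := E) hgr (S := Q) (R := {0}) (T := {0}) hPQ.add_right
      (by simp) subset_rfl (by simp) (disjoint_singleton_right.2 hPQ.zero_right) hB hC
      (fun y => (habc _).2.1) (fun y => hC0 _) (key2 h1 hld)
    filter_upwards [h1, h2] with y hy hy'
    rw [hkx, hb1] at hy'
    rw [hy', one_mul] at hy
    change k y ∈ _
    rw [hy]
    exact (habc _).2.2

/-- A curve which is locally contained in a coset of a subgroup is contained in this coset. -/
theorem mem_of_eventually_mem {K : Subgroup G} {c : ℝ → G}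
    (h : ∀ t, ∀ᶠ s in 𝓝 t, (c t)⁻¹ * c s ∈ K) (t s : ℝ) : (c t)⁻¹ * c s ∈ K := by
  refine PreconnectedSpace.induction₂' (fun t s => (c t)⁻¹ * c s ∈ K) (fun t => ?_)
    ⟨fun x y z h1 h2 => ?_⟩ t s
  · filter_upwards [h t] with s hs
    exact ⟨hs, by simpa using inv_mem hs⟩
  · simpa [mul_assoc] using mul_mem h1 h2

/-- The group `H̃` is generated by the values of `gradExp` in degree `0`. -/
theorem gradGroup_zero_le (hgr : IsGradation (E := E) (G := G) gr) :
    gradGroup G gr {0} ≤ Subgroup.closure (range (gradExp G hgr.internal {0})) := by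
  refine Subgroup.closure_le _ |>.2 ?_
  rintro g ⟨X, hX, hg⟩
  obtain ⟨c, hc, h0, rfl⟩ := isExp_iff.1 hg
  rw [gradSum_singleton] at hX
  have h := mem_of_eventually_mem
    (K := Subgroup.closure (range (gradExp G hgr.internal {0}))) (c := c) (fun t => by
      filter_upwards [(eventually_mem_of_logDer_mem hgr isTriangular_pos_neg
        (Eventually.of_forall fun s => (hc s).mdifferentiableAt)).2
        (Eventually.of_forall fun s v => by
          rw [(hc s).logDer]
          exact Submodule.smul_of_tower_mem _ _ hX)] with s hs
      exact Subgroup.subset_closure hs) 0 1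
  simpa [h0] using h

/-- The group of `⨁_{m ∈ Q ∪ {0}} 𝔤_m` is `K_Q H̃`. -/
theorem IsTriangular.exists_factorization (hgr : IsGradation (E := E) (G := G) gr) {P Q : Set ℤ}
    (hPQ : IsTriangular P Q) {g : G} (hg : g ∈ gradGroup G gr (Q ∪ {0})) :
    ∃ n ∈ gradGroup G gr Q, ∃ h ∈ gradGroup G gr {0}, g = n * h := by
  refine gradGroup_induction
    (P := fun g => ∃ n ∈ gradGroup G gr Q, ∃ h ∈ gradGroup G gr {0}, g = n * h) ?_ ?_ hg
  · exact ⟨1, one_mem _, 1, one_mem _, by simp⟩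
  · rintro X hX x _ hx ⟨n, hn, h, hh, rfl⟩
    obtain ⟨c, hc, h0, rfl⟩ := isExp_iff.1 hx
    -- with `Y` the component of degree `0`, the curve `exp (t X) exp (t Y)⁻¹` stays in `K_Q`
    set Y := gradProj hgr.internal {0} X with hY
    have hY0 : Y ∈ gradSum gr {0} := gradProj_mem _ _ _
    have hXY : X - Y ∈ gradSum gr Q := by
      have h1 := gradProj_triangular hgr.internal hPQ X
      have h2 : gradProj hgr.internal P X = 0 := by
        refine gradProj_of_disjoint hgr.internal ?_ hX
        rw [disjoint_union_right]
        exact ⟨hPQ.disjoint, disjoint_singleton_right.2 hPQ.zero_left⟩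
      rw [h2, zero_add] at h1
      rw [← eq_sub_of_add_eq h1]
      exact gradProj_mem _ _ _
    set e : ℝ → G := fun t => expC G Y (t * (1 : ℂ)) with he
    have hemem : ∀ t, e t ∈ gradGroup G gr {0} := fun t =>
      (isExp_expC Y (t * (1 : ℂ))).mem_gradGroup (Submodule.smul_mem _ _ hY0)
    have hed : ∀ t, HasLogDeriv e ((1 : ℝ →L[ℝ] ℝ).smulRight Y) t := fun t => by
      have := hasLogDeriv_expC_smul (G := G) Y 1 t
      rwa [one_smul] at this
    have hd : ∀ t, HasLogDeriv (fun t => c t * (e t)⁻¹)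
        ((1 : ℝ →L[ℝ] ℝ).smulRight (adE E (e t) (X - Y))) t := by
      intro t
      convert (hc t).mul (hed t).inv using 1
      ext
      simp [sub_eq_add_neg]
    have hK := mem_of_eventually_mem (K := gradGroup G gr Q) (c := fun t => c t * (e t)⁻¹)
      (fun t => (eventually_mem_of_logDer_mem hgr hPQ
        (Eventually.of_forall fun s => (hd s).mdifferentiableAt)).1
        (Eventually.of_forall fun s v => by
          rw [(hd s).logDer]
          exact Submodule.smul_of_tower_mem _ _
            (hgr.adE_mem (by simp) (hemem s) hXY))) 0 1
    have hn' : c 1 * (e 1)⁻¹ ∈ gradGroup G gr Q := by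
      simpa [h0, he] using hK
    exact ⟨_, mul_mem hn' (hgr.conj_mem (by simp) (hemem 1) hn), e 1 * h,
      mul_mem (hemem 1) hh, by group⟩

variable {M : Type*} [TopologicalSpace M] [ChartedSpace ℂ M]

/-- The modified Gauss decomposition of a mapping, near a point whose value lies in the open cell
with base element `g`. -/
theorem IsTriangular.exists_gauss (hgr : IsGradation (E := E) (G := G) gr) {P Q : Set ℤ}
    (hPQ : IsTriangular P Q) {f : M → G} (hf : ContMDiff 𝓘(ℝ, ℂ) 𝓘(ℝ, E) ∞ f) {p : M} {g n b : G}
    (hn : n ∈ gradGroup G gr P) (hb : b ∈ gradGroup G gr (Q ∪ {0})) (hp : f p = g * n * b) :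
    ∃ W : Set M, IsOpen W ∧ p ∈ W ∧ ∃ μ ν η : M → G,
      ContMDiffOn 𝓘(ℝ, ℂ) 𝓘(ℝ, E) ∞ μ W ∧ ContMDiffOn 𝓘(ℝ, ℂ) 𝓘(ℝ, E) ∞ ν W ∧
      ContMDiffOn 𝓘(ℝ, ℂ) 𝓘(ℝ, E) ∞ η W ∧ (∀ q, g⁻¹ * μ q ∈ gradGroup G gr P) ∧
      (∀ q, ν q ∈ gradGroup G gr Q) ∧ (∀ q, η q ∈ gradGroup G gr {0}) ∧
      ∀ q ∈ W, f q = μ q * ν q * η q := by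
  have : IsTopologicalGroup G := topologicalGroup_of_lieGroup 𝓘(ℂ, E) ω
  obtain ⟨a, b', c, ha1, hb1, hc1, habc, hloc⟩ := exists_local_gauss (G := G) hgr.internal hPQ
  obtain ⟨n', hn', h, hh, rfl⟩ := hPQ.exists_factorization hgr hb
  have hC0 : ∀ z, c z ∈ gradGroup G gr {0} := by
    intro z
    obtain ⟨u, hu⟩ := (habc z).2.2
    rw [← hu]
    exact gradExp_mem _ _ _
  -- move the value at `p` to the identity, and then conjugate `n'` past the factor `c` in `H̃`
  set y : M → G := fun q => (g * n)⁻¹ * f q * (n' * h)⁻¹ with hy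
  have hyp : y p = 1 := by simp [hy, hp]; group
  have hys : ContMDiff 𝓘(ℝ, ℂ) 𝓘(ℝ, E) ∞ y := (contMDiff_const.mul hf).mul contMDiff_const
  rw [← hyp] at hloc
  obtain ⟨W, hW, hWo, hpW⟩ := eventually_nhds_iff.1 (hys.continuous.continuousAt.eventually hloc)
  have hbs : ContMDiffOn 𝓘(ℝ, ℂ) 𝓘(ℝ, E) ∞ (fun q => b' (y q)) W := fun q hq =>
    (ContMDiffAt.comp (I' := 𝓘(ℝ, E)) q (hW q hq).2.2.1 (hys q)).contMDiffWithinAt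
  have hcs : ContMDiffOn 𝓘(ℝ, ℂ) 𝓘(ℝ, E) ∞ (fun q => c (y q)) W := fun q hq =>
    (ContMDiffAt.comp (I' := 𝓘(ℝ, E)) q (hW q hq).2.2.2 (hys q)).contMDiffWithinAt
  have has : ContMDiffOn 𝓘(ℝ, ℂ) 𝓘(ℝ, E) ∞ (fun q => a (y q)) W := fun q hq =>
    (ContMDiffAt.comp (I' := 𝓘(ℝ, E)) q (hW q hq).2.1 (hys q)).contMDiffWithinAt
  refine ⟨W, hWo, hpW, fun q => g * n * a (y q), fun q => b' (y q) * (c (y q) * n' * (c (y q))⁻¹),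
    fun q => c (y q) * h, contMDiffOn_const.mul has,
    hbs.mul ((hcs.mul contMDiffOn_const).mul hcs.inv), hcs.mul contMDiffOn_const,
    fun q => ?_, fun q => ?_, fun q => mul_mem (hC0 _) hh, fun q hq => ?_⟩
  · have := mul_mem hn (habc (y q)).1
    simpa [mul_assoc] using this
  · exact mul_mem (habc (y q)).2.1 (hgr.conj_mem (by simp) (hC0 _) hn')
  · have h1 := (hW q hq).1
    have h2 : f q = (g * n) * y q * (n' * h) := by simp [hy]; group
    rw [h2]
    conv_lhs => rw [← h1]
    group

end Factorization

/-! ### Slices for the orbits of the degree zero group -/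

section OrbitLift

variable {E : Type*} [NormedAddCommGroup E] [NormedSpace ℂ E]
  {F : Type*} [NormedAddCommGroup F] [NormedSpace ℝ F]
  {G : Type*} [TopologicalSpace G] [ChartedSpace E G] [Group G] [LieGroup 𝓘(ℂ, E) ω G]
  [FiniteDimensional ℂ E] [CompleteSpace E] [T2Space G] {gr : ℤ → Submodule ℂ E}
  [LieAlgebra.IsSemisimple ℂ (GroupLieAlgebra 𝓘(ℂ, E) G)]

/-- A function which is locally constant on a subset of a separable space takes only countably many
values there. -/
theorem countable_image_of_eventually_eq {X Y : Type*} [TopologicalSpace X]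
    [TopologicalSpace.SeparableSpace X] {S : Set X} {f : X → Y}
    (h : ∀ x ∈ S, ∀ᶠ y in 𝓝 x, f y = f x) : (f '' S).Countable := by
  obtain ⟨D, hD, hd⟩ := TopologicalSpace.exists_countable_dense X
  refine (hD.image f).mono ?_
  rintro _ ⟨x, hx, rfl⟩
  obtain ⟨y, hy, hyD⟩ := (mem_closure_iff_nhds.1 (hd x)) _ (h x hx)
  exact ⟨y, hyD, hy⟩

/-- The group `H̃` is a countable union of images of finite-dimensional vector spaces under
differentiable mappings. -/
theorem exists_parametrization (hgr : IsGradation (E := E) (G := G) gr) :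
    ∃ f : (k : ℕ) → (Fin k → E × E) → G,
      (∀ k v, MDifferentiableAt 𝓘(ℝ, Fin k → E × E) 𝓘(ℝ, E) (f k) v) ∧
      (∀ k v, f k v ∈ gradGroup G gr {0}) ∧ ∀ g ∈ gradGroup G gr {0}, ∃ k v, f k v = g := by
  let σ : E → G := gradExp G hgr.internal {0}
  have hσ : ∀ u, HasLogDeriv σ (logDer (E := E) σ u) u := fun u =>
    hasLogDeriv_of_mdifferentiableAt ((contMDiff_gradExp hgr.internal {0} u).mdifferentiableAt
      (by simp))
  have hσm : ∀ u, σ u ∈ gradGroup G gr {0} := gradExp_mem _ _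
  -- products of `k` elements `σ(u) σ(v)⁻¹`, which include generators (`v = 0`) and inverses (`u = 0`)
  let f : (k : ℕ) → (Fin k → E × E) → G := fun k =>
    Nat.rec (motive := fun k => (Fin k → E × E) → G) (fun _ => 1)
      (fun k fk v => σ (v 0).1 * (σ (v 0).2)⁻¹ * fk (fun i => v i.succ)) k
  refine ⟨f, fun k => ?_, fun k => ?_, fun g hg => ?_⟩
  · induction k with
    | zero => exact fun v => mdifferentiableAt_const
    | succ k ih =>
      intro v
      let p0 : (Fin (k + 1) → E × E) →L[ℝ] E × E := ContinuousLinearMap.proj 0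
      let ps : (Fin (k + 1) → E × E) →L[ℝ] (Fin k → E × E) :=
        ContinuousLinearMap.pi fun i => ContinuousLinearMap.proj i.succ
      have h1 := (hσ (v 0).1).comp (u := fun v : Fin (k + 1) → E × E => (v 0).1)
        (((ContinuousLinearMap.fst ℝ E E).comp p0).hasFDerivAt)
      have h2 := (hσ (v 0).2).comp (u := fun v : Fin (k + 1) → E × E => (v 0).2)
        (((ContinuousLinearMap.snd ℝ E E).comp p0).hasFDerivAt)
      have h3 := (hasLogDeriv_of_mdifferentiableAt (ih (ps v))).comp
        (u := fun v : Fin (k + 1) → E × E => ps v) ps.hasFDerivAt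
      exact ((h1.mul h2.inv).mul h3).mdifferentiableAt
  · induction k with
    | zero => exact fun v => one_mem _
    | succ k ih => exact fun v => mul_mem (mul_mem (hσm _) (inv_mem (hσm _))) (ih _)
  · refine Subgroup.closure_induction_left (p := fun g _ => ∃ k v, f k v = g) ⟨0, 0, rfl⟩ ?_ ?_
      (gradGroup_zero_le hgr hg)
    · rintro _ ⟨u, rfl⟩ _ _ ⟨k, v, rfl⟩
      refine ⟨k + 1, Fin.cons (u, 0) v, ?_⟩
      change σ u * (σ 0)⁻¹ * f k v = _
      rw [show σ 0 = 1 from gradExp_zero _ _, inv_one, mul_one]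
    · rintro _ ⟨u, rfl⟩ _ _ ⟨k, v, rfl⟩
      refine ⟨k + 1, Fin.cons (0, u) v, ?_⟩
      change σ 0 * (σ u)⁻¹ * f k v = _
      rw [show σ 0 = 1 from gradExp_zero _ _, one_mul]

theorem contDiffAt_adE_apply {f : F → G} {Y : F → E} {x : F}
    (hf : ContMDiffAt 𝓘(ℝ, F) 𝓘(ℝ, E) ∞ f x) (hY : ContDiffAt ℝ ∞ Y x) :
    ContDiffAt ℝ ∞ (fun y => adE E (f y) (Y y)) x := by
  set b := Module.finBasis ℂ E
  let κ : Fin (Module.finrank ℂ E) → E →L[ℂ] ℂ := fun i => LinearMap.toContinuousLinearMap (b.coord i)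
  have hb : ∀ y : E, ∑ i, κ i y • b i = y := fun y => b.sum_repr y
  have h3 : (fun y => Toda.adE E (f y) (Y y)) = fun y => ∑ i, κ i (Y y) • Toda.adE E (f y) (b i) := by
    funext y
    conv_lhs => rw [← hb (Y y)]
    simp
  rw [h3]
  exact ContDiffAt.sum fun i _ =>
    (((κ i).restrictScalars ℝ).contDiff.contDiffAt.comp x hY).smul (contDiffAt_adE hf (b i))

/-- A slice for the orbit of `x` under `H̃`: near `x` the mapping
`Ψ(u) = Ad(σ(u)) (x + (1 - π) u)` is a system of coordinates, where `π` is a projection onto the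
tangent space `R = [𝔤₀, x]` of the orbit. Its differential is complex linear, and it takes `R` to
the tangent space of the orbit at the points of the orbit. -/
theorem exists_slice (hgr : IsGradation (E := E) (G := G) gr) (x : E) :
    ∃ (π : E →L[ℂ] E) (σ : E → G) (Φ : E → E) (D : E → E →L[ℂ] E),
      (∀ w, π (π w) = π w) ∧ ContMDiff 𝓘(ℝ, E) 𝓘(ℝ, E) ∞ σ ∧
      (∀ u, σ u ∈ gradGroup G gr {0}) ∧
      (∀ u, ∃ L : E →L[ℂ] E, HasLogDeriv σ (L.restrictScalars ℝ) u) ∧ Φ x = 0 ∧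
      ∀ᶠ y in 𝓝 x, ContDiffAt ℝ ∞ Φ y ∧
        adE E (σ (Φ y)) (x + (Φ y - π (Φ y))) = y ∧
        (∀ w, fderiv ℝ Φ y (D y w) = w) ∧ (∀ w, D y (fderiv ℝ Φ y w) = w) ∧
        ∀ h ∈ gradGroup G gr {0}, y = adE E h x → ∀ X ∈ gr 0,
          π (fderiv ℝ Φ y (lieE G X y)) = fderiv ℝ Φ y (lieE G X y) := by
  -- `T y = [y₀, x]`, with the range `R`, and `A` is a right inverse of `T` on `R`
  let p : E →ₗ[ℂ] E := gradProj hgr.internal {0}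
  let T : E →ₗ[ℂ] E := ((lieL G).flip x).toLinearMap ∘ₗ p
  obtain ⟨r, hr⟩ := T.rangeRestrict.exists_rightInverse_of_surjective T.range_rangeRestrict
  obtain ⟨ρ, hρ⟩ := (T.range.subtype).exists_leftInverse_of_injective (Submodule.ker_subtype _)
  let A : E →ₗ[ℂ] E := p ∘ₗ r ∘ₗ ρ
  let π : E →L[ℂ] E := LinearMap.toContinuousLinearMap (T.range.subtype ∘ₗ ρ)
  have hp0 : ∀ y, p y ∈ gradSum gr {0} := gradProj_mem _ _
  have hpp : ∀ y, p (p y) = p y := fun y => gradProj_of_mem _ (hp0 y)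
  have hρ' : ∀ w : T.range, ρ w = w := fun w => congrArg (fun L => L w) hρ
  have hπR : ∀ w ∈ T.range, π w = w := fun w hw => congrArg Subtype.val (hρ' ⟨w, hw⟩)
  have hπmem : ∀ w, π w ∈ T.range := fun w => (ρ w).2
  have hA : ∀ w, lieE G (A w) x = π w := by
    intro w
    have h1 : T (r (ρ w)) = ρ w := congrArg Subtype.val (congrArg (fun L => L (ρ w)) hr)
    exact h1
  have hA0 : ∀ w, A w ∈ gradSum gr {0} := fun w => hp0 _
  have hRmem : ∀ X ∈ gr 0, lieE G X x ∈ T.range := by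
    intro X hX
    refine ⟨X, ?_⟩
    change lieE G (p X) x = _
    rw [show p X = X from gradProj_of_mem _ (by rwa [gradSum_singleton])]
  set σ : E → G := linExp G A with hσ
  have hσs : ContMDiff 𝓘(ℝ, E) 𝓘(ℝ, E) ∞ σ := contMDiff_linExp A
  have hσ0 : σ 0 = 1 := linExp_zero A
  have hσmem : ∀ u, σ u ∈ gradGroup G gr {0} := linExp_mem hA0
  choose L hL hLA using exists_hasLogDeriv_linExp (G := G) A
  set Ψ : E → E := fun u => adE E (σ u) (x + (u - π u)) with hΨ
  let DΨ : E → E →L[ℂ] E := fun u => (adE E (σ u)).comp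
    (((lieL G).flip (x + (u - π u))).comp (L u) + (ContinuousLinearMap.id ℂ E - π))
  have hY : ∀ u, HasFDerivAt (fun u => x + (u - π u))
      ((ContinuousLinearMap.id ℂ E - π).restrictScalars ℝ) u := fun u =>
    (((ContinuousLinearMap.id ℂ E - π).restrictScalars ℝ).hasFDerivAt).const_add x
  have hDΨ : ∀ u, HasFDerivAt Ψ ((DΨ u).restrictScalars ℝ) u := fun u =>
    (hL u).adE_apply (hY u)
  have hΨs : ∀ u, ContDiffAt ℝ ∞ Ψ u := fun u => contDiffAt_adE_apply (hσs u)
    (contDiffAt_const.add ((ContinuousLinearMap.id ℂ E - π).restrictScalars ℝ).contDiff.contDiffAt)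
  have hΨ0 : Ψ 0 = x := by simp [hΨ, hσ0, adE_one]
  have hD0 : (DΨ 0).restrictScalars ℝ = ContinuousLinearMap.id ℝ E := by
    ext v
    simp [DΨ, hσ0, adE_one, hLA 0 rfl, hA]
  obtain ⟨Φ, hΦ0, hΦ1, hΦ2⟩ := exists_smooth_localInverse (Eventually.of_forall hΨs)
    (by rw [← hD0]; exact hDΨ 0)
  rw [hΨ0] at hΦ0 hΦ1
  refine ⟨π, σ, Φ, fun y => DΨ (Φ y), fun w => hπR _ (hπmem w), hσs, hσmem,
    fun u => ⟨L u, hL u⟩, hΦ0, ?_⟩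
  have hΦc : Tendsto Φ (𝓝 x) (𝓝 0) := by
    have := hΦ1.self_of_nhds.2.continuousAt
    rwa [ContinuousAt, hΦ0] at this
  filter_upwards [hΦ1.eventually_nhds, hΦc.eventually hΦ2.eventually_nhds] with y hy hy'
  have hΨΦ := hy.self_of_nhds.1
  have hΦd := (hy.self_of_nhds.2.differentiableAt (by simp)).hasFDerivAt
  have h1 : ∀ w, fderiv ℝ Φ y (DΨ (Φ y) w) = w := by
    intro w
    have hΦd' : HasFDerivAt Φ (fderiv ℝ Φ y) (Ψ (Φ y)) := by rw [hΨΦ]; exact hΦd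
    have h2 := HasFDerivAt.comp (Φ y) hΦd' (hDΨ (Φ y))
    have h3 := (hasFDerivAt_id (𝕜 := ℝ) (Φ y)).congr_of_eventuallyEq (f₁ := Φ ∘ Ψ) hy'
    exact congrArg (fun T : E →L[ℝ] E => T w) (h2.unique h3)
  have h2 : ∀ w, DΨ (Φ y) (fderiv ℝ Φ y w) = w := by
    intro w
    have h2 := HasFDerivAt.comp y (hDΨ (Φ y)) hΦd
    have h3 := (hasFDerivAt_id (𝕜 := ℝ) y).congr_of_eventuallyEq (f₁ := Ψ ∘ Φ)
      (hy.mono fun z hz => hz.1)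
    exact congrArg (fun T : E →L[ℝ] E => T w) (h2.unique h3)
  refine ⟨hy.self_of_nhds.2, hΨΦ, h1, h2, fun h hh hyh X hX => ?_⟩
  -- compare the dimensions of `DΨ(R)` and `[𝔤₀, y] = Ad(h) R`
  let R' : Submodule ℂ E := (gr 0).map ((lieL G).flip y).toLinearMap
  have hinj : Function.Injective (DΨ (Φ y)).toLinearMap :=
    Function.LeftInverse.injective h1
  have hle : T.range.map (DΨ (Φ y)).toLinearMap ≤ R' := by
    rintro _ ⟨w, hw, rfl⟩
    have hLw : L (Φ y) w ∈ gradSum gr {0} := (hL (Φ y)).mem_gradSum hgr (by simp)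
      (Eventually.of_forall fun z => mul_mem (inv_mem (hσmem _)) (hσmem z)) w
    refine ⟨adE E (σ (Φ y)) (L (Φ y) w), ?_, ?_⟩
    · have := hgr.adE_mem (T := {0}) (by simp) (hσmem (Φ y)) hLw
      rwa [gradSum_singleton] at this
    · change lieE G _ y = adE E (σ (Φ y)) (lieE G (L (Φ y) w) (x + (Φ y - π (Φ y))) + (w - π w))
      rw [hπR w hw, sub_self, add_zero, adE_lieE]
      congr 1
      exact hΨΦ.symm
  have hle' : R' ≤ T.range.map (adE E h).toLinearMap := by
    rintro _ ⟨Z, hZ, rfl⟩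
    refine ⟨lieE G (adE E h⁻¹ Z) x, hRmem _ ?_, ?_⟩
    · have := hgr.adE_mem (T := {0}) (by simp) (inv_mem hh) (y := Z) (by rwa [gradSum_singleton])
      rwa [gradSum_singleton] at this
    · change adE E h (lieE G (adE E h⁻¹ Z) x) = lieE G Z y
      rw [adE_lieE, adE_apply_inv_self, hyh]
  have heq : T.range.map (DΨ (Φ y)).toLinearMap = R' := by
    refine Submodule.eq_of_le_of_finrank_le hle ?_
    rw [← (Submodule.equivMapOfInjective _ hinj T.range).finrank_eq]
    exact (Submodule.finrank_mono hle').trans (Submodule.finrank_map_le _ _)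
  have hmem : lieE G X y ∈ R' := ⟨X, hX, rfl⟩
  rw [← heq] at hmem
  obtain ⟨w, hw, hw'⟩ := hmem
  rw [← hw']
  change π (fderiv ℝ Φ y (DΨ (Φ y) w)) = fderiv ℝ Φ y (DΨ (Φ y) w)
  rw [h1, hπR w hw]

end OrbitLift

/-! ### Lifting mappings from an orbit to the group -/

section OrbitLift

variable {E : Type*} [NormedAddCommGroup E] [NormedSpace ℂ E]
  {F : Type*} [NormedAddCommGroup F] [NormedSpace ℝ F]
  {G : Type*} [TopologicalSpace G] [ChartedSpace E G] [Group G] [LieGroup 𝓘(ℂ, E) ω G]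
  [FiniteDimensional ℂ E] [CompleteSpace E] [T2Space G] {gr : ℤ → Submodule ℂ E}
  [LieAlgebra.IsSemisimple ℂ (GroupLieAlgebra 𝓘(ℂ, E) G)]

theorem eventually_eq_of_fderiv_zero {f : F → E} {x : F}
    (hf : ∀ᶠ y in 𝓝 x, HasFDerivAt f (0 : F →L[ℝ] E) y) : ∀ᶠ y in 𝓝 x, f y = f x := by
  obtain ⟨r, hr, h⟩ := Metric.eventually_nhds_iff_ball.1 hf
  filter_upwards [Metric.ball_mem_nhds x hr] with y hy
  exact Metric.isOpen_ball.is_const_of_fderiv_eq_zero (𝕜 := ℝ)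
    (convex_ball x r).isPreconnected
    (fun z hz => (h z hz).differentiableAt.differentiableWithinAt) (fun z hz => (h z hz).fderiv)
    hy (Metric.mem_ball_self hr)

/-- A smooth mapping with values in an orbit of `H̃` lifts locally to a smooth mapping to `H̃`.
The orbit need not be closed, but in the coordinates of a slice its transversal coordinates take
only countably many values, so that they are constant along a continuous mapping. The logarithmic
derivative of the lift depends complex linearly on the derivative of the given mapping. -/
theorem exists_orbit_lift (hgr : IsGradation (E := E) (G := G) gr) {lam : F → E} {q₀ : F}
    (hs : ∀ᶠ q in 𝓝 q₀, ContDiffAt ℝ ∞ lam q)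
    (horb : ∀ᶠ q in 𝓝 q₀, ∃ h ∈ gradGroup G gr {0}, lam q = adE E h (lam q₀)) :
    ∃ γ : F → G, (∀ q, γ q ∈ gradGroup G gr {0}) ∧
      ∀ᶠ q in 𝓝 q₀, ContMDiffAt 𝓘(ℝ, F) 𝓘(ℝ, E) ∞ γ q ∧ adE E (γ q) (lam q₀) = lam q ∧
        ∀ (v w : F) (c : ℂ), fderiv ℝ lam q v = c • fderiv ℝ lam q w →
          logDer (E := E) γ q v = c • logDer (E := E) γ q w := by
  set x := lam q₀
  obtain ⟨π, σ, Φ, D, hππ, hσs, hσmem, hσL, hΦ0, hloc⟩ := exists_slice hgr x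
  obtain ⟨O, hO, hOo, hxO⟩ := eventually_nhds_iff.1 hloc
  obtain ⟨f, hfd, hfm, hfsurj⟩ := exists_parametrization (E := E) hgr
  -- `τ` is the transversal coordinate; along the orbit it is locally constant in the parameters
  set τ : E → E := fun y => Φ y - π (Φ y) with hτ
  have hcount : (τ '' {y | y ∈ O ∧ ∃ h ∈ gradGroup G gr {0}, y = adE E h x}).Countable := by
    have h1 : ∀ k, ((fun v => τ (adE E (f k v) x)) '' {v | adE E (f k v) x ∈ O}).Countable := by
      intro k
      refine countable_image_of_eventually_eq fun v hv => eventually_eq_of_fderiv_zero ?_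
      have hd : ∀ v, HasFDerivAt (fun v => adE E (f k v) x) _ v := fun v =>
        (hasLogDeriv_of_mdifferentiableAt (E := E) (hfd k v)).adE x
      filter_upwards [(hd v).continuousAt.eventually (hOo.mem_nhds hv)] with u hu
      obtain ⟨hΦs, -, -, -, hπ⟩ := hO _ hu
      have h2 := ((hΦs.differentiableAt (by simp)).hasFDerivAt).comp u (hd u)
      have h3 := h2.sub ((π.restrictScalars ℝ).hasFDerivAt.comp u h2)
      refine h3.congr_fderiv (ContinuousLinearMap.ext fun w => ?_)
      have hL : logDer (E := E) (f k) u w ∈ gradSum gr {0} :=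
        (hasLogDeriv_of_mdifferentiableAt (E := E) (hfd k u)).mem_gradSum hgr (by simp)
          (Eventually.of_forall fun z => mul_mem (inv_mem (hfm k _)) (hfm k z)) w
      have hL' := hgr.adE_mem (T := {0}) (by simp) (hfm k u) hL
      rw [gradSum_singleton] at hL'
      have h4 := hπ (f k u) (hfm k u) rfl _ hL'
      rw [← adE_lieE] at h4
      exact sub_eq_zero.2 h4.symm
    refine (countable_iUnion h1).mono ?_
    rintro _ ⟨y, ⟨hyO, h, hh, rfl⟩, rfl⟩
    obtain ⟨k, v, rfl⟩ := hfsurj h hh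
    exact mem_iUnion.2 ⟨k, v, hyO, rfl⟩
  have hlc : ContinuousAt lam q₀ := hs.self_of_nhds.continuousAt
  obtain ⟨r, hr, hball⟩ := Metric.eventually_nhds_iff_ball.1
    ((hs.and horb).and (hlc.eventually (hOo.mem_nhds hxO)))
  have hzero : ∀ q ∈ Metric.ball q₀ r, τ (lam q) = 0 := by
    intro q hq
    have hcont : ContinuousOn (fun q => τ (lam q)) (Metric.ball q₀ r) := by
      intro z hz
      obtain ⟨hΦs, -⟩ := hO _ (hball z hz).2
      have h1 : ContinuousAt (fun q => Φ (lam q)) z :=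
        ContinuousAt.comp (g := Φ) hΦs.continuousAt (hball z hz).1.1.continuousAt
      exact (h1.sub (π.continuous.continuousAt.comp h1)).continuousWithinAt
    have h1 := hcount.isTotallyDisconnected ((fun q => τ (lam q)) '' Metric.ball q₀ r) (by
      rintro _ ⟨z, hz, rfl⟩
      exact ⟨lam z, ⟨(hball z hz).2, (hball z hz).1.2⟩, rfl⟩)
      ((convex_ball q₀ r).isPreconnected.image _ hcont)
    have h2 := h1 (mem_image_of_mem _ hq) (mem_image_of_mem _ (Metric.mem_ball_self hr))
    refine h2.trans ?_
    change Φ x - π (Φ x) = 0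
    rw [hΦ0, map_zero, sub_zero]
  refine ⟨fun q => σ (Φ (lam q)), fun q => hσmem _, ?_⟩
  filter_upwards [Metric.ball_mem_nhds q₀ hr] with q hq
  obtain ⟨hΦs, hΨ, -, hD, -⟩ := hO _ (hball q hq).2
  have hls := (hball q hq).1.1
  have hus : ContDiffAt ℝ ∞ (fun q => Φ (lam q)) q := hΦs.comp q hls
  refine ⟨(hσs _).comp q hus.contMDiffAt, ?_, fun v w c hvw => ?_⟩
  · have h1 : Φ (lam q) - π (Φ (lam q)) = 0 := hzero q hq
    rwa [h1, add_zero] at hΨ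
  · obtain ⟨L, hL⟩ := hσL (Φ (lam q))
    have hud := ((hΦs.differentiableAt (by simp)).hasFDerivAt).comp q
      (hls.differentiableAt (by simp)).hasFDerivAt
    have h1 := hL.comp (u := fun q => Φ (lam q)) hud
    rw [h1.logDer]
    -- the inverse of the complex linear mapping `D` is complex linear
    have h2 : ∀ z : E, fderiv ℝ Φ (lam q) (c • z) = c • fderiv ℝ Φ (lam q) z := by
      intro z
      obtain ⟨-, -, hD', -⟩ := hO _ (hball q hq).2
      have := hD' (c • fderiv ℝ Φ (lam q) z)
      rwa [map_smul, hD] at this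
    change L (fderiv ℝ Φ (lam q) (fderiv ℝ lam q v)) =
      c • L (fderiv ℝ Φ (lam q) (fderiv ℝ lam q w))
    rw [hvw, h2, map_smul]

theorem exp_apply_of_eigenvector {T : E →L[ℂ] E} {x : E} {μ : ℂ} (h : T x = μ • x) :
    NormedSpace.exp T x = Complex.exp μ • x := by
  have h1 := (ContinuousLinearMap.apply ℂ E x).hasSum (NormedSpace.exp_series_hasSum_exp' (𝕂 := ℂ) T)
  have h2 := (NormedSpace.exp_series_hasSum_exp' (𝕂 := ℂ) μ).smul_const x
  have h3 : ∀ n : ℕ, (T ^ n) x = μ ^ n • x := by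
    intro n
    induction n with
    | zero => simp
    | succ n ih => rw [pow_succ', mul_apply_eq_comp, ih, map_smul, h, smul_smul, pow_succ]
  rw [Complex.exp_eq_exp_ℂ]
  refine h1.unique ?_
  convert h2 using 2 with n
  simp [h3, smul_smul]

/-- Multiplication by `√-1` on the graded piece `𝔤_m`, `m ≠ 0`, is realized by an element of `H̃`,
namely by a value of the one-parameter group of the grading element. -/
theorem IsGradation.exists_adE_eq_I_smul (hgr : IsGradation (E := E) (G := G) gr) {m : ℤ}
    (hm : m ≠ 0) : ∃ h ∈ gradGroup G gr {0}, ∀ x ∈ gr m, adE E h x = Complex.I • x := by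
  obtain ⟨d, hd0, hd⟩ := hgr.exists_gradingElement
  set w : ℂ := Real.pi / 2 * Complex.I / m
  have he := isExp_expC (G := G) d w
  refine ⟨expC G d w, he.mem_gradGroup (by rw [gradSum_singleton]; exact Submodule.smul_mem _ _ hd0),
    fun x hx => ?_⟩
  obtain ⟨c, hc, h0, h1⟩ := isExp_iff.1 he
  rw [← h1, adE_oneParam hc h0, exp_apply_of_eigenvector (μ := Real.pi / 2 * Complex.I),
    Complex.exp_pi_div_two_mul_I]
  rw [lieL_apply, lieE_smul_left, hd m x hx, smul_smul]
  congr 1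
  have : (m : ℂ) ≠ 0 := by exact_mod_cast hm
  simp only [w]
  field_simp

end OrbitLift

/-! ### Components of type (1, 0) and (0, 1) -/

section Wirtinger

variable {E : Type*} [NormedAddCommGroup E] [NormedSpace ℂ E]

/-- The components of a real linear mapping `L = A dz + B dz̄` of the complex line: one has
`A = wirt I L` and `B = wirt (-I) L`. -/
def wirt (c : ℂ) : (ℂ →L[ℝ] E) →L[ℝ] E :=
  (1 / 2 : ℂ) • (ContinuousLinearMap.apply ℝ E (1 : ℂ) -
    c • ContinuousLinearMap.apply ℝ E Complex.I)

theorem wirt_apply (c : ℂ) (L : ℂ →L[ℝ] E) : wirt c L = (1 / 2 : ℂ) • (L 1 - c • L Complex.I) := rfl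

theorem apply_eq_wirt (L : ℂ →L[ℝ] E) (w : ℂ) :
    L w = w • wirt Complex.I L + (starRingEnd ℂ w) • wirt (-Complex.I) L := by
  have h : L w = w.re • L 1 + w.im • L Complex.I := by
    rw [← map_smul, ← map_smul, ← map_add]
    congr 1
    apply Complex.ext <;> simp
  have h1 : ((w.re : ℂ)) = (w + (starRingEnd ℂ) w) / 2 := Complex.re_eq_add_conj w
  have h2 : ((w.im : ℂ)) = (w - (starRingEnd ℂ) w) / (2 * Complex.I) := Complex.im_eq_sub_conj w
  rw [h, ← Complex.coe_smul w.re, ← Complex.coe_smul w.im, h1, h2, wirt_apply, wirt_apply]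
  have hI : Complex.I ^ 2 = -1 := Complex.I_sq
  match_scalars <;> field_simp
  linear_combination (w - (starRingEnd ℂ) w) * hI

theorem wirt_comp (c : ℂ) (T : E →L[ℂ] E) (L : ℂ →L[ℝ] E) :
    wirt c ((T.restrictScalars ℝ).comp L) = T (wirt c L) := by
  simp [wirt_apply]

theorem wirt_mem {c : ℂ} {L : ℂ →L[ℝ] E} {S : Submodule ℂ E} (h : ∀ v, L v ∈ S) : wirt c L ∈ S :=
  S.smul_mem _ (S.sub_mem (h _) (S.smul_mem _ (h _)))

/-- A real linear mapping without component of one of the two types is complex linear or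
antilinear. -/
theorem apply_I_mul_of_wirt_neg_eq_zero {L : ℂ →L[ℝ] E} {c : ℂ}
    (hc : c = Complex.I ∨ c = -Complex.I) (h : wirt (-c) L = 0) (w : ℂ) :
    L (Complex.I * w) = c • L w := by
  rcases hc with rfl | rfl
  · rw [apply_eq_wirt L, apply_eq_wirt L w, h]
    simp [smul_smul]
  · rw [neg_neg] at h
    rw [apply_eq_wirt L, apply_eq_wirt L w, h]
    simp [smul_smul]

theorem wirt_neg_eq_zero {L : ℂ →L[ℝ] E} {c : ℂ} (hc : c = Complex.I ∨ c = -Complex.I)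
    (h : L Complex.I = c • L 1) : wirt (-c) L = 0 := by
  rw [wirt_apply, h]
  rcases hc with rfl | rfl <;> simp [smul_smul]

variable {G : Type*} [TopologicalSpace G] [ChartedSpace E G] [Group G] [LieGroup 𝓘(ℂ, E) ω G]
  [FiniteDimensional ℂ E] [CompleteSpace E] [T2Space G]

theorem HasFDerivAt.wirt {α : ℂ → ℂ →L[ℝ] E} {α' : ℂ →L[ℝ] ℂ →L[ℝ] E} {x : ℂ}
    (h : HasFDerivAt α α' x) (c : ℂ) :
    HasFDerivAt (fun y => Toda.wirt c (α y)) ((Toda.wirt c).comp α') x :=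
  HasFDerivAt.comp x (Toda.wirt (E := E) c).hasFDerivAt h

/-- The curvature of `A dz + B dz̄` is, up to a factor, the value of the curvature form on the pair
`(1, √-1)`. -/
theorem wirt_curvature {α : ℂ → ℂ →L[ℝ] E} {α' : ℂ →L[ℝ] ℂ →L[ℝ] E} {x : ℂ}
    (h : HasFDerivAt α α' x) :
    wirt Complex.I (fderiv ℝ (fun y => wirt (-Complex.I) (α y)) x) -
      wirt (-Complex.I) (fderiv ℝ (fun y => wirt Complex.I (α y)) x) +
      lieE G (wirt Complex.I (α x)) (wirt (-Complex.I) (α x)) =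
    (Complex.I / 2) • (α' 1 Complex.I - α' Complex.I 1 + lieE G (α x 1) (α x Complex.I)) := by
  rw [(HasFDerivAt.wirt h _).fderiv, (HasFDerivAt.wirt h _).fderiv]
  have h1 : lieE G (wirt Complex.I (α x)) (wirt (-Complex.I) (α x)) =
      (Complex.I / 2) • lieE G (α x 1) (α x Complex.I) := by
    rw [wirt_apply, wirt_apply, ← lieL_apply, ← lieL_apply]
    simp only [map_smul, map_sub, smul_apply, sub_apply, lieL_apply]
    rw [lieE_skew (α x Complex.I) (α x 1), lieE_self, lieE_self]
    module
  rw [h1]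
  simp only [ContinuousLinearMap.comp_apply, wirt_apply]
  module

/-- The Maurer-Cartan equation says that `f^* θ` has zero curvature. -/
theorem wirt_maurerCartan {f : ℂ → G} {x : ℂ} (hf : ContMDiffAt 𝓘(ℝ, ℂ) 𝓘(ℝ, E) ∞ f x) :
    wirt Complex.I (fderiv ℝ (fun y => wirt (-Complex.I) (logDer (E := E) f y)) x) -
      wirt (-Complex.I) (fderiv ℝ (fun y => wirt Complex.I (logDer (E := E) f y)) x) +
      lieE G (wirt Complex.I (logDer f x)) (wirt (-Complex.I) (logDer f x)) = 0 := by
  rw [wirt_curvature (G := G) ((contDiffAt_logDer hf).differentiableAt (by simp)).hasFDerivAt,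
    maurerCartan_equation hf, smul_zero]

theorem HasLogDeriv.wirt_mul {f g : ℂ → G} {x : ℂ} (hf : MDifferentiableAt 𝓘(ℝ, ℂ) 𝓘(ℝ, E) f x)
    (hg : MDifferentiableAt 𝓘(ℝ, ℂ) 𝓘(ℝ, E) g x) (c : ℂ) :
    wirt c (Toda.logDer (E := E) (fun y => f y * g y) x) =
      Toda.adE E (g x)⁻¹ (wirt c (Toda.logDer f x)) + wirt c (Toda.logDer g x) := by
  rw [((hasLogDeriv_of_mdifferentiableAt hf).mul (hasLogDeriv_of_mdifferentiableAt hg)).logDer,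
    map_add, wirt_comp]

/-- The curvature of the Toda connection is the difference of the two sides of the Toda equation: the
derivative of `Ad(γ⁻¹) x₊` cancels the bracket of `(γ^* θ)_-` with `√-1 Ad(γ⁻¹) x₊`. -/
theorem toda_curvature {γ : ℂ → G} {x : ℂ} (hγ : ContMDiffAt 𝓘(ℝ, ℂ) 𝓘(ℝ, E) ∞ γ x) (xm xp : E) :
    wirt Complex.I (fderiv ℝ (fun y => Complex.I • adE E (γ y)⁻¹ xp) x) -
      wirt (-Complex.I)
        (fderiv ℝ (fun y => Complex.I • xm + wirt Complex.I (logDer (E := E) γ y)) x) +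
      lieE G (Complex.I • xm + wirt Complex.I (logDer (E := E) γ x)) (Complex.I • adE E (γ x)⁻¹ xp) =
    lieE G (adE E (γ x)⁻¹ xp) xm -
      wirt (-Complex.I) (fderiv ℝ (fun y => wirt Complex.I (logDer (E := E) γ y)) x) := by
  have h1 := (hasLogDeriv_of_mdifferentiableAt (hγ.mdifferentiableAt (by simp))).inv.adE xp
  have h2 : HasFDerivAt (fun y => Complex.I • adE E (γ y)⁻¹ xp) _ x := h1.const_smul Complex.I
  rw [h2.fderiv, fderiv_const_add]
  have h3 : wirt Complex.I (Complex.I • ((((adE E (γ x)⁻¹).comp ((lieL G).flip xp)).restrictScalars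
      ℝ).comp (-((adE E (γ x)).restrictScalars ℝ).comp (logDer (E := E) γ x)))) =
      -(Complex.I • lieE G (wirt Complex.I (logDer (E := E) γ x)) (adE E (γ x)⁻¹ xp)) := by
    have e : (((adE E (γ x)⁻¹).comp ((lieL G).flip xp)).restrictScalars
      ℝ).comp (-((adE E (γ x)).restrictScalars ℝ).comp (logDer (E := E) γ x)) =
      (((-(lieL G).flip (adE E (γ x)⁻¹ xp))).restrictScalars ℝ).comp (logDer (E := E) γ x) := by
      ext v
      simp [adE_lieE, adE_inv_apply_self]
    rw [e]
    have e2 := wirt_comp Complex.I (Complex.I • (-(lieL G).flip (adE E (γ x)⁻¹ xp)))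
      (logDer (E := E) γ x)
    refine (Eq.trans ?_ e2).trans ?_
    · rfl
    · simp
  rw [h3, lieE_add_left, lieE_smul_left, lieE_smul_right, lieE_smul_right, smul_smul,
    Complex.I_mul_I, lieE_skew xm]
  module

end Wirtinger

/-! ### The gauge transformation to the Toda connection -/

section Gauge

variable {E : Type*} [NormedAddCommGroup E] [NormedSpace ℂ E]
  {G : Type*} [TopologicalSpace G] [ChartedSpace E G] [Group G] [LieGroup 𝓘(ℂ, E) ω G]
  [FiniteDimensional ℂ E] [CompleteSpace E] [T2Space G] {gr : ℤ → Submodule ℂ E}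
  [LieAlgebra.IsSemisimple ℂ (GroupLieAlgebra 𝓘(ℂ, E) G)]

theorem wirt_logDer_mem (hgr : IsGradation (E := E) (G := G) gr) {S : Set ℤ}
    (hS : ∀ s ∈ S, ∀ t ∈ S, s + t ∈ S) {f : ℂ → G} {x : ℂ} {U : Set ℂ} (hU : U ∈ 𝓝 x)
    (hf : MDifferentiableAt 𝓘(ℝ, ℂ) 𝓘(ℝ, E) f x) {g : G}
    (hfS : ∀ y ∈ U, g⁻¹ * f y ∈ gradGroup G gr S) (c : ℂ) :
    wirt c (logDer (E := E) f x) ∈ gradSum gr S := by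
  refine wirt_mem fun v => (hasLogDeriv_of_mdifferentiableAt hf).mem_gradSum hgr hS ?_ v
  filter_upwards [hU] with y hy
  have := mul_mem (inv_mem (hfS x (mem_of_mem_nhds hU))) (hfS y hy)
  simpa using this

/-- If `f = μ β` with `μ` in a coset of `K_P` and `β` in `K_{Q ∪ 0}`, then a component of `μ^* θ` is
determined by the component of `f^* θ` modulo degrees in `Q ∪ 0`. -/
theorem wirt_logDer_left_eq (hgr : IsGradation (E := E) (G := G) gr) {P Q : Set ℤ}
    (hPQ : IsTriangular P Q) {μ β : ℂ → G} {x : ℂ} {U : Set ℂ} (hU : U ∈ 𝓝 x)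
    (hμ : MDifferentiableAt 𝓘(ℝ, ℂ) 𝓘(ℝ, E) μ x) (hβ : MDifferentiableAt 𝓘(ℝ, ℂ) 𝓘(ℝ, E) β x)
    {g : G} (hμP : ∀ y ∈ U, g⁻¹ * μ y ∈ gradGroup G gr P)
    (hβQ : ∀ y ∈ U, β y ∈ gradGroup G gr (Q ∪ {0})) {c : ℂ} {Y : E} (hY : Y ∈ gradSum gr P)
    (h : wirt c (logDer (E := E) (fun y => μ y * β y) x) - adE E (β x)⁻¹ Y ∈
      gradSum gr (Q ∪ {0})) :
    wirt c (logDer (E := E) μ x) = Y := by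
  have hadd : ∀ s ∈ Q ∪ {0}, ∀ t ∈ Q ∪ {0}, s + t ∈ Q ∪ {0} := by
    rintro s (hs | rfl) t (ht | rfl)
    · exact Or.inl (hPQ.add_right s hs t ht)
    · exact Or.inl (by simpa using hs)
    · exact Or.inl (by simpa using ht)
    · simp
  have h1 := wirt_logDer_mem hgr hPQ.add_left hU hμ hμP c
  have h2 := wirt_logDer_mem hgr hadd hU hβ (g := 1) (by simpa using hβQ) c
  rw [HasLogDeriv.wirt_mul hμ hβ] at h
  have h3 : adE E (β x)⁻¹ (wirt c (logDer (E := E) μ x) - Y) ∈ gradSum gr (Q ∪ {0}) := by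
    have := Submodule.sub_mem _ h h2
    convert this using 1
    rw [map_sub]
    abel
  have h4 := hgr.adE_mem hadd (hβQ x (mem_of_mem_nhds hU)) h3
  rw [adE_apply_inv_self] at h4
  refine sub_eq_zero.1 (eq_zero_of_mem_gradSum hgr.internal ?_ (Submodule.sub_mem _ h1 hY) h4)
  rw [disjoint_union_right]
  exact ⟨hPQ.disjoint, disjoint_singleton_right.2 hPQ.zero_left⟩

/-- The factor `h` of degree `0` does not change the leading term: `Ad((n h)⁻¹) Ad(h) Y = Y` up to terms
of the degrees reached from `Y` by `n`. -/
theorem adE_conj_sub_mem (hgr : IsGradation (E := E) (G := G) gr) {S U : Set ℤ} {m : ℤ}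
    (hmU : ∀ s ∈ S, s + m ∈ U) (hSU : ∀ s ∈ S, ∀ u ∈ U, s + u ∈ U) {n h : G}
    (hn : n ∈ gradGroup G gr S) (hh : h ∈ gradGroup G gr {0}) {Y : E} (hY : Y ∈ gr m) :
    adE E (n * h)⁻¹ (adE E h Y) - Y ∈ gradSum gr U := by
  rw [← adE_mul_apply]
  have h1 := hgr.conj_mem (S := {0}) (T := S) (by simp) (inv_mem hh) (inv_mem hn)
  have h2 : (n * h)⁻¹ * h = h⁻¹ * n⁻¹ * h⁻¹⁻¹ := by group
  rw [h2]
  exact hgr.adE_sub_mem (S := S) (T := {m}) (by rintro s hs _ rfl; exact hmU s hs) hSU h1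
    (by rwa [gradSum_singleton])

/-- The component `Z` of the gauge transformed form is `√-1 x₋` modulo nonnegative degrees by the first
expression, and `C` modulo negative degrees by the second one. -/
theorem gauge_minus (hgr : IsGradation (E := E) (G := G) gr) {n h : G} {xm X A Y C Z : E}
    (hxm : xm ∈ gr (-1)) (hn : n ∈ gradGroup G gr {m | 0 < m}) (hh : h ∈ gradGroup G gr {0})
    (hX : X ∈ gradSum gr {m | 0 < m}) (hA : A ∈ gradSum gr {0}) (hY : Y ∈ gradSum gr {m | m < 0})
    (hC : C ∈ gradSum gr {0}) (h1 : Z = Complex.I • adE E (n * h)⁻¹ (adE E h xm) + (X + A))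
    (h2 : Z = Y + C) : Z = Complex.I • xm + C := by
  rw [← sub_eq_zero]
  have k1 := adE_conj_sub_mem hgr (S := {m | 0 < m}) (U := {m | 0 ≤ m})
    (by intro s hs; simp at *; omega) (by intro s hs u hu; simp at *; omega) hn hh hxm
  refine eq_zero_of_mem_gradSum hgr.internal (S := {m | 0 ≤ m}) (T := {m | m < 0})
    (disjoint_left.2 fun m hm hm' => by simp at *; omega) ?_ ?_
  · have hX' : X ∈ gradSum gr {m | 0 ≤ m} :=
      gradSum_mono (ofPred_subset_ofPred.2 fun m hm => hm.le) hX
    have hA' : A ∈ gradSum gr {m | 0 ≤ m} := gradSum_mono (by simp) hA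
    have hC' : C ∈ gradSum gr {m | 0 ≤ m} := gradSum_mono (by simp) hC
    have e : Z - (Complex.I • xm + C) =
        Complex.I • (adE E (n * h)⁻¹ (adE E h xm) - xm) + (X + A - C) := by
      rw [h1, smul_sub]
      abel
    rw [e]
    exact add_mem (Submodule.smul_mem _ _ k1) (sub_mem (add_mem hX' hA') hC')
  · have hx' : xm ∈ gradSum gr {m | m < 0} := mem_gradSum (by simp) hxm
    have e : Z - (Complex.I • xm + C) = Y - Complex.I • xm := by
      rw [h2]
      abel
    rw [e]
    exact sub_mem hY (Submodule.smul_mem _ _ hx')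

/-- The counterpart of `gauge_minus` for the other component, which has no terms of degree `≤ 0` by
one expression and is `√-1 Ad(g⁻¹) x₊` modulo these degrees by the other one. -/
theorem gauge_plus (hgr : IsGradation (E := E) (G := G) gr) {n h g : G} {xp A Y C Z : E}
    (hxp : xp ∈ gr 1) (hn : n ∈ gradGroup G gr {m | m < 0}) (hh : h ∈ gradGroup G gr {0})
    (hg : g ∈ gradGroup G gr {0}) (hA : A ∈ gradSum gr {0}) (hY : Y ∈ gradSum gr {m | m < 0})
    (hC : C ∈ gradSum gr {0}) (h1 : Z ∈ gradSum gr {m | 0 < m})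
    (h2 : Z = Complex.I • adE E (n * (h * g))⁻¹ (adE E h xp) + (Y + (A + C))) :
    Z = Complex.I • adE E g⁻¹ xp := by
  rw [← sub_eq_zero]
  have k1 := adE_conj_sub_mem hgr (S := {m | m < 0}) (U := {m | m ≤ 0})
    (by intro s hs; simp at *; omega) (by intro s hs u hu; simp at *; omega) hn hh hxp
  have k1' := hgr.adE_mem (S := {0}) (T := {m | m ≤ 0}) (by simp) (inv_mem hg) k1
  have k3 : adE E g⁻¹ (adE E (n * h)⁻¹ (adE E h xp)) =
      adE E (n * (h * g))⁻¹ (adE E h xp) := by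
    rw [← adE_mul_apply]
    congr 2
    group
  rw [map_sub, k3] at k1'
  refine eq_zero_of_mem_gradSum hgr.internal (S := {m | m ≤ 0}) (T := {m | 0 < m})
    (disjoint_left.2 fun m hm hm' => by simp at *; omega) ?_ ?_
  · have hY' : Y ∈ gradSum gr {m | m ≤ 0} :=
      gradSum_mono (ofPred_subset_ofPred.2 fun m hm => hm.le) hY
    have hA' : A ∈ gradSum gr {m | m ≤ 0} := gradSum_mono (by simp) hA
    have hC' : C ∈ gradSum gr {m | m ≤ 0} := gradSum_mono (by simp) hC
    have e : Z - Complex.I • adE E g⁻¹ xp = Complex.I • (adE E (n * (h * g))⁻¹ (adE E h xp) -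
        adE E g⁻¹ xp) + (Y + (A + C)) := by
      rw [h2, smul_sub]
      abel
    rw [e]
    exact add_mem (Submodule.smul_mem _ _ k1') (add_mem hY' (add_mem hA' hC'))
  · have k4 := hgr.adE_mem (S := {0}) (T := {1}) (by simp) (inv_mem hg) (y := xp)
      (by rwa [gradSum_singleton])
    have k5 : adE E g⁻¹ xp ∈ gradSum gr {m | 0 < m} := gradSum_mono (by simp) k4
    exact sub_mem h1 (Submodule.smul_mem _ _ k5)

/-- The connection form of `φ ψ`, where `ψ = η₊⁻¹ γ₋`, is the Toda connection of `γ`.  It is computed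
from both decompositions `φ ψ = μ₋ ν₊ γ₋ = μ₊ ν₋ γ₊ γ`, and the degrees are compared. -/
theorem wirt_logDer_gauge (hgr : IsGradation (E := E) (G := G) gr) {U : Set ℂ} (hUo : IsOpen U)
    {x : ℂ} (hx : x ∈ U) {xm xp : E} (hxm : xm ∈ gr (-1)) (hxp : xp ∈ gr 1) {gp gm : G}
    {φ μp νm ηm μm νp ηp γp γm : ℂ → G}
    (dμp : MDifferentiableAt 𝓘(ℝ, ℂ) 𝓘(ℝ, E) μp x) (dνm : MDifferentiableAt 𝓘(ℝ, ℂ) 𝓘(ℝ, E) νm x)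
    (dηm : MDifferentiableAt 𝓘(ℝ, ℂ) 𝓘(ℝ, E) ηm x) (dμm : MDifferentiableAt 𝓘(ℝ, ℂ) 𝓘(ℝ, E) μm x)
    (dνp : MDifferentiableAt 𝓘(ℝ, ℂ) 𝓘(ℝ, E) νp x) (dηp : MDifferentiableAt 𝓘(ℝ, ℂ) 𝓘(ℝ, E) ηp x)
    (dγp : MDifferentiableAt 𝓘(ℝ, ℂ) 𝓘(ℝ, E) γp x) (dγm : MDifferentiableAt 𝓘(ℝ, ℂ) 𝓘(ℝ, E) γm x)
    (mμp : ∀ y ∈ U, gp⁻¹ * μp y ∈ gradGroup G gr {m | 0 < m})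
    (mνm : ∀ y ∈ U, νm y ∈ gradGroup G gr {m | m < 0})
    (mηm : ∀ y ∈ U, ηm y ∈ gradGroup G gr {0})
    (mμm : ∀ y ∈ U, gm⁻¹ * μm y ∈ gradGroup G gr {m | m < 0})
    (mνp : ∀ y ∈ U, νp y ∈ gradGroup G gr {m | 0 < m})
    (mηp : ∀ y ∈ U, ηp y ∈ gradGroup G gr {0})
    (mγp : ∀ y ∈ U, γp y ∈ gradGroup G gr {0}) (mγm : ∀ y ∈ U, γm y ∈ gradGroup G gr {0})
    (hp : ∀ y ∈ U, φ y = μp y * νm y * ηm y) (hm : ∀ y ∈ U, φ y = μm y * νp y * ηp y)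
    (hφm : wirt Complex.I (logDer (E := E) φ x) ∈ gr (-1) ⊔ gr 0)
    (hφp : wirt (-Complex.I) (logDer (E := E) φ x) ∈ gr 0 ⊔ gr 1)
    (hγp : wirt Complex.I (logDer (E := E) γp x) = 0)
    (hγm : wirt (-Complex.I) (logDer (E := E) γm x) = 0)
    (lp : wirt (-Complex.I) (logDer (E := E) μp x) = Complex.I • adE E (γp x) xp)
    (lm : wirt Complex.I (logDer (E := E) μm x) = Complex.I • adE E (γm x) xm) :
    let γ : ℂ → G := fun y => (γp y)⁻¹ * (ηm y * (ηp y)⁻¹) * γm y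
    wirt Complex.I (logDer (E := E) (fun y => φ y * ((ηp y)⁻¹ * γm y)) x) =
        Complex.I • xm + wirt Complex.I (logDer (E := E) γ x) ∧
      wirt (-Complex.I) (logDer (E := E) (fun y => φ y * ((ηp y)⁻¹ * γm y)) x) =
        Complex.I • adE E (γ x)⁻¹ xp := by
  intro γ
  have hU : U ∈ 𝓝 x := hUo.mem_nhds hx
  have dmul : ∀ {f g : ℂ → G}, MDifferentiableAt 𝓘(ℝ, ℂ) 𝓘(ℝ, E) f x →
      MDifferentiableAt 𝓘(ℝ, ℂ) 𝓘(ℝ, E) g x →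
      MDifferentiableAt 𝓘(ℝ, ℂ) 𝓘(ℝ, E) (fun y => f y * g y) x := fun hf hg =>
    ((hasLogDeriv_of_mdifferentiableAt hf).mul
      (hasLogDeriv_of_mdifferentiableAt hg)).mdifferentiableAt
  have dinv : ∀ {f : ℂ → G}, MDifferentiableAt 𝓘(ℝ, ℂ) 𝓘(ℝ, E) f x →
      MDifferentiableAt 𝓘(ℝ, ℂ) 𝓘(ℝ, E) (fun y => (f y)⁻¹) x := fun hf =>
    (hasLogDeriv_of_mdifferentiableAt hf).inv.mdifferentiableAt
  have dγ : MDifferentiableAt 𝓘(ℝ, ℂ) 𝓘(ℝ, E) γ x :=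
    dmul (dmul (dinv dγp) (dmul dηm (dinv dηp))) dγm
  have mγ : ∀ y ∈ U, γ y ∈ gradGroup G gr {0} := fun y hy =>
    mul_mem (mul_mem (inv_mem (mγp y hy)) (mul_mem (mηm y hy) (inv_mem (mηp y hy)))) (mγm y hy)
  have h0 : ∀ s ∈ ({0} : Set ℤ), ∀ t ∈ ({0} : Set ℤ), s + t ∈ ({0} : Set ℤ) := by simp
  have hpos := isTriangular_pos_neg.add_left
  have hneg := isTriangular_pos_neg.add_right
  -- the components of the two Gauss factors that vanish by the grading condition
  have zp : wirt Complex.I (logDer (E := E) μp x) = 0 := by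
    refine wirt_logDer_left_eq hgr isTriangular_pos_neg hU dμp (dmul dνm dηm) mμp
      (fun y hy => mul_mem (gradGroup_mono subset_union_left (mνm y hy))
        (gradGroup_mono subset_union_right (mηm y hy))) (Submodule.zero_mem _) ?_
    rw [map_zero, sub_zero, logDer_congr (g := φ)]
    · refine (sup_le ?_ ?_ : gr (-1) ⊔ gr 0 ≤ _) hφm <;>
        exact fun y hy => mem_gradSum (by simp) hy
    · filter_upwards [hU] with y hy
      rw [hp y hy, mul_assoc]
  have zm : wirt (-Complex.I) (logDer (E := E) μm x) = 0 := by
    refine wirt_logDer_left_eq hgr isTriangular_neg_pos hU dμm (dmul dνp dηp) mμm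
      (fun y hy => mul_mem (gradGroup_mono subset_union_left (mνp y hy))
        (gradGroup_mono subset_union_right (mηp y hy))) (Submodule.zero_mem _) ?_
    rw [map_zero, sub_zero, logDer_congr (g := φ)]
    · refine (sup_le ?_ ?_ : gr 0 ⊔ gr 1 ≤ _) hφp <;>
        exact fun y hy => mem_gradSum (by simp) hy
    · filter_upwards [hU] with y hy
      rw [hm y hy, mul_assoc]
  -- the two factorizations of `φ ψ`
  have e1 : ∀ c, wirt c (logDer (E := E) (fun y => φ y * ((ηp y)⁻¹ * γm y)) x) =
      adE E (νp x * γm x)⁻¹ (wirt c (logDer μm x)) +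
        (adE E (γm x)⁻¹ (wirt c (logDer νp x)) + wirt c (logDer γm x)) := by
    intro c
    rw [← HasLogDeriv.wirt_mul dνp dγm, ← HasLogDeriv.wirt_mul dμm (dmul dνp dγm)]
    congr 1
    refine logDer_congr ?_
    filter_upwards [hU] with y hy
    rw [hm y hy]
    group
  have e2 : ∀ c, wirt c (logDer (E := E) (fun y => φ y * ((ηp y)⁻¹ * γm y)) x) =
      adE E (νm x * (γp x * γ x))⁻¹ (wirt c (logDer μp x)) +
        (adE E (γp x * γ x)⁻¹ (wirt c (logDer νm x)) +
          (adE E (γ x)⁻¹ (wirt c (logDer γp x)) + wirt c (logDer γ x))) := by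
    intro c
    rw [← HasLogDeriv.wirt_mul dγp dγ, ← HasLogDeriv.wirt_mul dνm (dmul dγp dγ),
      ← HasLogDeriv.wirt_mul dμp (dmul dνm (dmul dγp dγ))]
    congr 1
    refine logDer_congr ?_
    filter_upwards [hU] with y hy
    rw [hp y hy]
    simp only [γ]
    group
  have νpmem : ∀ c, adE E (γm x)⁻¹ (wirt c (logDer (E := E) νp x)) ∈ gradSum gr {m | 0 < m} :=
    fun c => hgr.adE_mem (S := {0}) (by simp) (inv_mem (mγm x hx))
      (wirt_logDer_mem hgr hpos hU dνp (g := 1) (by simpa using mνp) c)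
  have νmmem : ∀ c, adE E (γp x * γ x)⁻¹ (wirt c (logDer (E := E) νm x)) ∈
      gradSum gr {m | m < 0} :=
    fun c => hgr.adE_mem (S := {0}) (by simp) (inv_mem (mul_mem (mγp x hx) (mγ x hx)))
      (wirt_logDer_mem hgr hneg hU dνm (g := 1) (by simpa using mνm) c)
  have zeromem : ∀ {f : ℂ → G}, MDifferentiableAt 𝓘(ℝ, ℂ) 𝓘(ℝ, E) f x →
      (∀ y ∈ U, f y ∈ gradGroup G gr {0}) → ∀ c, wirt c (logDer (E := E) f x) ∈ gradSum gr {0} :=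
    fun hf hf0 c => wirt_logDer_mem hgr h0 hU hf (g := 1) (by simpa using hf0) c
  constructor
  · have h1 := e1 Complex.I
    have h2 := e2 Complex.I
    rw [lm, map_smul] at h1
    rw [zp, hγp, map_zero, map_zero, zero_add, zero_add] at h2
    exact gauge_minus hgr hxm (mνp x hx) (mγm x hx) (νpmem _) (zeromem dγm mγm _) (νmmem _)
      (zeromem dγ mγ _) h1 h2
  · have h1 := e1 (-Complex.I)
    have h2 := e2 (-Complex.I)
    rw [lp, map_smul] at h2
    rw [zm, hγm, map_zero, zero_add, add_zero] at h1
    have k4 := hgr.adE_mem (S := {0}) (T := {0}) (by simp) (inv_mem (mγ x hx))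
      (zeromem dγp mγp (-Complex.I))
    refine gauge_plus hgr hxp (mνm x hx) (mγp x hx) (mγ x hx) k4 (νmmem _) (zeromem dγ mγ _) ?_ h2
    rw [h1]
    exact νpmem _

end Gauge

/-! ### Lifts of holomorphic components -/

section ComponentLift

variable {E : Type*} [NormedAddCommGroup E] [NormedSpace ℂ E]
  {G : Type*} [TopologicalSpace G] [ChartedSpace E G] [Group G] [LieGroup 𝓘(ℂ, E) ω G]
  [FiniteDimensional ℂ E] [CompleteSpace E] [T2Space G] {gr : ℤ → Submodule ℂ E}
  [LieAlgebra.IsSemisimple ℂ (GroupLieAlgebra 𝓘(ℂ, E) G)]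

/-- If one component of `μ^* θ` vanishes, the Maurer-Cartan equation says that the other one is
holomorphic or antiholomorphic. -/
theorem wirt_fderiv_wirt_logDer_eq_zero {μ : ℂ → G} {x : ℂ} {c : ℂ}
    (hc : c = Complex.I ∨ c = -Complex.I) (hμ : ContMDiffAt 𝓘(ℝ, ℂ) 𝓘(ℝ, E) ∞ μ x)
    (h0 : ∀ᶠ y in 𝓝 x, wirt (-c) (logDer (E := E) μ y) = 0) :
    wirt (-c) (fderiv ℝ (fun y => wirt c (logDer (E := E) μ y)) x) = 0 := by
  have h := wirt_maurerCartan hμ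
  have h1 : fderiv ℝ (fun y => wirt (-c) (logDer (E := E) μ y)) x = 0 := by
    have e : (fun y => wirt (-c) (logDer (E := E) μ y)) =ᶠ[𝓝 x] fun _ => (0 : E) := h0
    rw [e.fderiv_eq, fderiv_fun_const]
    rfl
  have h2 := h0.self_of_nhds
  rcases hc with rfl | rfl
  · rw [h1, h2, ← lieL_apply, map_zero, map_zero, add_zero, zero_sub, neg_eq_zero] at h
    exact h
  · rw [neg_neg] at h1 h2 ⊢
    rw [h1, h2, ← lieL_apply, map_zero, map_zero, zero_apply, add_zero, sub_zero] at h
    exact h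

/-- If `μ^* θ` has only one component, with values in the orbit of `X ∈ 𝔤_m`, then this component is
`√-1 Ad(γ) X` with `γ` holomorphic or antiholomorphic.  The factor `√-1` is absorbed by an element
`k` of `H̃` from `IsGradation.exists_adE_eq_I_smul`. -/
theorem exists_lift_of_component (hgr : IsGradation (E := E) (G := G) gr) {μ : ℂ → G} {x₀ : ℂ}
    {c : ℂ} (hc : c = Complex.I ∨ c = -Complex.I)
    (hμ : ∀ᶠ y in 𝓝 x₀, ContMDiffAt 𝓘(ℝ, ℂ) 𝓘(ℝ, E) ∞ μ y)
    (h0 : ∀ᶠ y in 𝓝 x₀, wirt (-c) (logDer (E := E) μ y) = 0) {m : ℤ} (hm : m ≠ 0) {X : E}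
    (hX : X ∈ gr m)
    (horb : ∀ᶠ y in 𝓝 x₀, ∃ h ∈ gradGroup G gr {0},
      wirt c (logDer (E := E) μ y) = adE E h X) :
    ∃ γ : ℂ → G, (∀ y, γ y ∈ gradGroup G gr {0}) ∧ ∀ᶠ y in 𝓝 x₀,
      ContMDiffAt 𝓘(ℝ, ℂ) 𝓘(ℝ, E) ∞ γ y ∧ wirt (-c) (logDer (E := E) γ y) = 0 ∧
      wirt c (logDer (E := E) μ y) = Complex.I • adE E (γ y) X := by
  set lam : ℂ → E := fun y => wirt c (logDer (E := E) μ y) with hlam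
  obtain ⟨h₀, hh₀, e₀⟩ := horb.self_of_nhds
  obtain ⟨k, hk, ek⟩ := hgr.exists_adE_eq_I_smul hm
  have ek' : adE E k⁻¹ X = -(Complex.I • X) := by
    have h1 : adE E k⁻¹ (Complex.I • X) = X := by rw [← ek X hX, adE_inv_apply_self]
    rw [map_smul] at h1
    have h2 : adE E k⁻¹ X = -(Complex.I • Complex.I • adE E k⁻¹ X) := by
      rw [smul_smul, Complex.I_mul_I, neg_smul, one_smul, neg_neg]
    rw [h2, h1]
  obtain ⟨γ, hγ, hγ'⟩ := exists_orbit_lift (G := G) hgr (lam := lam) (q₀ := x₀)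
    (by
      filter_upwards [hμ] with y hy
      exact (wirt (E := E) c).contDiff.contDiffAt.comp y (contDiffAt_logDer hy))
    (by
      filter_upwards [horb] with y ⟨h, hh, hy⟩
      refine ⟨h * h₀⁻¹, mul_mem hh (inv_mem hh₀), ?_⟩
      rw [show lam x₀ = adE E h₀ X from e₀, adE_mul_apply, adE_inv_apply_self]
      exact hy)
  refine ⟨fun y => γ y * (h₀ * k⁻¹), fun y => mul_mem (hγ y) (mul_mem hh₀ (inv_mem hk)), ?_⟩
  filter_upwards [hγ', h0.eventually_nhds, hμ] with y ⟨hys, hy, hyd⟩ hy0 hyμ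
  refine ⟨hys.mul contMDiffAt_const, ?_, ?_⟩
  · have h1 := apply_I_mul_of_wirt_neg_eq_zero hc (wirt_fderiv_wirt_logDer_eq_zero hc hyμ hy0) 1
    rw [mul_one] at h1
    have h2 := hyd _ _ _ h1
    have h3 := (hasLogDeriv_of_mdifferentiableAt (hys.mdifferentiableAt (by simp))).mul
      (hasLogDeriv_const (h₀ * k⁻¹) y)
    rw [h3.logDer, add_zero, wirt_comp, wirt_neg_eq_zero hc h2, map_zero]
  · rw [adE_mul_apply, adE_mul_apply, ek', map_neg, map_smul, map_neg, map_smul, smul_neg,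
      smul_smul, Complex.I_mul_I, neg_smul, one_smul, neg_neg, ← e₀]
    exact hy.symm

end ComponentLift

/-! ### Forms in a local coordinate -/

section Coordinates

variable {E : Type*} [NormedAddCommGroup E] [NormedSpace ℂ E]
  {G : Type*} [TopologicalSpace G] [ChartedSpace E G] [Group G] [LieGroup 𝓘(ℂ, E) ω G]
  [FiniteDimensional ℂ E] [CompleteSpace E]
  {M : Type*} [TopologicalSpace M] [ChartedSpace ℂ M] [IsManifold 𝓘(ℂ, ℂ) ω M]
  {z : OpenPartialHomeomorph M ℂ}

/-- The two forms of the adjoint representation agree, since the chart at the identity has the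
identity as its differential there. -/
theorem Ad_eq_adE (g : G) (X : E) : Ad (E := E) g X = adE E g X := by
  let A : E →L[ℂ] E := Ad (E := E) g
  have h1 : HasMFDerivAt 𝓘(ℂ, E) 𝓘(ℂ, E) (fun h : G => g * h * g⁻¹)
      ((oneChart E G).symm (oneChart E G 1)) A := by
    rw [oneChart_symm_one]
    exact (((contMDiff_mul_left (I := 𝓘(ℂ, E)) (n := ω) (a := g)).mul
      (contMDiff_const (c := g⁻¹))).mdifferentiable (by simp) 1).hasMFDerivAt
  have h2 := HasMFDerivAt.comp (M := E) (oneChart E G 1) h1 hasMFDerivAt_oneChart_symm_one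
  have h3 : HasMFDerivAt 𝓘(ℂ, E) 𝓘(ℂ, E) (oneChart E G)
      (((fun h : G => g * h * g⁻¹) ∘ (oneChart E G).symm) (oneChart E G 1))
      (ContinuousLinearMap.id ℂ E) := by
    have e : ((fun h : G => g * h * g⁻¹) ∘ (oneChart E G).symm) (oneChart E G 1) = 1 := by simp
    rw [e]
    exact hasMFDerivAt_oneChart_one
  have h4 : HasFDerivAt (fun x => oneChart E G (g * (oneChart E G).symm x * g⁻¹)) A
      (oneChart E G 1) :=
    hasMFDerivAt_iff_hasFDerivAt.1 (HasMFDerivAt.comp (M := E) (oneChart E G 1) h3 h2)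
  exact congrArg (fun T : E →L[ℂ] E => T X) h4.fderiv.symm

theorem contMDiffAt_coord (hz : z ∈ IsManifold.maximalAtlas 𝓘(ℂ, ℂ) ω M) {p : M}
    (hp : p ∈ z.source) : ContMDiffAt 𝓘(ℝ, ℂ) 𝓘(ℝ, ℂ) ∞ z p :=
  ((contMDiffOn_restrictScalars (contMDiffOn_of_mem_maximalAtlas hz)).contMDiffAt
    (z.open_source.mem_nhds hp)).of_le le_top

theorem contMDiffAt_coord_symm (hz : z ∈ IsManifold.maximalAtlas 𝓘(ℂ, ℂ) ω M) {x : ℂ}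
    (hx : x ∈ z.target) : ContMDiffAt 𝓘(ℝ, ℂ) 𝓘(ℝ, ℂ) ∞ z.symm x :=
  ((contMDiffOn_restrictScalars (contMDiffOn_symm_of_mem_maximalAtlas hz)).contMDiffAt
    (z.open_target.mem_nhds hx)).of_le le_top

/-- The mapping `f` read in the coordinate `z`. -/
abbrev inCoord {Y : Type*} (z : OpenPartialHomeomorph M ℂ) (f : M → Y) : ℂ → Y :=
  fun x => f (z.symm x)

theorem contMDiffAt_inCoord (hz : z ∈ IsManifold.maximalAtlas 𝓘(ℂ, ℂ) ω M) {f : M → G} {x : ℂ}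
    (hx : x ∈ z.target) (hf : ContMDiffAt 𝓘(ℝ, ℂ) 𝓘(ℝ, E) ∞ f (z.symm x)) :
    ContMDiffAt 𝓘(ℝ, ℂ) 𝓘(ℝ, E) ∞ (inCoord z f) x :=
  ContMDiffAt.comp (I' := 𝓘(ℝ, ℂ)) x hf (contMDiffAt_coord_symm hz hx)

/-- The differentials of a coordinate and of its inverse are complex linear mappings of the complex
line, inverse to each other. -/
theorem exists_mfderiv_coord (hz : z ∈ IsManifold.maximalAtlas 𝓘(ℂ, ℂ) ω M) {p : M}
    (hp : p ∈ z.source) : ∃ Z S : ℂ →L[ℂ] ℂ, HasMFDerivAt 𝓘(ℂ, ℂ) 𝓘(ℂ, ℂ) z p Z ∧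
      HasMFDerivAt 𝓘(ℂ, ℂ) 𝓘(ℂ, ℂ) z.symm (z p) S ∧ (∀ w, Z (S w) = w) ∧ ∀ w, S (Z w) = w := by
  obtain ⟨Z, hZ⟩ : ∃ Z : ℂ →L[ℂ] ℂ, HasMFDerivAt 𝓘(ℂ, ℂ) 𝓘(ℂ, ℂ) z p Z :=
    ⟨_, (((contMDiffOn_of_mem_maximalAtlas hz).contMDiffAt
      (z.open_source.mem_nhds hp)).mdifferentiableAt (by simp)).hasMFDerivAt⟩
  obtain ⟨S, hS⟩ : ∃ S : ℂ →L[ℂ] ℂ, HasMFDerivAt 𝓘(ℂ, ℂ) 𝓘(ℂ, ℂ) z.symm (z p) S :=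
    ⟨_, (((contMDiffOn_symm_of_mem_maximalAtlas hz).contMDiffAt
      (z.open_target.mem_nhds (z.map_source hp))).mdifferentiableAt (by simp)).hasMFDerivAt⟩
  refine ⟨Z, S, hZ, hS, fun w => ?_, fun w => ?_⟩
  · have hZ' : HasMFDerivAt 𝓘(ℂ, ℂ) 𝓘(ℂ, ℂ) z (z.symm (z p)) Z := by rwa [z.left_inv hp]
    have h1 : HasFDerivAt (z ∘ z.symm) (Z.comp S) (z p) :=
      hasMFDerivAt_iff_hasFDerivAt.1 (HasMFDerivAt.comp (M := ℂ) (z p) hZ' hS)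
    have h2 : HasFDerivAt (z ∘ z.symm) (ContinuousLinearMap.id ℂ ℂ) (z p) :=
      (hasFDerivAt_id (z p)).congr_of_eventuallyEq (by
        filter_upwards [z.open_target.mem_nhds (z.map_source hp)] with y hy using z.right_inv hy)
    exact congrArg (fun T : ℂ →L[ℂ] ℂ => T w) (h1.unique h2)
  · have h1 : HasMFDerivAt 𝓘(ℂ, ℂ) 𝓘(ℂ, ℂ) (z.symm ∘ z) p (S.comp Z) :=
      HasMFDerivAt.comp (M := M) p hS hZ
    have h2 : HasMFDerivAt 𝓘(ℂ, ℂ) 𝓘(ℂ, ℂ) (z.symm ∘ z) p (ContinuousLinearMap.id ℂ ℂ) :=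
      (hasMFDerivAt_id (I := 𝓘(ℂ, ℂ)) p).congr_of_eventuallyEq (by
        filter_upwards [z.open_source.mem_nhds hp] with y hy using z.left_inv hy)
    have h3 : S.comp Z = ContinuousLinearMap.id ℂ ℂ := hasMFDerivAt_unique h1 h2
    exact congrArg (fun T : ℂ →L[ℂ] ℂ => T w) h3

theorem coordVec_mfderiv (hz : z ∈ IsManifold.maximalAtlas 𝓘(ℂ, ℂ) ω M) {p : M}
    (hp : p ∈ z.source) (v : TangentSpace 𝓘(ℝ, ℂ) p) :
    coordVec z (mfderiv 𝓘(ℝ, ℂ) 𝓘(ℝ, ℂ) z p v : ℂ) p = v := by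
  obtain ⟨Z, S, hZc, hSc, -, h⟩ := exists_mfderiv_coord hz hp
  have hZ := hasMFDerivAt_restrictScalars hZc
  have hS := hasMFDerivAt_restrictScalars hSc
  unfold coordVec
  rw [hZ.mfderiv, hS.mfderiv]
  exact h v

theorem mcForm_coordVec (hz : z ∈ IsManifold.maximalAtlas 𝓘(ℂ, ℂ) ω M) {p : M}
    (hp : p ∈ z.source) {f : M → G} (hf : MDifferentiableAt 𝓘(ℝ, ℂ) 𝓘(ℝ, E) f p) (w : ℂ) :
    (mcForm (E := E) f p (coordVec z w p) : E) = logDer (E := E) (inCoord z f) (z p) w := by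
  obtain ⟨Z, S, hZc, hSc, -, h⟩ := exists_mfderiv_coord hz hp
  have hZ := hasMFDerivAt_restrictScalars hZc
  have hS := hasMFDerivAt_restrictScalars hSc
  obtain ⟨D, hD⟩ : ∃ D : ℂ →L[ℝ] E, HasMFDerivAt 𝓘(ℝ, ℂ) 𝓘(ℝ, E) f p D := ⟨_, hf.hasMFDerivAt⟩
  have hD' : HasMFDerivAt 𝓘(ℝ, ℂ) 𝓘(ℝ, E) f (z.symm (z p)) D := by rwa [z.left_inv hp]
  have h1 := hasLogDeriv_of_hasMFDerivAt (HasMFDerivAt.comp (M := ℂ) (z p) hD' hS)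
  have h2 : logDer (E := E) (inCoord z f) (z p) =
      ((mcE E (f (z.symm (z p)))).restrictScalars ℝ).comp (D.comp (S.restrictScalars ℝ)) := h1.logDer
  rw [h2, z.left_inv hp]
  unfold mcForm coordVec
  rw [hD.mfderiv, hS.mfderiv]
  rfl

theorem dFun_coordVec (hz : z ∈ IsManifold.maximalAtlas 𝓘(ℂ, ℂ) ω M) {p : M}
    (hp : p ∈ z.source) {f : M → E} {L : ℂ →L[ℝ] E}
    (hf : HasFDerivAt (inCoord z f) L (z p)) (w : ℂ) :
    (dFun (E := E) (G := G) f p (coordVec z w p) : E) = L w := by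
  obtain ⟨Z, S, hZc, hSc, h, -⟩ := exists_mfderiv_coord hz hp
  have hZ := hasMFDerivAt_restrictScalars hZc
  have hS := hasMFDerivAt_restrictScalars hSc
  have h1 := HasMFDerivAt.comp (M := M) p (hasMFDerivAt_iff_hasFDerivAt.2 hf) hZ
  have h2 : HasMFDerivAt 𝓘(ℝ, ℂ) 𝓘(ℝ, E) f p (L.comp (Z.restrictScalars ℝ)) :=
    h1.congr_of_eventuallyEq (by
      filter_upwards [z.open_source.mem_nhds hp] with y hy
      simp [inCoord, z.left_inv hy])
  have h3 : mfderiv 𝓘(ℝ, ℂ) 𝓘(ℝ, E) f p = L.comp (Z.restrictScalars ℝ) := h2.mfderiv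
  unfold dFun coordVec
  rw [hS.mfderiv]
  refine (congrArg (fun T : ℂ →L[ℝ] E => T (S w)) h3).trans ?_
  exact congrArg L (h w)

theorem dzComp_mcForm (hz : z ∈ IsManifold.maximalAtlas 𝓘(ℂ, ℂ) ω M) {p : M}
    (hp : p ∈ z.source) {f : M → G} (hf : MDifferentiableAt 𝓘(ℝ, ℂ) 𝓘(ℝ, E) f p) :
    (dzComp (E := E) z (mcForm f) p : E) = wirt (E := E) Complex.I (logDer (E := E) (inCoord z f) (z p)) := by
  have h1 := mcForm_coordVec hz hp hf 1
  have h2 := mcForm_coordVec hz hp hf Complex.I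
  exact (congrArg₂ (fun a b : E => (1 / 2 : ℂ) • (a - Complex.I • b)) h1 h2).trans
    (wirt_apply _ _).symm

theorem dzbarComp_mcForm (hz : z ∈ IsManifold.maximalAtlas 𝓘(ℂ, ℂ) ω M) {p : M}
    (hp : p ∈ z.source) {f : M → G} (hf : MDifferentiableAt 𝓘(ℝ, ℂ) 𝓘(ℝ, E) f p) :
    (dzbarComp (E := E) z (mcForm f) p : E) = wirt (E := E) (-Complex.I) (logDer (E := E) (inCoord z f) (z p)) := by
  have h1 := mcForm_coordVec hz hp hf 1
  have h2 := mcForm_coordVec hz hp hf Complex.I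
  refine (congrArg₂ (fun a b : E => (1 / 2 : ℂ) • (a + Complex.I • b)) h1 h2).trans ?_
  rw [wirt_apply, neg_smul, sub_neg_eq_add]

theorem dz_eq (hz : z ∈ IsManifold.maximalAtlas 𝓘(ℂ, ℂ) ω M) {p : M}
    (hp : p ∈ z.source) {f : M → E} {F : ℂ → E} (e : inCoord z f =ᶠ[𝓝 (z p)] F)
    (hF : DifferentiableAt ℝ F (z p)) :
    (dz (E := E) (G := G) z f p : E) = wirt Complex.I (fderiv ℝ F (z p)) := by
  have hf := hF.hasFDerivAt.congr_of_eventuallyEq e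
  have h1 := dFun_coordVec (G := G) hz hp hf 1
  have h2 := dFun_coordVec (G := G) hz hp hf Complex.I
  exact (congrArg₂ (fun a b : E => (1 / 2 : ℂ) • (a - Complex.I • b)) h1 h2).trans
    (wirt_apply _ _).symm

theorem dzbar_eq (hz : z ∈ IsManifold.maximalAtlas 𝓘(ℂ, ℂ) ω M) {p : M}
    (hp : p ∈ z.source) {f : M → E} {F : ℂ → E} (e : inCoord z f =ᶠ[𝓝 (z p)] F)
    (hF : DifferentiableAt ℝ F (z p)) :
    (dzbar (E := E) (G := G) z f p : E) = wirt (-Complex.I) (fderiv ℝ F (z p)) := by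
  have hf := hF.hasFDerivAt.congr_of_eventuallyEq e
  have h1 := dFun_coordVec (G := G) hz hp hf 1
  have h2 := dFun_coordVec (G := G) hz hp hf Complex.I
  refine (congrArg₂ (fun a b : E => (1 / 2 : ℂ) • (a + Complex.I • b)) h1 h2).trans ?_
  rw [wirt_apply, neg_smul, sub_neg_eq_add]

theorem formOf_coordVec (hz : z ∈ IsManifold.maximalAtlas 𝓘(ℂ, ℂ) ω M) {p : M}
    (hp : p ∈ z.source) (A B : M → E) (w : ℂ) :
    (formOf (E := E) (G := G) z A B p (coordVec z w p) : E) =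
      w • A p + (starRingEnd ℂ w) • B p := by
  obtain ⟨Z, S, hZc, hSc, h, -⟩ := exists_mfderiv_coord hz hp
  have hZ := hasMFDerivAt_restrictScalars hZc
  have hS := hasMFDerivAt_restrictScalars hSc
  have h1 : (mfderiv 𝓘(ℝ, ℂ) 𝓘(ℝ, ℂ) z p (coordVec z w p) : ℂ) = w := by
    unfold coordVec
    rw [hZ.mfderiv, hS.mfderiv]
    exact h w
  unfold formOf
  exact congrArg (fun u : ℂ => u • A p + (starRingEnd ℂ u) • B p) h1

end Coordinates

/-! ### Holomorphic and antiholomorphic mappings to the group -/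

section Holomorphic

variable {E : Type*} [NormedAddCommGroup E] [NormedSpace ℂ E]
  {G : Type*} [TopologicalSpace G] [ChartedSpace E G] [Group G] [LieGroup 𝓘(ℂ, E) ω G]
  [FiniteDimensional ℂ E] [CompleteSpace E] [T2Space G]
  {M : Type*} [TopologicalSpace M] [ChartedSpace ℂ M] [IsManifold 𝓘(ℂ, ℂ) ω M]
  {z : OpenPartialHomeomorph M ℂ}

theorem contMDiffAt_of_coord (hz : z ∈ IsManifold.maximalAtlas 𝓘(ℂ, ℂ) ω M) {p : M}
    (hp : p ∈ z.source) {f : ℂ → G} (hf : ContMDiffAt 𝓘(ℝ, ℂ) 𝓘(ℝ, E) ∞ f (z p)) :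
    ContMDiffAt 𝓘(ℝ, ℂ) 𝓘(ℝ, E) ∞ (fun q => f (z q)) p :=
  ContMDiffAt.comp (I' := 𝓘(ℝ, ℂ)) p hf (contMDiffAt_coord hz hp)

theorem contMDiffAt_of_inCoord (hz : z ∈ IsManifold.maximalAtlas 𝓘(ℂ, ℂ) ω M) {p : M}
    (hp : p ∈ z.source) {f : M → G} (hf : ContMDiffAt 𝓘(ℝ, ℂ) 𝓘(ℝ, E) ∞ (inCoord z f) (z p)) :
    ContMDiffAt 𝓘(ℝ, ℂ) 𝓘(ℝ, E) ∞ f p := by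
  refine (contMDiffAt_of_coord hz hp hf).congr_of_eventuallyEq ?_
  filter_upwards [z.open_source.mem_nhds hp] with q hq
  simp [inCoord, z.left_inv hq]

/-- A holomorphic mapping to `G` is smooth, and its Maurer-Cartan form is of type `(1, 0)`. -/
theorem contMDiffAt_of_holomorphicOn (hz : z ∈ IsManifold.maximalAtlas 𝓘(ℂ, ℂ) ω M) {W : Set M}
    (hW : IsOpen W) (hWz : W ⊆ z.source) {γ : M → G}
    (hγ : MDifferentiableOn 𝓘(ℂ, ℂ) 𝓘(ℂ, E) γ W) {p : M} (hp : p ∈ W) :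
    ContMDiffAt 𝓘(ℝ, ℂ) 𝓘(ℝ, E) ∞ γ p ∧
      wirt (-Complex.I) (logDer (E := E) (inCoord z γ) (z p)) = 0 := by
  have key : ∀ q ∈ W, ∃ X : E, HasLogDeriv (inCoord z γ) (spanC X) (z q) := by
    intro q hq
    obtain ⟨Z, S, hZ, hS, -, -⟩ := exists_mfderiv_coord hz (hWz hq)
    obtain ⟨D, hD⟩ : ∃ D : ℂ →L[ℂ] E, HasMFDerivAt 𝓘(ℂ, ℂ) 𝓘(ℂ, E) γ (z.symm (z q)) D :=
      ⟨_, by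
        rw [z.left_inv (hWz hq)]
        exact ((hγ q hq).mdifferentiableAt (hW.mem_nhds hq)).hasMFDerivAt⟩
    have h1 : HasMFDerivAt 𝓘(ℝ, ℂ) 𝓘(ℝ, E) (inCoord z γ) (z q) ((D.comp S).restrictScalars ℝ) :=
      hasMFDerivAt_restrictScalars (L := D.comp S) (HasMFDerivAt.comp (M := ℂ) (z q) hD hS)
    have h2 := hasLogDeriv_of_hasMFDerivAt h1
    refine ⟨mcE E (γ (z.symm (z q))) (D (S 1)), ?_⟩
    convert h2 using 1
    refine ContinuousLinearMap.ext fun w => ?_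
    have e : S w = w * S 1 := by rw [← smul_eq_mul, ← map_smul, smul_eq_mul, mul_one]
    have e2 : D (w * S 1) = w • D (S 1) := by
      rw [← smul_eq_mul, map_smul]
    change w • mcE E (γ (z.symm (z q))) (D (S 1)) = mcE E (γ (z.symm (z q))) (D (S w))
    rw [e, e2, map_smul]
  constructor
  · refine contMDiffAt_of_inCoord hz (hWz hp) (contMDiffAt_of_hasLogDeriv_spanC ?_)
    filter_upwards [(z.isOpen_inter_preimage_symm hW).mem_nhds
      ⟨z.map_source (hWz hp), by simpa [z.left_inv (hWz hp)] using hp⟩] with x hx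
    have := key _ hx.2
    rwa [z.right_inv hx.1] at this
  · obtain ⟨X, hX⟩ := key p hp
    rw [hX.logDer]
    exact wirt_neg_eq_zero (Or.inl rfl) (by simp)

/-- An antiholomorphic mapping to `G` is smooth, and its Maurer-Cartan form is of type `(0, 1)`. -/
theorem contMDiffAt_of_antiholomorphicOn (hz : z ∈ IsManifold.maximalAtlas 𝓘(ℂ, ℂ) ω M) {W : Set M}
    (hW : IsOpen W) (hWz : W ⊆ z.source) {γ : M → G} (hγ : AntiholomorphicOn (E := E) γ W) {p : M}
    (hp : p ∈ W) : ContMDiffAt 𝓘(ℝ, ℂ) 𝓘(ℝ, E) ∞ γ p ∧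
      wirt Complex.I (logDer (E := E) (inCoord z γ) (z p)) = 0 := by
  have key : ∀ q ∈ W, ∃ X : E,
      HasLogDeriv (inCoord z γ) ((spanC X).comp Complex.conjCLE.toContinuousLinearMap) (z q) := by
    intro q hq
    obtain ⟨Z, S, hZ, hS, -, -⟩ := exists_mfderiv_coord hz (hWz hq)
    obtain ⟨D, hD, hDI⟩ : ∃ D : ℂ →L[ℝ] E, HasMFDerivAt 𝓘(ℝ, ℂ) 𝓘(ℝ, E) γ (z.symm (z q)) D ∧
        ∀ w : ℂ, D (Complex.I * w) = -(Complex.I • D w) := by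
      rw [z.left_inv (hWz hq)]
      exact ⟨_, ((hγ.1 q hq).mdifferentiableAt (hW.mem_nhds hq)).hasMFDerivAt, hγ.2 q hq⟩
    have h1 : HasMFDerivAt 𝓘(ℝ, ℂ) 𝓘(ℝ, E) (inCoord z γ) (z q) (D.comp (S.restrictScalars ℝ)) :=
      HasMFDerivAt.comp (M := ℂ) (z q) hD (hasMFDerivAt_restrictScalars hS)
    have h2 := hasLogDeriv_of_hasMFDerivAt h1
    refine ⟨mcE E (γ (z.symm (z q))) (D (S 1)), ?_⟩
    convert h2 using 1
    refine ContinuousLinearMap.ext fun w => ?_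
    have e : S w = w * S 1 := by rw [← smul_eq_mul, ← map_smul, smul_eq_mul, mul_one]
    have e2 : D (w * S 1) = (starRingEnd ℂ w) • D (S 1) := by
      have h3 : w * S 1 = w.re • S 1 + w.im • (Complex.I * S 1) := by
        conv_lhs => rw [← Complex.re_add_im w]
        simp only [Complex.real_smul]
        ring
      have h4 : (starRingEnd ℂ) w = w.re - w.im * Complex.I := by
        apply Complex.ext <;> simp
      rw [h3, map_add, map_smul, map_smul, hDI, h4, sub_smul, mul_smul, Complex.coe_smul,
        Complex.coe_smul, smul_neg, sub_eq_add_neg]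
    change (starRingEnd ℂ w) • mcE E (γ (z.symm (z q))) (D (S 1)) =
      mcE E (γ (z.symm (z q))) (D (S w))
    rw [e, e2, map_smul]
  constructor
  · refine contMDiffAt_of_inCoord hz (hWz hp) ?_
    have h1 : ContMDiffAt 𝓘(ℝ, ℂ) 𝓘(ℝ, E) ∞ (fun x => inCoord z γ (Complex.conjCLE x))
        (Complex.conjCLE (z p)) := by
      refine contMDiffAt_of_hasLogDeriv_spanC ?_
      have hpx : z p ∈ z.target ∩ z.symm ⁻¹' W :=
        ⟨z.map_source (hWz hp), by simpa [z.left_inv (hWz hp)] using hp⟩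
      have hc : ContinuousAt Complex.conjCLE (Complex.conjCLE (z p)) :=
        Complex.conjCLE.continuous.continuousAt
      have hc' := hc.eventually ((z.isOpen_inter_preimage_symm hW).mem_nhds (by simpa using hpx))
      filter_upwards [hc'] with x hx
      obtain ⟨X, hX⟩ := key _ hx.2
      rw [z.right_inv hx.1] at hX
      refine ⟨X, ?_⟩
      convert hX.comp (u := Complex.conjCLE) Complex.conjCLE.toContinuousLinearMap.hasFDerivAt
        using 1
      ext w
      simp
    have h2 : ContMDiffAt 𝓘(ℝ, ℂ) 𝓘(ℝ, ℂ) ∞ Complex.conjCLE (z p) :=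
      Complex.conjCLE.contDiff.contMDiff.contMDiffAt
    have h3 := ContMDiffAt.comp (I' := 𝓘(ℝ, ℂ)) (z p) h1 h2
    refine h3.congr_of_eventuallyEq (Eventually.of_forall fun x => ?_)
    simp
  · obtain ⟨X, hX⟩ := key p hp
    rw [hX.logDer]
    have := wirt_neg_eq_zero (c := -Complex.I)
      (L := (spanC X).comp Complex.conjCLE.toContinuousLinearMap) (Or.inr rfl) (by simp)
    rwa [neg_neg] at this

theorem holomorphic_of_coord (hz : z ∈ IsManifold.maximalAtlas 𝓘(ℂ, ℂ) ω M) {p : M}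
    (hp : p ∈ z.source) {γ : ℂ → G} (hγ : MDifferentiableAt 𝓘(ℝ, ℂ) 𝓘(ℝ, E) γ (z p))
    (h : wirt (-Complex.I) (logDer (E := E) γ (z p)) = 0) :
    MDifferentiableAt 𝓘(ℂ, ℂ) 𝓘(ℂ, E) (fun q => γ (z q)) p := by
  obtain ⟨Z, S, hZ, hS, -, -⟩ := exists_mfderiv_coord hz hp
  have h1 := (hasLogDeriv_of_mdifferentiableAt hγ).hasMFDerivAt
  set X := wirt Complex.I (logDer (E := E) γ (z p))
  have e : logDer (E := E) γ (z p) = spanC X := by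
    ext w
    rw [apply_eq_wirt, h, smul_zero, add_zero]
    rfl
  rw [e] at h1
  have h2 : HasMFDerivAt 𝓘(ℂ, ℂ) 𝓘(ℂ, E) γ (z p)
      ((leftE E (γ (z p))).comp (ContinuousLinearMap.toSpanSingleton ℂ X)) :=
    hasMFDerivAt_of_restrictScalars (F := ℂ)
      (L := (leftE E (γ (z p))).comp (ContinuousLinearMap.toSpanSingleton ℂ X)) h1
  exact (HasMFDerivAt.comp (M := M) p h2 hZ).mdifferentiableAt

theorem antiholomorphic_of_coord (hz : z ∈ IsManifold.maximalAtlas 𝓘(ℂ, ℂ) ω M) {p : M}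
    (hp : p ∈ z.source) {γ : ℂ → G} (hγ : MDifferentiableAt 𝓘(ℝ, ℂ) 𝓘(ℝ, E) γ (z p))
    (h : wirt Complex.I (logDer (E := E) γ (z p)) = 0) :
    MDifferentiableAt 𝓘(ℝ, ℂ) 𝓘(ℝ, E) (fun q => γ (z q)) p ∧
      let L : ℂ →L[ℝ] E := mfderiv 𝓘(ℝ, ℂ) 𝓘(ℝ, E) (fun q => γ (z q)) p
      ∀ w : ℂ, L (Complex.I * w) = -(Complex.I • L w) := by
  obtain ⟨Z, S, hZ, hS, -, -⟩ := exists_mfderiv_coord hz hp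
  have h1 := (hasLogDeriv_of_mdifferentiableAt hγ).hasMFDerivAt
  have h2 : HasMFDerivAt 𝓘(ℝ, ℂ) 𝓘(ℝ, E) (fun q => γ (z q)) p
      ((((leftE E (γ (z p))).restrictScalars ℝ).comp (logDer (E := E) γ (z p))).comp
        (Z.restrictScalars ℝ)) :=
    HasMFDerivAt.comp (M := M) p h1 (hasMFDerivAt_restrictScalars hZ)
  refine ⟨h2.mdifferentiableAt, ?_⟩
  rw [h2.mfderiv]
  intro L w
  have h3 := apply_I_mul_of_wirt_neg_eq_zero (c := -Complex.I) (Or.inr rfl)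
    (by rwa [neg_neg]) (Z w)
  have e : Z (Complex.I * w) = Complex.I * Z w := by rw [← smul_eq_mul, map_smul, smul_eq_mul]
  change leftE E (γ (z p)) (logDer (E := E) γ (z p) (Z (Complex.I * w))) =
    -(Complex.I • leftE E (γ (z p)) (logDer (E := E) γ (z p) (Z w)))
  rw [e, h3, map_smul, neg_smul]

end Holomorphic

/-! ### Lifts for the Gauss factors -/

section GaussLift

variable {E : Type*} [NormedAddCommGroup E] [NormedSpace ℂ E]
  {G : Type*} [TopologicalSpace G] [ChartedSpace E G] [Group G] [LieGroup 𝓘(ℂ, E) ω G]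
  [FiniteDimensional ℂ E] [CompleteSpace E] [T2Space G] {gr : ℤ → Submodule ℂ E}
  [LieAlgebra.IsSemisimple ℂ (GroupLieAlgebra 𝓘(ℂ, E) G)]

/-- The Gauss factor `μ` of an admissible mapping `φ = μ β` has a Maurer-Cartan form of only one
type, whose coefficient has a lift to `H̃`.  With `c = √-1` this is used for `μ₋`, and with `c = -√-1`
for `μ₊`. -/
theorem exists_gauss_lift (hgr : IsGradation (E := E) (G := G) gr) {P Q : Set ℤ}
    (hPQ : IsTriangular P Q) {φ μ β : ℂ → G} {x₀ : ℂ} {U : Set ℂ} (hU : IsOpen U) (hx₀ : x₀ ∈ U)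
    (hμ : ∀ y ∈ U, ContMDiffAt 𝓘(ℝ, ℂ) 𝓘(ℝ, E) ∞ μ y)
    (hβ : ∀ y ∈ U, MDifferentiableAt 𝓘(ℝ, ℂ) 𝓘(ℝ, E) β y)
    {g : G} (hμP : ∀ y ∈ U, g⁻¹ * μ y ∈ gradGroup G gr P)
    (hβQ : ∀ y ∈ U, β y ∈ gradGroup G gr (Q ∪ {0})) (hφ : ∀ y ∈ U, φ y = μ y * β y)
    {c : ℂ} (hc : c = Complex.I ∨ c = -Complex.I)
    (h0 : ∀ y ∈ U, wirt (-c) (logDer (E := E) φ y) ∈ gradSum gr (Q ∪ {0}))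
    {m : ℤ} (hm : m ∈ P) {X : E} (hX : X ∈ gr m)
    (horb : ∀ y ∈ U, ∃ h ∈ gradGroup G gr {0},
      wirt c (logDer (E := E) φ y) - adE E (β y)⁻¹ (adE E h X) ∈ gradSum gr (Q ∪ {0})) :
    ∃ γ : ℂ → G, (∀ y, γ y ∈ gradGroup G gr {0}) ∧ ∀ᶠ y in 𝓝 x₀,
      ContMDiffAt 𝓘(ℝ, ℂ) 𝓘(ℝ, E) ∞ γ y ∧ wirt (-c) (logDer (E := E) γ y) = 0 ∧
      wirt c (logDer (E := E) μ y) = Complex.I • adE E (γ y) X := by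
  have hφ' : ∀ y ∈ U, logDer (E := E) φ y = logDer (E := E) (fun y => μ y * β y) y :=
    fun y hy => logDer_congr (by filter_upwards [hU.mem_nhds hy] with w hw using hφ w hw)
  refine exists_lift_of_component hgr hc ?_ ?_ (m := m) ?_ hX ?_
  · filter_upwards [hU.mem_nhds hx₀] with y hy using hμ y hy
  · filter_upwards [hU.mem_nhds hx₀] with y hy
    refine wirt_logDer_left_eq hgr hPQ (hU.mem_nhds hy) ((hμ y hy).mdifferentiableAt (by simp))
      (hβ y hy) hμP hβQ (Submodule.zero_mem _) ?_
    rw [map_zero, sub_zero, ← hφ' y hy]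
    exact h0 y hy
  · rintro rfl
    exact hPQ.zero_left hm
  · filter_upwards [hU.mem_nhds hx₀] with y hy
    obtain ⟨h, hh, hy'⟩ := horb y hy
    refine ⟨h, hh, wirt_logDer_left_eq hgr hPQ (hU.mem_nhds hy)
      ((hμ y hy).mdifferentiableAt (by simp)) (hβ y hy) hμP hβQ ?_ ?_⟩
    · have := hgr.adE_mem (T := {m}) (by simp) hh (y := X) (by rwa [gradSum_singleton])
      exact gradSum_mono (singleton_subset_iff.2 hm) this
    · rw [← hφ' y hy]
      exact hy'

end GaussLift

/-! ### The groups of the gradation -/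

section Groups

variable {E : Type*} [NormedAddCommGroup E] [NormedSpace ℂ E]
  {G : Type*} [TopologicalSpace G] [ChartedSpace E G] [Group G] [LieGroup 𝓘(ℂ, E) ω G]
  [FiniteDimensional ℂ E] [CompleteSpace E] (gr : ℤ → Submodule ℂ E)

theorem bPlus_eq : bPlus (E := E) (G := G) gr = gradSum gr ({m | 0 < m} ∪ {0}) := by
  have e : ({m | 0 < m} ∪ {0} : Set ℤ) = {m | 0 ≤ m} := by
    ext m
    simp [le_iff_lt_or_eq, eq_comm]
    try tauto
  rw [e]
  rfl

theorem bMinus_eq : bMinus (E := E) (G := G) gr = gradSum gr ({m | m < 0} ∪ {0}) := by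
  have e : ({m | m < 0} ∪ {0} : Set ℤ) = {m | m ≤ 0} := by
    ext m
    simp [le_iff_lt_or_eq]
    try tauto
  rw [e]
  rfl

theorem NPlus_eq : NPlus (E := E) (G := G) gr = gradGroup G gr {m | 0 < m} := rfl

theorem NMinus_eq : NMinus (E := E) (G := G) gr = gradGroup G gr {m | m < 0} := rfl

theorem BPlus_eq : BPlus (E := E) (G := G) gr = gradGroup G gr ({m | 0 < m} ∪ {0}) :=
  congrArg (connectedSubgroup (E := E) (G := G)) (bPlus_eq (G := G) gr)

theorem BMinus_eq : BMinus (E := E) (G := G) gr = gradGroup G gr ({m | m < 0} ∪ {0}) :=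
  congrArg (connectedSubgroup (E := E) (G := G)) (bMinus_eq (G := G) gr)

theorem HTilde_eq : HTilde (E := E) (G := G) gr = gradGroup G gr {0} :=
  congrArg (connectedSubgroup (E := E) (G := G)) (gradSum_singleton (gr := gr) 0).symm

end Groups

/-! ### The curvature of the Toda connection -/

section TodaCurvature

variable {E : Type*} [NormedAddCommGroup E] [NormedSpace ℂ E]
  {G : Type*} [TopologicalSpace G] [ChartedSpace E G] [Group G] [LieGroup 𝓘(ℂ, E) ω G]
  [FiniteDimensional ℂ E] [CompleteSpace E] [T2Space G]
  {M : Type*} [TopologicalSpace M] [ChartedSpace ℂ M] [IsManifold 𝓘(ℂ, ℂ) ω M]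
  {z : OpenPartialHomeomorph M ℂ}

theorem eventually_inCoord {W : Set M} (hW : IsOpen W) {p : M} (hp : p ∈ W)
    (hpz : p ∈ z.source) : ∀ᶠ y in 𝓝 (z p), y ∈ z.target ∧ z.symm y ∈ W :=
  (z.isOpen_inter_preimage_symm hW).mem_nhds
    ⟨z.map_source hpz, by simpa [z.left_inv hpz] using hp⟩

theorem inCoord_dzComp_mcForm (hz : z ∈ IsManifold.maximalAtlas 𝓘(ℂ, ℂ) ω M) {W : Set M}
    (hW : IsOpen W) {γ : M → G} (hγ : ContMDiffOn 𝓘(ℝ, ℂ) 𝓘(ℝ, E) ∞ γ W) {p : M} (hp : p ∈ W)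
    (hpz : p ∈ z.source) :
    inCoord (Y := E) z (dzComp (E := E) z (mcForm γ)) =ᶠ[𝓝 (z p)]
      fun y => wirt (E := E) Complex.I (logDer (E := E) (inCoord z γ) y) := by
  filter_upwards [eventually_inCoord hW hp hpz] with y hy
  have h := dzComp_mcForm hz (z.map_target hy.1)
    ((hγ.contMDiffAt (hW.mem_nhds hy.2)).mdifferentiableAt (by simp))
  rw [z.right_inv hy.1] at h
  exact h

theorem dzbar_dzComp_mcForm (hz : z ∈ IsManifold.maximalAtlas 𝓘(ℂ, ℂ) ω M) {W : Set M}
    (hW : IsOpen W) {γ : M → G} (hγ : ContMDiffOn 𝓘(ℝ, ℂ) 𝓘(ℝ, E) ∞ γ W) {p : M} (hp : p ∈ W)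
    (hpz : p ∈ z.source) :
    (dzbar (E := E) z (dzComp z (mcForm γ)) p : E) = wirt (E := E) (-Complex.I)
      (fderiv ℝ (fun y => wirt (E := E) Complex.I (logDer (E := E) (inCoord z γ) y)) (z p)) := by
  have e := inCoord_dzComp_mcForm hz hW hγ hp hpz
  have hs : ContMDiffAt 𝓘(ℝ, ℂ) 𝓘(ℝ, E) ∞ (inCoord z γ) (z p) :=
    contMDiffAt_inCoord hz (z.map_source hpz) (by
      rw [z.left_inv hpz]; exact hγ.contMDiffAt (hW.mem_nhds hp))
  have hd : DifferentiableAt ℝ (fun y => wirt (E := E) Complex.I (logDer (E := E) (inCoord z γ) y)) (z p) :=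
    ((wirt (E := E) Complex.I).contDiff.contDiffAt.comp _
      (contDiffAt_logDer hs)).differentiableAt (by simp)
  exact dzbar_eq (G := G) hz hpz e hd

/-- The curvature of the Toda connection is the difference of the two sides of the Toda equation. -/
theorem curvature_toda (hz : z ∈ IsManifold.maximalAtlas 𝓘(ℂ, ℂ) ω M) {W : Set M}
    (hW : IsOpen W) {γ : M → G} (hγ : ContMDiffOn 𝓘(ℝ, ℂ) 𝓘(ℝ, E) ∞ γ W) {p : M} (hp : p ∈ W)
    (hpz : p ∈ z.source) (xm xp : GroupLieAlgebra 𝓘(ℂ, E) G) :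
    dz z (todaPlus xp γ) p - dzbar z (todaMinus z xm γ) p +
      ⁅todaMinus z xm γ p, todaPlus xp γ p⁆ =
    ⁅Ad (γ p)⁻¹ xp, xm⁆ - dzbar z (dzComp z (mcForm γ)) p := by
  have e := inCoord_dzComp_mcForm hz hW hγ hp hpz
  have hs : ContMDiffAt 𝓘(ℝ, ℂ) 𝓘(ℝ, E) ∞ (inCoord z γ) (z p) :=
    contMDiffAt_inCoord hz (z.map_source hpz) (by
      rw [z.left_inv hpz]; exact hγ.contMDiffAt (hW.mem_nhds hp))
  have hd : DifferentiableAt ℝ (fun y => wirt (E := E) Complex.I (logDer (E := E) (inCoord z γ) y)) (z p) :=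
    ((wirt (E := E) Complex.I).contDiff.contDiffAt.comp _
      (contDiffAt_logDer hs)).differentiableAt (by simp)
  let xm' : E := xm
  let xp' : E := xp
  have em : inCoord (Y := E) z (todaMinus z xm γ) =ᶠ[𝓝 (z p)]
      fun y => Complex.I • xm' + wirt (E := E) Complex.I (logDer (E := E) (inCoord z γ) y) := by
    filter_upwards [e] with y hy
    exact congrArg (fun X : E => Complex.I • xm' + X) hy
  have ep : inCoord (Y := E) z (todaPlus xp γ) =
      fun y => Complex.I • adE E (inCoord z γ y)⁻¹ xp' := by
    funext y
    exact congrArg (fun X : E => Complex.I • X) (Ad_eq_adE (γ (z.symm y))⁻¹ xp')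
  have hdp : DifferentiableAt ℝ (fun y => Complex.I • adE E (inCoord z γ y)⁻¹ xp') (z p) := by
    have h1 := (hasLogDeriv_of_mdifferentiableAt (hs.mdifferentiableAt (by simp))).inv.adE xp'
    exact (h1.const_smul Complex.I).differentiableAt
  have h1 := dzbar_eq (G := G) hz hpz em (hd.const_add (Complex.I • xm'))
  have h2 := dz_eq (G := G) hz hpz ep.eventuallyEq hdp
  have h3 : @Eq E (todaMinus z xm γ p)
      (Complex.I • xm' + wirt (E := E) Complex.I (logDer (E := E) (inCoord z γ) (z p))) := by
    have := em.self_of_nhds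
    simpa only [inCoord, z.left_inv hpz] using this
  have h4 : @Eq E (todaPlus xp γ p) (Complex.I • adE E (inCoord z γ (z p))⁻¹ xp') := by
    have := congrFun ep (z p)
    simpa only [inCoord, z.left_inv hpz] using this
  have h5 : @Eq E (Ad (γ p)⁻¹ xp) (adE E (inCoord z γ (z p))⁻¹ xp') := by
    have e0 : inCoord z γ (z p) = γ p := congrArg γ (z.left_inv hpz)
    rw [e0]
    exact Ad_eq_adE (γ p)⁻¹ xp'
  have h6 := dzbar_dzComp_mcForm hz hW hγ hp hpz
  have key := toda_curvature hs xm' xp'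
  rw [← h1, ← h2, ← h3, ← h4, ← h5, ← h6] at key
  exact key

end TodaCurvature

/-! ### From Gauss data to the Toda equation -/

section GaussDataGauge

variable {E : Type*} [NormedAddCommGroup E] [NormedSpace ℂ E]
  {G : Type*} [TopologicalSpace G] [ChartedSpace E G] [Group G] [LieGroup 𝓘(ℂ, E) ω G]
  [FiniteDimensional ℂ E] [CompleteSpace E] [T2Space G]
  [LieAlgebra.IsSemisimple ℂ (GroupLieAlgebra 𝓘(ℂ, E) G)]
  {M : Type*} [TopologicalSpace M] [ChartedSpace ℂ M] [IsManifold 𝓘(ℂ, ℂ) ω M]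
  {z : OpenPartialHomeomorph M ℂ}

theorem contMDiffOn_mul {W : Set M} {f g : M → G} (hf : ContMDiffOn 𝓘(ℝ, ℂ) 𝓘(ℝ, E) ∞ f W)
    (hg : ContMDiffOn 𝓘(ℝ, ℂ) 𝓘(ℝ, E) ∞ g W) :
    ContMDiffOn 𝓘(ℝ, ℂ) 𝓘(ℝ, E) ∞ (fun q => f q * g q) W := hf.mul hg

/-- The gauge transform of `φ^* θ` by `ψ` is `(φ ψ)^* θ`. -/
theorem gaugeTransform_mcForm (hz : z ∈ IsManifold.maximalAtlas 𝓘(ℂ, ℂ) ω M) {φ ψ : M → G} {q : M}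
    (hq : q ∈ z.source) (hφ : ContMDiffAt 𝓘(ℝ, ℂ) 𝓘(ℝ, E) ∞ φ q)
    (hψ : ContMDiffAt 𝓘(ℝ, ℂ) 𝓘(ℝ, E) ∞ ψ q) (v : TangentSpace 𝓘(ℝ, ℂ) q) :
    gaugeTransform (E := E) ψ (mcForm φ) q v = mcForm (E := E) (fun r => φ r * ψ r) q v := by
  rw [← coordVec_mfderiv hz hq v]
  set w : ℂ := mfderiv 𝓘(ℝ, ℂ) 𝓘(ℝ, ℂ) z q v
  have dφ := hφ.mdifferentiableAt (by simp)
  have dψ := hψ.mdifferentiableAt (by simp)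
  have h1 := mcForm_coordVec hz hq ((hφ.mul hψ).mdifferentiableAt (by simp)) w
  have h2 := mcForm_coordVec hz hq dφ w
  have h3 := mcForm_coordVec hz hq dψ w
  have lφ : HasLogDeriv (inCoord z φ) (logDer (E := E) (inCoord z φ) (z q)) (z q) :=
    hasLogDeriv_of_mdifferentiableAt ((contMDiffAt_inCoord hz (z.map_source hq)
      (by rwa [z.left_inv hq])).mdifferentiableAt (by simp))
  have lψ : HasLogDeriv (inCoord z ψ) (logDer (E := E) (inCoord z ψ) (z q)) (z q) :=
    hasLogDeriv_of_mdifferentiableAt ((contMDiffAt_inCoord hz (z.map_source hq)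
      (by rwa [z.left_inv hq])).mdifferentiableAt (by simp))
  have h4 : logDer (E := E) (inCoord z (φ * ψ)) (z q) w =
      adE E (inCoord z ψ (z q))⁻¹ (logDer (E := E) (inCoord z φ) (z q) w) +
        logDer (E := E) (inCoord z ψ) (z q) w :=
    congrArg (fun L : ℂ →L[ℝ] E => L w) (lφ.mul lψ).logDer
  have e0 : inCoord z ψ (z q) = ψ q := congrArg ψ (z.left_inv hq)
  rw [e0, ← h2, ← h3] at h4
  refine Eq.trans ?_ (h4.symm.trans h1.symm)
  let X₁ : E := mcForm (E := E) φ q (coordVec z w q)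
  let X₂ : E := mcForm (E := E) ψ q (coordVec z w q)
  exact congrArg (fun X : E => X + X₂) (Ad_eq_adE (ψ q)⁻¹ X₁)

variable {gr : ℤ → Submodule ℂ E} {xm xp : E} {φ : M → G} {W : Set M} {gp gm : G}

theorem GaussData.smooth_γp (D : GaussData (E := E) gr xm xp φ z W gp gm)
    (hz : z ∈ IsManifold.maximalAtlas 𝓘(ℂ, ℂ) ω M) (hW : IsOpen W) (hWz : W ⊆ z.source) :
    ContMDiffOn 𝓘(ℝ, ℂ) 𝓘(ℝ, E) ∞ D.γp W := fun _ hq =>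
  (contMDiffAt_of_antiholomorphicOn hz hW hWz D.γp_antiholomorphic hq).1.contMDiffWithinAt

theorem GaussData.smooth_γm (D : GaussData (E := E) gr xm xp φ z W gp gm)
    (hz : z ∈ IsManifold.maximalAtlas 𝓘(ℂ, ℂ) ω M) (hW : IsOpen W) (hWz : W ⊆ z.source) :
    ContMDiffOn 𝓘(ℝ, ℂ) 𝓘(ℝ, E) ∞ D.γm W := fun _ hq =>
  (contMDiffAt_of_holomorphicOn hz hW hWz D.γm_holomorphic hq).1.contMDiffWithinAt

theorem GaussData.smooth_γ (D : GaussData (E := E) gr xm xp φ z W gp gm)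
    (hz : z ∈ IsManifold.maximalAtlas 𝓘(ℂ, ℂ) ω M) (hW : IsOpen W) (hWz : W ⊆ z.source) :
    ContMDiffOn 𝓘(ℝ, ℂ) 𝓘(ℝ, E) ∞ D.γ W :=
  (((D.smooth_γp hz hW hWz).inv.mul (D.smooth_ηm.mul D.smooth_ηp.inv)).mul
    (D.smooth_γm hz hW hWz))

/-- The gauge transformation `ψ = η₊⁻¹ γ₋` which takes `φ^* θ` to the Toda connection of `γ`. -/
def GaussData.ψ (D : GaussData (E := E) gr xm xp φ z W gp gm) (q : M) : G := (D.ηp q)⁻¹ * D.γm q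

theorem GaussData.smooth_ψ (D : GaussData (E := E) gr xm xp φ z W gp gm)
    (hz : z ∈ IsManifold.maximalAtlas 𝓘(ℂ, ℂ) ω M) (hW : IsOpen W) (hWz : W ⊆ z.source) :
    ContMDiffOn 𝓘(ℝ, ℂ) 𝓘(ℝ, E) ∞ D.ψ W :=
  D.smooth_ηp.inv.mul (D.smooth_γm hz hW hWz)

/-- The components of `(φ ψ)^* θ` are those of the Toda connection. -/
theorem GaussData.components (D : GaussData (E := E) gr xm xp φ z W gp gm)
    (hgr : IsGradation (E := E) (G := G) gr) (hxm : xm ∈ gr (-1)) (hxp : xp ∈ gr 1)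
    (hz : z ∈ IsManifold.maximalAtlas 𝓘(ℂ, ℂ) ω M) (hW : IsOpen W) (hWz : W ⊆ z.source)
    (hφ : ContMDiffOn 𝓘(ℝ, ℂ) 𝓘(ℝ, E) ∞ φ W) (hφg : GradingCondition (E := E) gr φ) {q : M}
    (hq : q ∈ W) :
    wirt (E := E) Complex.I (logDer (E := E) (inCoord z (fun r => φ r * D.ψ r)) (z q)) =
        (todaMinus z xm D.γ q : E) ∧
      wirt (E := E) (-Complex.I) (logDer (E := E) (inCoord z (fun r => φ r * D.ψ r)) (z q)) =
        (todaPlus xp D.γ q : E) := by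
  have hqz := hWz hq
  have sm : ∀ {f : M → G}, ContMDiffOn 𝓘(ℝ, ℂ) 𝓘(ℝ, E) ∞ f W →
      MDifferentiableAt 𝓘(ℝ, ℂ) 𝓘(ℝ, E) f q := fun hf =>
    (hf.contMDiffAt (hW.mem_nhds hq)).mdifferentiableAt (by simp)
  have sc : ∀ {f : M → G}, ContMDiffOn 𝓘(ℝ, ℂ) 𝓘(ℝ, E) ∞ f W →
      MDifferentiableAt 𝓘(ℝ, ℂ) 𝓘(ℝ, E) (inCoord z f) (z q) := fun hf =>
    (contMDiffAt_inCoord hz (z.map_source hqz) (by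
      rw [z.left_inv hqz]; exact hf.contMDiffAt (hW.mem_nhds hq))).mdifferentiableAt (by simp)
  have hγ := D.smooth_γ hz hW hWz
  have hφq := hφg z hz q hqz
  have e1 := dzComp_mcForm hz hqz (sm hφ)
  have e2 := dzbarComp_mcForm hz hqz (sm hφ)
  have e3 := dzComp_mcForm hz hqz (sm D.smooth_μm)
  have e4 := dzbarComp_mcForm hz hqz (sm D.smooth_μp)
  have e5 := dzComp_mcForm hz hqz (sm hγ)
  have e0 : ∀ f : M → G, inCoord z f (z q) = f q := fun f => congrArg f (z.left_inv hqz)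
  have lp : wirt (E := E) (-Complex.I) (logDer (E := E) (inCoord z D.μp) (z q)) =
      Complex.I • adE E (inCoord z D.γp (z q)) xp := by
    rw [e0]
    exact e4.symm.trans ((D.lift_plus q hq).trans
      (congrArg (fun X : E => Complex.I • X) (Ad_eq_adE (D.γp q) xp)))
  have lm : wirt (E := E) Complex.I (logDer (E := E) (inCoord z D.μm) (z q)) =
      Complex.I • adE E (inCoord z D.γm (z q)) xm := by
    rw [e0]
    exact e3.symm.trans ((D.lift_minus q hq).trans
      (congrArg (fun X : E => Complex.I • X) (Ad_eq_adE (D.γm q) xm)))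
  have key := wirt_logDer_gauge hgr (U := z.target ∩ z.symm ⁻¹' W)
    (z.isOpen_inter_preimage_symm hW) (x := z q)
    ⟨z.map_source hqz, by simpa [z.left_inv hqz] using hq⟩ hxm hxp (gp := gp) (gm := gm)
    (φ := inCoord z φ) (sc D.smooth_μp) (sc D.smooth_νm) (sc D.smooth_ηm) (sc D.smooth_μm)
    (sc D.smooth_νp) (sc D.smooth_ηp) (sc (D.smooth_γp hz hW hWz)) (sc (D.smooth_γm hz hW hWz))
    (fun y hy => D.μp_mem _ hy.2) (fun y hy => D.νm_mem _ hy.2)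
    (fun y hy => by rw [← HTilde_eq]; exact D.ηm_mem _ hy.2)
    (fun y hy => D.μm_mem _ hy.2) (fun y hy => D.νp_mem _ hy.2)
    (fun y hy => by rw [← HTilde_eq]; exact D.ηp_mem _ hy.2)
    (fun y hy => by rw [← HTilde_eq]; exact D.γp_mem _ hy.2)
    (fun y hy => by rw [← HTilde_eq]; exact D.γm_mem _ hy.2)
    (fun y hy => D.decomp_plus _ hy.2) (fun y hy => D.decomp_minus _ hy.2)
    (by rw [← e1]; exact hφq.1) (by rw [← e2]; exact hφq.2)
    (contMDiffAt_of_antiholomorphicOn hz hW hWz D.γp_antiholomorphic hq).2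
    (contMDiffAt_of_holomorphicOn hz hW hWz D.γm_holomorphic hq).2 lp lm
  refine ⟨key.1.trans ?_, key.2.trans ?_⟩
  · exact congrArg (fun X : E => Complex.I • xm + X) e5.symm
  · have h := Ad_eq_adE (E := E) (inCoord z D.γ (z q))⁻¹ xp
    rw [e0] at h
    refine (congrArg (fun X : E => Complex.I • X) ?_).trans
      (congrArg (fun X : E => Complex.I • X) h.symm)
    exact congrArg (fun g : G => adE E g⁻¹ xp) (e0 D.γ)

theorem GaussData.mcForm_mul_ψ (D : GaussData (E := E) gr xm xp φ z W gp gm)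
    (hgr : IsGradation (E := E) (G := G) gr) (hxm : xm ∈ gr (-1)) (hxp : xp ∈ gr 1)
    (hz : z ∈ IsManifold.maximalAtlas 𝓘(ℂ, ℂ) ω M) (hW : IsOpen W) (hWz : W ⊆ z.source)
    (hφ : ContMDiffOn 𝓘(ℝ, ℂ) 𝓘(ℝ, E) ∞ φ W) (hφg : GradingCondition (E := E) gr φ) {q : M}
    (hq : q ∈ W) (v : TangentSpace 𝓘(ℝ, ℂ) q) :
    mcForm (E := E) (fun r => φ r * D.ψ r) q v =
      formOf (E := E) z (todaMinus z xm D.γ) (todaPlus xp D.γ) q v := by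
  rw [← coordVec_mfderiv hz (hWz hq) v]
  set w : ℂ := mfderiv 𝓘(ℝ, ℂ) 𝓘(ℝ, ℂ) z q v
  have h1 := mcForm_coordVec hz (hWz hq) (((hφ.mul (D.smooth_ψ hz hW hWz)).contMDiffAt
    (hW.mem_nhds hq)).mdifferentiableAt (by simp)) w
  let A : M → E := todaMinus (E := E) z xm D.γ
  let B : M → E := todaPlus (E := E) xp D.γ
  have h2 := formOf_coordVec (G := G) hz (hWz hq) A B w
  obtain ⟨h3, h4⟩ := D.components hgr hxm hxp hz hW hWz hφ hφg hq
  refine h1.trans (Eq.trans ?_ h2.symm)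
  refine (apply_eq_wirt (E := E) _ w).trans ?_
  exact congrArg₂ (fun a b : E => w • a + (starRingEnd ℂ w) • b) h3 h4

/-- The Toda equation holds because its connection form is `(φ ψ)^* θ`, which has zero curvature. -/
theorem GaussData.toda (D : GaussData (E := E) gr xm xp φ z W gp gm)
    (hgr : IsGradation (E := E) (G := G) gr) (hxm : xm ∈ gr (-1)) (hxp : xp ∈ gr 1)
    (hz : z ∈ IsManifold.maximalAtlas 𝓘(ℂ, ℂ) ω M) (hW : IsOpen W) (hWz : W ⊆ z.source)
    (hφ : ContMDiffOn 𝓘(ℝ, ℂ) 𝓘(ℝ, E) ∞ φ W) (hφg : GradingCondition (E := E) gr φ) :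
    TodaEquation (E := E) z xm xp D.γ W := by
  intro q hq
  have hqz := hWz hq
  have hs : ContMDiffAt 𝓘(ℝ, ℂ) 𝓘(ℝ, E) ∞ (inCoord z (fun r => φ r * D.ψ r)) (z q) :=
    contMDiffAt_inCoord hz (z.map_source hqz) (by
      rw [z.left_inv hqz]
      exact (hφ.mul (D.smooth_ψ hz hW hWz)).contMDiffAt (hW.mem_nhds hq))
  have hd : ∀ c, DifferentiableAt ℝ (fun y => wirt (E := E) c
      (logDer (E := E) (inCoord z (fun r => φ r * D.ψ r)) y)) (z q) := fun c =>
    ((wirt (E := E) c).contDiff.contDiffAt.comp _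
      (contDiffAt_logDer hs)).differentiableAt (by simp)
  have em : inCoord (Y := E) z (todaMinus z xm D.γ) =ᶠ[𝓝 (z q)] fun y => wirt (E := E) Complex.I
      (logDer (E := E) (inCoord z (fun r => φ r * D.ψ r)) y) := by
    filter_upwards [eventually_inCoord hW hq hqz] with y hy
    have := (D.components hgr hxm hxp hz hW hWz hφ hφg hy.2).1
    rw [z.right_inv hy.1] at this
    exact this.symm
  have ep : inCoord (Y := E) z (todaPlus xp D.γ) =ᶠ[𝓝 (z q)] fun y => wirt (E := E) (-Complex.I)
      (logDer (E := E) (inCoord z (fun r => φ r * D.ψ r)) y) := by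
    filter_upwards [eventually_inCoord hW hq hqz] with y hy
    have := (D.components hgr hxm hxp hz hW hWz hφ hφg hy.2).2
    rw [z.right_inv hy.1] at this
    exact this.symm
  have h1 := dz_eq (G := G) hz hqz ep (hd _)
  have h2 := dzbar_eq (G := G) hz hqz em (hd _)
  obtain ⟨h3, h4⟩ := D.components hgr hxm hxp hz hW hWz hφ hφg hq
  have key := wirt_maurerCartan hs
  rw [← h1, ← h2, h3, h4] at key
  have key2 := curvature_toda hz hW (D.smooth_γ hz hW hWz) hq hqz xm xp
  exact (sub_eq_zero.1 (key2.symm.trans key)).symm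

end GaussDataGauge

/-! ### Existence of Gauss data -/

section GaussDataExistence

variable {E : Type*} [NormedAddCommGroup E] [NormedSpace ℂ E]
  {G : Type*} [TopologicalSpace G] [ChartedSpace E G] [Group G] [LieGroup 𝓘(ℂ, E) ω G]
  [FiniteDimensional ℂ E] [CompleteSpace E] [T2Space G]
  [LieAlgebra.IsSemisimple ℂ (GroupLieAlgebra 𝓘(ℂ, E) G)]
  {M : Type*} [TopologicalSpace M] [ChartedSpace ℂ M] [IsManifold 𝓘(ℂ, ℂ) ω M]
  {z : OpenPartialHomeomorph M ℂ} {gr : ℤ → Submodule ℂ E}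

/-- `exists_gauss_lift` for mappings defined on `M`. -/
theorem exists_gauss_lift_coord (hgr : IsGradation (E := E) (G := G) gr) {P Q : Set ℤ}
    (hPQ : IsTriangular P Q) (hz : z ∈ IsManifold.maximalAtlas 𝓘(ℂ, ℂ) ω M) {W : Set M}
    (hW : IsOpen W) (hWz : W ⊆ z.source) {p : M} (hp : p ∈ W) {φ μ β : M → G}
    (hμ : ContMDiffOn 𝓘(ℝ, ℂ) 𝓘(ℝ, E) ∞ μ W) (hβ : ContMDiffOn 𝓘(ℝ, ℂ) 𝓘(ℝ, E) ∞ β W) {g : G}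
    (hμP : ∀ q ∈ W, g⁻¹ * μ q ∈ gradGroup G gr P)
    (hβQ : ∀ q ∈ W, β q ∈ gradGroup G gr (Q ∪ {0})) (hφ : ∀ q ∈ W, φ q = μ q * β q)
    {c : ℂ} (hc : c = Complex.I ∨ c = -Complex.I)
    (h0 : ∀ q ∈ W, wirt (-c) (logDer (E := E) (inCoord z φ) (z q)) ∈ gradSum gr (Q ∪ {0}))
    {m : ℤ} (hm : m ∈ P) {X : E} (hX : X ∈ gr m)
    (horb : ∀ q ∈ W, ∃ h ∈ gradGroup G gr {0}, wirt c (logDer (E := E) (inCoord z φ) (z q)) -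
      adE E ((φ q)⁻¹ * μ q) (adE E h X) ∈ gradSum gr (Q ∪ {0})) :
    ∃ (γ : ℂ → G) (V : Set M), IsOpen V ∧ p ∈ V ∧ (∀ y, γ y ∈ gradGroup G gr {0}) ∧ ∀ q ∈ V,
      ContMDiffAt 𝓘(ℝ, ℂ) 𝓘(ℝ, E) ∞ γ (z q) ∧ wirt (-c) (logDer (E := E) γ (z q)) = 0 ∧
      wirt c (logDer (E := E) (inCoord z μ) (z q)) = Complex.I • adE E (γ (z q)) X := by
  have sc : ∀ {f : M → G}, ContMDiffOn 𝓘(ℝ, ℂ) 𝓘(ℝ, E) ∞ f W → ∀ y ∈ z.target ∩ z.symm ⁻¹' W,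
      ContMDiffAt 𝓘(ℝ, ℂ) 𝓘(ℝ, E) ∞ (inCoord z f) y := fun hf y hy =>
    contMDiffAt_inCoord hz hy.1 (hf.contMDiffAt (hW.mem_nhds hy.2))
  obtain ⟨γ, hγ, hγ'⟩ := exists_gauss_lift hgr hPQ (φ := inCoord z φ) (μ := inCoord z μ)
    (β := inCoord z β) (x₀ := z p) (z.isOpen_inter_preimage_symm hW)
    ⟨z.map_source (hWz hp), by simpa [z.left_inv (hWz hp)] using hp⟩ (sc hμ)
    (fun y hy => (sc hβ y hy).mdifferentiableAt (by simp)) (fun y hy => hμP _ hy.2)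
    (fun y hy => hβQ _ hy.2) (fun y hy => hφ _ hy.2) hc
    (fun y hy => by simpa only [z.right_inv hy.1] using h0 _ hy.2) hm hX
    (fun y hy => by
      obtain ⟨h, hh, h'⟩ := horb _ hy.2
      rw [hφ _ hy.2, z.right_inv hy.1] at h'
      refine ⟨h, hh, ?_⟩
      have e : (μ (z.symm y) * β (z.symm y))⁻¹ * μ (z.symm y) = (β (z.symm y))⁻¹ := by group
      rwa [e] at h')
  obtain ⟨V, hV, hVo, hpV⟩ := mem_nhds_iff.1
    ((z.continuousAt (hWz hp)).eventually hγ')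
  exact ⟨γ, V, hVo, hpV, hγ, fun q hq => hV hq⟩

theorem exists_gaussData (hgr : IsGradation (E := E) (G := G) gr) {xm xp : E}
    (hxm : xm ∈ gr (-1)) (hxp : xp ∈ gr 1) (hz : z ∈ IsManifold.maximalAtlas 𝓘(ℂ, ℂ) ω M)
    {φ : M → G} (hφ : ContMDiff 𝓘(ℝ, ℂ) 𝓘(ℝ, E) ∞ φ) (hadm : Admissible (E := E) gr xm xp φ) {p : M}
    (hp : p ∈ z.source) {gp gm : G}
    (h₁ : ∃ n ∈ NPlus (E := E) (G := G) gr, ∃ b ∈ BMinus (E := E) (G := G) gr, φ p = gp * n * b)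
    (h₂ : ∃ n ∈ NMinus (E := E) (G := G) gr, ∃ b ∈ BPlus (E := E) (G := G) gr, φ p = gm * n * b) :
    ∃ W : Set M, IsOpen W ∧ p ∈ W ∧ W ⊆ z.source ∧
      Nonempty (GaussData (E := E) gr xm xp φ z W gp gm) := by
  obtain ⟨n₁, hn₁, b₁, hb₁, e₁⟩ := h₁
  obtain ⟨n₂, hn₂, b₂, hb₂, e₂⟩ := h₂
  rw [NPlus_eq] at hn₁
  rw [BMinus_eq] at hb₁
  rw [NMinus_eq] at hn₂
  rw [BPlus_eq] at hb₂
  obtain ⟨W₁, hW₁, hp₁, μp, νm, ηm, sμp, sνm, sηm, mμp, mνm, mηm, dp⟩ :=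
    isTriangular_pos_neg.exists_gauss hgr hφ hn₁ hb₁ e₁
  obtain ⟨W₂, hW₂, hp₂, μm, νp, ηp, sμm, sνp, sηp, mμm, mνp, mηp, dm⟩ :=
    isTriangular_neg_pos.exists_gauss hgr hφ hn₂ hb₂ e₂
  set W := W₁ ∩ W₂ ∩ z.source with hWdef
  have hW : IsOpen W := (hW₁.inter hW₂).inter z.open_source
  have hWz : W ⊆ z.source := inter_subset_right
  have i₁ : W ⊆ W₁ := fun q hq => hq.1.1
  have i₂ : W ⊆ W₂ := fun q hq => hq.1.2
  have hpW : p ∈ W := ⟨⟨hp₁, hp₂⟩, hp⟩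
  have cm : ∀ q ∈ W, @Eq E (dzComp (E := E) z (mcForm φ) q)
      (wirt (E := E) Complex.I (logDer (E := E) (inCoord z φ) (z q))) := fun q hq =>
    dzComp_mcForm hz (hWz hq) (hφ.mdifferentiable (by simp) q)
  have cp : ∀ q ∈ W, @Eq E (dzbarComp (E := E) z (mcForm φ) q)
      (wirt (E := E) (-Complex.I) (logDer (E := E) (inCoord z φ) (z q))) := fun q hq =>
    dzbarComp_mcForm hz (hWz hq) (hφ.mdifferentiable (by simp) q)
  -- admissibility at the element `μ₋ ∈ φ B̃₊` gives the orbit condition, and the grading condition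
  -- makes the other component of `μ₋^* θ` vanish; similarly for `μ₊ ∈ φ B̃₋`
  obtain ⟨γm, Vm, hVm, hpm, mγm, lm⟩ := exists_gauss_lift_coord hgr isTriangular_neg_pos hz hW hWz
    hpW (φ := φ) (sμm.mono i₂) (contMDiffOn_mul (sνp.mono i₂) (sηp.mono i₂)) (fun q _ => mμm q)
    (fun q _ => mul_mem (gradGroup_mono subset_union_left (mνp q))
      (gradGroup_mono subset_union_right (mηp q))) (fun q hq => by rw [dm q (i₂ hq), mul_assoc])
    (Or.inl rfl) (fun q hq => by
      rw [← cp q hq]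
      refine (sup_le ?_ ?_ : gr 0 ⊔ gr 1 ≤ _) (hadm.grading z hz q (hWz hq)).2 <;>
        exact fun y hy => mem_gradSum (by simp) hy) (m := -1) (by simp) hxm (fun q hq => by
      obtain ⟨y, ⟨h, hh, rfl⟩, -, hs⟩ := hadm.minus z hz q (hWz hq) (μm q) (by
        rw [BPlus_eq, dm q (i₂ hq)]
        have e : (μm q * νp q * ηp q)⁻¹ * μm q = (νp q * ηp q)⁻¹ := by group
        rw [e]
        exact inv_mem (mul_mem (gradGroup_mono subset_union_left (mνp q))
          (gradGroup_mono subset_union_right (mηp q))))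
      rw [HTilde_eq] at hh
      rw [bPlus_eq] at hs
      refine ⟨h, hh, ?_⟩
      rw [← cm q hq, ← Ad_eq_adE, ← Ad_eq_adE]
      exact hs)
  obtain ⟨γp, Vp, hVp, hpp, mγp, lp⟩ := exists_gauss_lift_coord hgr isTriangular_pos_neg hz hW hWz
    hpW (φ := φ) (sμp.mono i₁) (contMDiffOn_mul (sνm.mono i₁) (sηm.mono i₁)) (fun q _ => mμp q)
    (fun q _ => mul_mem (gradGroup_mono subset_union_left (mνm q))
      (gradGroup_mono subset_union_right (mηm q))) (fun q hq => by rw [dp q (i₁ hq), mul_assoc])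
    (Or.inr rfl) (fun q hq => by
      rw [neg_neg, ← cm q hq]
      refine (sup_le ?_ ?_ : gr (-1) ⊔ gr 0 ≤ _) (hadm.grading z hz q (hWz hq)).1 <;>
        exact fun y hy => mem_gradSum (by simp) hy) (m := 1) (by simp) hxp (fun q hq => by
      obtain ⟨y, ⟨h, hh, rfl⟩, -, hs⟩ := hadm.plus z hz q (hWz hq) (μp q) (by
        rw [BMinus_eq, dp q (i₁ hq)]
        have e : (μp q * νm q * ηm q)⁻¹ * μp q = (νm q * ηm q)⁻¹ := by group
        rw [e]
        exact inv_mem (mul_mem (gradGroup_mono subset_union_left (mνm q))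
          (gradGroup_mono subset_union_right (mηm q))))
      rw [HTilde_eq] at hh
      rw [bMinus_eq] at hs
      refine ⟨h, hh, ?_⟩
      rw [← cp q hq, ← Ad_eq_adE, ← Ad_eq_adE]
      exact hs)
  have hH : ∀ {g : G}, g ∈ gradGroup G gr {0} → g ∈ HTilde (E := E) (G := G) gr := fun hg => by
    rwa [HTilde_eq]
  refine ⟨W ∩ (Vm ∩ Vp), hW.inter (hVm.inter hVp), ⟨hpW, hpm, hpp⟩, fun q hq => hWz hq.1, ⟨?_⟩⟩
  have j₁ : W ∩ (Vm ∩ Vp) ⊆ W₁ := fun q hq => i₁ hq.1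
  have j₂ : W ∩ (Vm ∩ Vp) ⊆ W₂ := fun q hq => i₂ hq.1
  exact
    { μp := μp
      νm := νm
      ηm := ηm
      μm := μm
      νp := νp
      ηp := ηp
      γp := fun q => γp (z q)
      γm := fun q => γm (z q)
      smooth_μp := sμp.mono j₁
      smooth_νm := sνm.mono j₁
      smooth_ηm := sηm.mono j₁
      smooth_μm := sμm.mono j₂
      smooth_νp := sνp.mono j₂
      smooth_ηp := sηp.mono j₂
      μp_mem := fun q _ => mμp q
      νm_mem := fun q _ => mνm q
      ηm_mem := fun q _ => hH (mηm q)
      μm_mem := fun q _ => mμm q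
      νp_mem := fun q _ => mνp q
      ηp_mem := fun q _ => hH (mηp q)
      decomp_plus := fun q hq => dp q (j₁ hq)
      decomp_minus := fun q hq => dm q (j₂ hq)
      γp_mem := fun q _ => hH (mγp _)
      γm_mem := fun q _ => hH (mγm _)
      γp_antiholomorphic := by
        have h : ∀ q ∈ W ∩ (Vm ∩ Vp), _ := fun q hq =>
          antiholomorphic_of_coord hz (hWz hq.1) ((lp q hq.2.2).1.mdifferentiableAt (by simp))
            (by simpa only [neg_neg] using (lp q hq.2.2).2.1)
        exact ⟨fun q hq => (h q hq).1.mdifferentiableWithinAt, fun q hq => (h q hq).2⟩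
      γm_holomorphic := fun q hq =>
        (holomorphic_of_coord hz (hWz hq.1) ((lm q hq.2.1).1.mdifferentiableAt (by simp))
          (lm q hq.2.1).2.1).mdifferentiableWithinAt
      lift_plus := fun q hq => by
        have h1 := dzbarComp_mcForm hz (hWz hq.1) ((sμp.contMDiffAt
          (hW₁.mem_nhds (j₁ hq))).mdifferentiableAt (by simp))
        exact (h1.trans (lp q hq.2.2).2.2).trans
          (congrArg (fun X : E => Complex.I • X) (Ad_eq_adE (γp (z q)) xp).symm)
      lift_minus := fun q hq => by
        have h1 := dzComp_mcForm hz (hWz hq.1) ((sμm.contMDiffAt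
          (hW₂.mem_nhds (j₂ hq))).mdifferentiableAt (by simp))
        exact (h1.trans (lm q hq.2.1).2.2).trans
          (congrArg (fun X : E => Complex.I • X) (Ad_eq_adE (γm (z q)) xm).symm) }

end GaussDataExistence

end Toda

end

theorem theorem2p3
    {E : Type*} [NormedAddCommGroup E] [NormedSpace ℂ E] [FiniteDimensional ℂ E] [CompleteSpace E]
    {G : Type*} [TopologicalSpace G] [T2Space G] [ChartedSpace E G] [Group G]
    [LieGroup 𝓘(ℂ, E) ω G] [LieAlgebra.IsSemisimple ℂ (GroupLieAlgebra 𝓘(ℂ, E) G)]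
    {M : Type*} [TopologicalSpace M] [ChartedSpace ℂ M] [IsManifold 𝓘(ℂ, ℂ) ω M]
    (gr : ℤ → Submodule ℂ (GroupLieAlgebra 𝓘(ℂ, E) G)) (hgr : Toda.IsGradation gr)
    (xm xp : GroupLieAlgebra 𝓘(ℂ, E) G)
    (hxm : xm ∈ gr (-1)) (hxm0 : xm ≠ 0) (hxp : xp ∈ gr 1) (hxp0 : xp ≠ 0)
    (z : OpenPartialHomeomorph M ℂ) (hz : z ∈ IsManifold.maximalAtlas 𝓘(ℂ, ℂ) ω M) :
    (∀ φ : M → G, ContMDiff 𝓘(ℝ, ℂ) 𝓘(ℝ, E) ∞ φ → Toda.Admissible gr xm xp φ →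
      -- the decompositions and the lifts exist near every point, for every choice of
      -- base elements whose open cells contain the value of `φ`
      (∀ p ∈ z.source, ∀ gp gm : G,
        (∃ n ∈ Toda.NPlus gr, ∃ b ∈ Toda.BMinus gr, φ p = gp * n * b) →
        (∃ n ∈ Toda.NMinus gr, ∃ b ∈ Toda.BPlus gr, φ p = gm * n * b) →
        ∃ W : Set M, IsOpen W ∧ p ∈ W ∧ W ⊆ z.source ∧
          Nonempty (Toda.GaussData gr xm xp φ z W gp gm)) ∧
      -- and whatever they are, `γ` is obtained from `φ` by an `H̃`-gauge transformation `ψ`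
      (∀ (W : Set M), IsOpen W → W ⊆ z.source → ∀ (gp gm : G)
        (D : Toda.GaussData gr xm xp φ z W gp gm),
        (∀ q ∈ W, D.γ q ∈ Toda.HTilde gr) ∧
        (∃ ψ : M → G, ContMDiffOn 𝓘(ℝ, ℂ) 𝓘(ℝ, E) ∞ ψ W ∧
          (∀ q ∈ W, ψ q ∈ Toda.HTilde gr) ∧
          ∀ q ∈ W, ∀ v : TangentSpace 𝓘(ℝ, ℂ) q,
            Toda.gaugeTransform (E := E) ψ (Toda.mcForm φ) q v =
                Toda.mcForm (E := E) (fun r => φ r * ψ r) q v ∧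
            Toda.mcForm (E := E) (fun r => φ r * ψ r) q v =
                Toda.formOf z (Toda.todaMinus z xm D.γ) (Toda.todaPlus xp D.γ) q v) ∧
        Toda.TodaEquation z xm xp D.γ W)) ∧
    -- the zero curvature condition for a connection of this form is the Toda equation
    (∀ (W : Set M), IsOpen W → W ⊆ z.source → ∀ γ : M → G,
      ContMDiffOn 𝓘(ℝ, ℂ) 𝓘(ℝ, E) ∞ γ W → (∀ q ∈ W, γ q ∈ Toda.HTilde gr) →
      (Toda.ZeroCurvature z (Toda.todaMinus z xm γ) (Toda.todaPlus xp γ) W ↔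
        Toda.TodaEquation z xm xp γ W)) := by
  refine ⟨fun φ hφ hadm => ⟨fun p hp gp gm h₁ h₂ =>
    Toda.exists_gaussData hgr hxm hxp hz hφ hadm hp h₁ h₂, fun W hW hWz gp gm D =>
    ⟨fun q hq => ?_, ⟨Toda.GaussData.ψ D, Toda.GaussData.smooth_ψ D hz hW hWz, fun q hq => ?_,
      fun q hq v => ⟨?_, ?_⟩⟩, ?_⟩⟩, fun W hW hWz γ hγ _ => ?_⟩
  · exact mul_mem (mul_mem (inv_mem (D.γp_mem q hq))
      (mul_mem (D.ηm_mem q hq) (inv_mem (D.ηp_mem q hq)))) (D.γm_mem q hq)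
  · exact mul_mem (inv_mem (D.ηp_mem q hq)) (D.γm_mem q hq)
  · exact Toda.gaugeTransform_mcForm hz (hWz hq) hφ.contMDiffAt
      ((Toda.GaussData.smooth_ψ D hz hW hWz).contMDiffAt (hW.mem_nhds hq)) v
  · exact Toda.GaussData.mcForm_mul_ψ D hgr hxm hxp hz hW hWz hφ.contMDiffOn hadm.grading hq v
  · exact Toda.GaussData.toda D hgr hxm hxp hz hW hWz hφ.contMDiffOn hadm.grading
  · have key := fun q (hq : q ∈ W) => Toda.curvature_toda hz hW hγ hq (hWz hq) xm xp
    refine forall₂_congr fun q hq => ?_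
    rw [key q hq, sub_eq_zero, eq_comm]
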